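/- **Problem.** Let $m\ge 1$ and, for $i=1,\dots,m$, let $f_i(x,y)=\mathbb E_{\xi\sim\mathcal P_i}f_i(x,y;\xi)$ and $g_i(x,y)=\mathbb E_{\zeta\sim\mathcal Q_i}g_i(x,y;\zeta)$ for $x\in\mathbb R^{d_x}$, $y\in\mathbb R^{d_{y,i}}$ (all functions are measurable in the sample and integrable; $f_i,g_i$ are continuously differentiable, and all sample functions and all derivatives $\nabla_yg_i$ are differentiable in $(x,y)$). Put $y_i(x)=\arg\min_y g_i(x,y)$ and $F(x)=\frac1m\sum_{i=1}^m f_i(x,y_i(x))$. $\|\cdot\|$ is the Euclidean norm of vectors and the spectral norm of matrices. **Assumption 1.** $\lambda I\preceq\nabla^2_{yy}g_i(x,y)\preceq L_gI$ for all $i,x,y$, where $\lambda,L_g>0$. **Assumption 2.** For each sample, $\nabla_xf_i(\cdot;\xi)$, $\nabla_yf_i(\cdot;\xi)$, $\nabla_yg_i(\cdot;\zeta)$, $\nabla^2_{xy}g_i(\cdot;\zeta)$, $\nabla^2_{yy}g_i(\cdot;\zeta)$ are Lipschitz in $(x,y)$ with constants $L_{fx},L_{fy},L_{gy},L_{gxy},L_{gyy}$;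 $\|\nabla_xf_i(x,y)\|^2\le C_{fx}^2$ and $\|\nabla_yf_i(x,y)\|^2\le C_{fy}^2$; and each of these five stochastic quantities is an unbiased estimator of the corresponding derivative of $f_i$ or $g_i$, with variance at most $\sigma^2$. **PL condition.** $F$ has a global minimizer $x^*$ and $\mu(F(x)-F(x^*))\le\|\nabla F(x)\|^2$ for all $x\in\mathcal X$, where $\mu>0$ and $\mathcal X\subseteq\mathbb R^{d_x}$ is a set that contains the outputs $x$ of all stages below almost surely ($\mathcal X=\mathbb R^{d_x}$ is allowed and is the usual PL condition). **One stage (BSVRB$^{v1}$)** with parameters $\alpha,\bar\alpha,\beta,\hat\tau,\eta$ and length $T$, from $\Theta=(x_1,y_1,s_1,H_1,z_1)$: put $x_0=x_1$, $y_0=y_1$, $H_0=H_1$. For $t=1,\dots,T$ draw a uniform set $\mathcal I_t\subseteq\{1,\dots,m\}$ of $I$ blocks and, for each block, batches $\mathcal B_i^t$, $\widetilde{\mathcal B}_i^t$ of $B$ i.i.d. samples from $\mathcal P_i$, $\mathcal Q_i$; $h(\cdot;\mathcal B)$ is the average of $h$ over the batch. With $\gamma=\frac{m-I}{I(1-\alpha)}+1-\alpha$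 and $\bar\gamma$ defined likewise from $\bar\alpha$, for $i\in\mathcal I_t$, $$s_{i,t+1}=(1-\alpha)s_{i,t}+\alpha\nabla_yg_i(x_t,y_{i,t};\widetilde{\mathcal B}_i^t)+\gamma\big(\nabla_yg_i(x_t,y_{i,t};\widetilde{\mathcal B}_i^t)-\nabla_yg_i(x_{t-1},y_{i,t-1};\widetilde{\mathcal B}_i^t)\big),$$ $$H_{i,t+1}=S_\lambda\big[(1-\bar\alpha)H_{i,t}+\bar\alpha\nabla^2_{yy}g_i(x_t,y_{i,t};\widetilde{\mathcal B}_i^t)+\bar\gamma\big(\nabla^2_{yy}g_i(x_t,y_{i,t};\widetilde{\mathcal B}_i^t)-\nabla^2_{yy}g_i(x_{t-1},y_{i,t-1};\widetilde{\mathcal B}_i^t)\big)\big],$$ where $S_\lambda$ is the Frobenius projection onto the symmetric matrices $M\succeq\lambda I$; the other blocks of $s,H$ do not change. With $$G_t=\frac1I\sum_{i\in\mathcal I_t}\big[\nabla_xf_i(x_t,y_{i,t};\mathcal B_i^t)-\nabla^2_{xy}g_i(x_t,y_{i,t};\widetilde{\mathcal B}_i^t)H_{i,t}^{-1}\nabla_yf_i(x_t,y_{i,t};\mathcal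 B_i^t)\big]$$ and $\widetilde G_t$ the same expression with $x_{t-1},y_{i,t-1},H_{i,t-1}$ and the same draws, put $z_{t+1}=(1-\beta)(z_t-\widetilde G_t)+G_t$, $y_{t+1}=y_t-\tau\hat\tau s_t$, $x_{t+1}=x_t-\eta z_{t+1}$. The stage returns $(x_{\tilde t},y_{\tilde t},s_{\tilde t},H_{\tilde t},z_{\tilde t})$ for $\tilde t$ uniform on $\{1,\dots,T\}$. **RE-BSVRB$^{v1}$** runs stage $k=1,2,\dots$ from the output $\Theta_{k-1}$ of the previous stage, starting from a deterministic $\Theta_0$; all draws and all indices $\tilde t$ are independent. $x_{(k)}$ denotes the $x$-component of $\Theta_k$. **Theorem.** Let $0<\tau\le\frac{2}{3L_g}$. There are constants $L_F,C_8,C_9,c_{10},c_T>0$ that depend only on $\tau$, the constants of Assumptions 1–2 and an upper bound of the dimensions $d_{y,i}$, such that the following holds for all $1\le I\le m$ and $B\ge1$; put $\rho=\frac{\mathbb I(I<m)}{I}+\frac1B$ and $C_{10}=\frac mI c_{10}$. For all $D_0$ and $\alpha_1\in(0,\frac12]$ there is a constant $c_1>0$ (depending on these and on the preceding quantities, but not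 on $\mu$, $\epsilon$ or the problem instance) such that for every problem as above: (a) $F$ is differentiable and $\nabla F$ is $L_F$-Lipschitz. (b) Assume the PL condition. Let $\Theta_0$ consist of $x,y,s,H,z$ with $H_i$ symmetric, $H_i\succeq\lambda I$, and let each of $F(x)-F(x^*)$, $\sum_i\|y_i-y_i(x)\|^2$, $\sum_i\|s_i-\nabla_yg_i(x,y_i)\|^2$, $\sum_i\|H_i-\nabla^2_{yy}g_i(x,y_i)\|^2$ and $\big\|z-\frac1m\sum_i\big(\nabla_xf_i(x,y_i)-\nabla^2_{xy}g_i(x,y_i)H_i^{-1}\nabla_yf_i(x,y_i)\big)\big\|^2$ be at most $D_0$. Let stage $k$ have the parameters $\alpha_k=\bar\alpha_k=\beta_k$, $\hat\tau=\tau_k$, $\eta_k$, $T_k$. For $k=1$: $\tau_1=\sqrt{C_8\alpha_1}\,\frac Im$, $\eta_1=\min\{\frac1{2L_F},\sqrt{C_9I^2\alpha_1/m^2}\}$ and $$T_1\ge c_1\max\Big\{\frac m{\mu\eta_1},\frac m{\mu\beta_1}\rho^{-1},\frac m{\mu\tau_1}\rho^{-1}\Big\}.$$ Put $\epsilon_1=\frac{7C_{10}(\beta_1+\alpha_1+\bar\alpha_1)}{\mu}\rho$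 and $\epsilon_k=\epsilon_1/2^{k-1}$. For $k\ge2$: $0<\alpha_k\le\frac{\mu\epsilon_k}{21C_{10}}\rho^{-1}$, $\tau_k=\sqrt{C_8\alpha_k}\,\frac Im$, $\eta_k=\sqrt{C_9}\sqrt{\min\{\tau_k^2,\alpha_kI^2/m^2\}}$ and $$T_k\ge c_T\frac mI\max\Big\{\frac1{\mu\eta_k},\frac1{\beta_k},\frac1{\tau_k}\Big\}.$$ (In particular, the least such $T_k$ are allowed; they are of the order of the right-hand sides.) Then for every $\epsilon>0$ and every integer $K\ge1$ with $K\ge1+\log_2(\epsilon_1/\epsilon)$, so that $K=O(\log(\epsilon_1/\epsilon))$ stages suffice, $F(x_{(K)})-F(x^*)$ is integrable and $\mathbb E[F(x_{(K)})-F(x^*)]\le\epsilon$. -/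

import Mathlib

open MeasureTheory ProbabilityTheory

universe u v w

noncomputable section

namespace BSVRB

/-- Euclidean space of dimension `d`. -/
abbrev Vec (d : ℕ) := EuclideanSpace ℝ (Fin d)

/-- Real `d' × d` matrices, as linear maps; the norm is the spectral norm. -/
abbrev Mat (d d' : ℕ) := Vec d →L[ℝ] Vec d'

/-! ### Partial derivatives -/

/-- The partial gradient `∇_x h(x, y)`. -/
def gradX {a b : ℕ} (h : Vec a → Vec b → ℝ) (x : Vec a) (y : Vec b) : Vec a :=
  gradient (fun x' => h x' y) x

/-- The partial gradient `∇_y h(x, y)`. -/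
def gradY {a b : ℕ} (h : Vec a → Vec b → ℝ) (x : Vec a) (y : Vec b) : Vec b :=
  gradient (fun y' => h x y') y

/-- The Hessian `∇²_yy h(x, y)`. -/
def hessYY {a b : ℕ} (h : Vec a → Vec b → ℝ) (x : Vec a) (y : Vec b) : Mat b b :=
  fderiv ℝ (fun y' => gradY h x y') y

/-- The `a × b` matrix `∇²_xy h(x, y)` with entries `∂²h / ∂x_j ∂y_l`: the transpose of the
Jacobian of `∇_y h` with respect to `x`. -/
def jacXY {a b : ℕ} (h : Vec a → Vec b → ℝ) (x : Vec a) (y : Vec b) : Mat b a :=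
  ContinuousLinearMap.adjoint (fderiv ℝ (fun x' => gradY h x' y) x)

/-! ### The multi-block bilevel problem -/

/-- The data of a multi-block bilevel problem with `m` blocks: the distributions `P i`, `Q i` of
the samples `ξ`, `ζ`, and the sample functions `f i x y ξ`, `g i x y ζ`. -/
structure Problem (m dx : ℕ) (dy : Fin m → ℕ) (Ξ : Type u) (Z : Type v)
    [MeasurableSpace Ξ] [MeasurableSpace Z] where
  P : Fin m → Measure Ξ
  Q : Fin m → Measure Z
  f : (i : Fin m) → Vec dx → Vec (dy i) → Ξ → ℝ
  g : (i : Fin m) → Vec dx → Vec (dy i) → Z → ℝ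

section

variable {m dx : ℕ} {dy : Fin m → ℕ} {Ξ : Type u} {Z : Type v}
  [MeasurableSpace Ξ] [MeasurableSpace Z]

/-- The upper-level function `f_i(x, y) = E_{ξ ∼ P_i} f_i(x, y; ξ)`. -/
def Problem.fE (p : Problem m dx dy Ξ Z) (i : Fin m) (x : Vec dx) (y : Vec (dy i)) : ℝ :=
  ∫ ξ, p.f i x y ξ ∂(p.P i)

/-- The lower-level function `g_i(x, y) = E_{ζ ∼ Q_i} g_i(x, y; ζ)`. -/
def Problem.gE (p : Problem m dx dy Ξ Z) (i : Fin m) (x : Vec dx) (y : Vec (dy i)) : ℝ :=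
  ∫ ζ, p.g i x y ζ ∂(p.Q i)

open Classical in
/-- The lower-level solution `y_i(x) = argmin_y g_i(x, y)` (and `0` if there is no minimizer, which
is excluded by strong convexity). -/
def Problem.ySol (p : Problem m dx dy Ξ Z) (i : Fin m) (x : Vec dx) : Vec (dy i) :=
  if h : ∃ y, ∀ y', p.gE i x y ≤ p.gE i x y' then h.choose else 0

/-- The objective `F(x) = (1/m) ∑_i f_i(x, y_i(x))`. -/
def Problem.F (p : Problem m dx dy Ξ Z) (x : Vec dx) : ℝ :=
  (1 / (m : ℝ)) * ∑ i, p.fE i x (p.ySol i x)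

/-! ### Assumptions -/

/-- The standing conventions: the samples follow probability distributions, the expectations that
define `f_i` and `g_i` exist, and all partial derivatives that are used exist. -/
structure Problem.Standing (p : Problem m dx dy Ξ Z) : Prop where
  isProb_P : ∀ i, IsProbabilityMeasure (p.P i)
  isProb_Q : ∀ i, IsProbabilityMeasure (p.Q i)
  measurable_f : ∀ i x y, Measurable (p.f i x y)
  measurable_g : ∀ i x y, Measurable (p.g i x y)
  integrable_f : ∀ i x y, Integrable (p.f i x y) (p.P i)
  integrable_g : ∀ i x y, Integrable (p.g i x y) (p.Q i)
  diff_f : ∀ i ξ, Differentiable ℝ (fun q : Vec dx × Vec (dy i) => p.f i q.1 q.2 ξ)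
  diff_g : ∀ i ζ, Differentiable ℝ (fun q : Vec dx × Vec (dy i) => p.g i q.1 q.2 ζ)
  diff_gradY_g : ∀ i ζ, Differentiable ℝ
    (fun q : Vec dx × Vec (dy i) => gradY (fun x y => p.g i x y ζ) q.1 q.2)
  diff_fE : ∀ i, ContDiff ℝ 1 (fun q : Vec dx × Vec (dy i) => p.fE i q.1 q.2)
  diff_gE : ∀ i, ContDiff ℝ 1 (fun q : Vec dx × Vec (dy i) => p.gE i q.1 q.2)
  diff_gradY_gE : ∀ i, Differentiable ℝ
    (fun q : Vec dx × Vec (dy i) => gradY (p.gE i) q.1 q.2)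

/-- The regularity constants of the problem. -/
structure Consts where
  lam : ℝ
  Lg : ℝ
  Lfx : ℝ
  Lfy : ℝ
  Lgy : ℝ
  Lgxy : ℝ
  Lgyy : ℝ
  Cfx : ℝ
  Cfy : ℝ
  sigma : ℝ
  lam_pos : 0 < lam
  Lg_pos : 0 < Lg
  Lfx_nonneg : 0 ≤ Lfx
  Lfy_nonneg : 0 ≤ Lfy
  Lgy_nonneg : 0 ≤ Lgy
  Lgxy_nonneg : 0 ≤ Lgxy
  Lgyy_nonneg : 0 ≤ Lgyy
  Cfx_nonneg : 0 ≤ Cfx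
  Cfy_nonneg : 0 ≤ Cfy
  sigma_nonneg : 0 ≤ sigma

/-- `g_i(x, ·)` is `L_g`-smooth and `λ`-strongly convex: `L_g I ⪰ ∇²_yy g_i(x, y) ⪰ λ I`. -/
def Problem.Assumption1 (p : Problem m dx dy Ξ Z) (c : Consts) : Prop :=
  ∀ i x y, (hessYY (p.gE i) x y - c.lam • ContinuousLinearMap.id ℝ (Vec (dy i))).IsPositive ∧
    (c.Lg • ContinuousLinearMap.id ℝ (Vec (dy i)) - hessYY (p.gE i) x y).IsPositive

/-- `h` is `L`-Lipschitz with respect to `(x, y)`, for the Euclidean norm of the pair. -/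
def JointLip {a b : ℕ} {V : Type*} [NormedAddCommGroup V] (L : ℝ) (h : Vec a → Vec b → V) : Prop :=
  ∀ x y x' y', ‖h x y - h x' y'‖ ≤ L * Real.sqrt (‖x - x'‖ ^ 2 + ‖y - y'‖ ^ 2)

/-- The one-sample estimator `h` of `v` is unbiased, with variance bounded by `σ²`. -/
def UnbiasedVar {S : Type*} [MeasurableSpace S] {V : Type*} [NormedAddCommGroup V]
    [NormedSpace ℝ V] (ν : Measure S) (h : S → V) (v : V) (σ : ℝ) : Prop :=
  MemLp h 2 ν ∧ ∫ s, h s ∂ν = v ∧ ∫ s, ‖h s - v‖ ^ 2 ∂ν ≤ σ ^ 2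

/-- Lipschitz stochastic gradients, Jacobians and Hessians, bounded gradients of `f_i`, and
unbiased stochastic estimators of bounded variance. -/
structure Problem.Assumption2 (p : Problem m dx dy Ξ Z) (c : Consts) : Prop where
  lip_fx : ∀ i ξ, JointLip c.Lfx (gradX fun x y => p.f i x y ξ)
  lip_fy : ∀ i ξ, JointLip c.Lfy (gradY fun x y => p.f i x y ξ)
  lip_gy : ∀ i ζ, JointLip c.Lgy (gradY fun x y => p.g i x y ζ)
  lip_gxy : ∀ i ζ, JointLip c.Lgxy (jacXY fun x y => p.g i x y ζ)
  lip_gyy : ∀ i ζ, JointLip c.Lgyy (hessYY fun x y => p.g i x y ζ)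
  bdd_fx : ∀ i x y, ‖gradX (p.fE i) x y‖ ^ 2 ≤ c.Cfx ^ 2
  bdd_fy : ∀ i x y, ‖gradY (p.fE i) x y‖ ^ 2 ≤ c.Cfy ^ 2
  var_fx : ∀ i x y, UnbiasedVar (p.P i) (fun ξ => gradX (fun x y => p.f i x y ξ) x y)
    (gradX (p.fE i) x y) c.sigma
  var_fy : ∀ i x y, UnbiasedVar (p.P i) (fun ξ => gradY (fun x y => p.f i x y ξ) x y)
    (gradY (p.fE i) x y) c.sigma
  var_gy : ∀ i x y, UnbiasedVar (p.Q i) (fun ζ => gradY (fun x y => p.g i x y ζ) x y)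
    (gradY (p.gE i) x y) c.sigma
  var_gxy : ∀ i x y, UnbiasedVar (p.Q i) (fun ζ => jacXY (fun x y => p.g i x y ζ) x y)
    (jacXY (p.gE i) x y) c.sigma
  var_gyy : ∀ i x y, UnbiasedVar (p.Q i) (fun ζ => hessYY (fun x y => p.g i x y ζ) x y)
    (hessYY (p.gE i) x y) c.sigma

/-- The Polyak–Łojasiewicz condition with constant `μ` on the set `X`, where `xstar` is a global
minimizer of `F`; for `X = Set.univ` this is the usual PL condition. -/
def Problem.PLOn (p : Problem m dx dy Ξ Z) (μ : ℝ) (xstar : Vec dx) (X : Set (Vec dx)) : Prop :=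
  ∀ x ∈ X, μ * (p.F x - p.F xstar) ≤ ‖gradient p.F x‖ ^ 2

/-! ### The algorithm -/

/-- The symmetric matrices `M ⪰ lam I`. -/
def matGe (d : ℕ) (lam : ℝ) : Set (Mat d d) :=
  {M | (M - lam • ContinuousLinearMap.id ℝ (Vec d)).IsPositive}

/-- The square of the Frobenius norm. -/
def frobSq {d : ℕ} (A : Mat d d) : ℝ := ∑ j, ‖A (EuclideanSpace.single j 1)‖ ^ 2

open Classical in
/-- The projection `S_lam[A]` onto `{M ⪰ lam I}`, for the Frobenius norm. -/
def matProj {d : ℕ} (lam : ℝ) (A : Mat d d) : Mat d d :=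
  if h : ∃ M ∈ matGe d lam, ∀ N ∈ matGe d lam, frobSq (A - M) ≤ frobSq (A - N)
  then h.choose else 0

/-- The variables `(x, y, s, H, z)` of the algorithm. -/
structure State (dx : ℕ) {m : ℕ} (dy : Fin m → ℕ) where
  x : Vec dx
  y : (i : Fin m) → Vec (dy i)
  s : (i : Fin m) → Vec (dy i)
  H : (i : Fin m) → Mat (dy i) (dy i)
  z : Vec dx

/-- The step-size parameters of one stage. -/
structure Params where
  alpha : ℝ
  alphaBar : ℝ
  beta : ℝ
  tauT : ℝ
  eta : ℝ

/-- What is drawn in one iteration: the set of sampled blocks, the mini-batches `ℬ_i ∼ P_i` and the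
mini-batches `ℬ̃_i ∼ Q_i`. (Mini-batches are drawn for all blocks; only those of sampled blocks are
used.) -/
abbrev Draw (m B : ℕ) (Ξ : Type u) (Z : Type v) :=
  Finset (Fin m) × (Fin m → Fin B → Ξ) × (Fin m → Fin B → Z)

/-- The average over a mini-batch. -/
def batchMean {B : ℕ} {S V : Type*} [AddCommGroup V] [Module ℝ V] (b : Fin B → S) (h : S → V) : V :=
  (1 / (B : ℝ)) • ∑ j, h (b j)

/-- The factor `γ = (m - I) / (I (1 - α)) + (1 - α)` of the error correction. -/
def gammaOf (m I : ℕ) (α : ℝ) : ℝ := ((m : ℝ) - I) / (I * (1 - α)) + (1 - α)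

/-- The block-and-batch estimator `(1/I) ∑_{i ∈ ℐ} [∇_x f_i(x, y_i; ℬ_i)
- ∇²_xy g_i(x, y_i; ℬ̃_i) H_i⁻¹ ∇_y f_i(x, y_i; ℬ_i)]` at `θ = (x, y, s, H, z)`. -/
def Problem.gradEst (p : Problem m dx dy Ξ Z) (I : ℕ) {B : ℕ} (d : Draw m B Ξ Z)
    (θ : State dx dy) : Vec dx :=
  (1 / (I : ℝ)) • ∑ i ∈ d.1,
    (batchMean (d.2.1 i) (fun ξ => gradX (fun x y => p.f i x y ξ) θ.x (θ.y i)) -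
      batchMean (d.2.2 i) (fun ζ => jacXY (fun x y => p.g i x y ζ) θ.x (θ.y i))
        ((θ.H i).inverse
          (batchMean (d.2.1 i) (fun ξ => gradY (fun x y => p.f i x y ξ) θ.x (θ.y i)))))

/-- One iteration: from the variables `prev`, `cur` with the indices `t - 1`, `t` and the draw `d`
of iteration `t` to the variables with index `t + 1`. -/
def Problem.step (p : Problem m dx dy Ξ Z) (I : ℕ) {B : ℕ} (lam τ : ℝ) (a : Params)
    (d : Draw m B Ξ Z) (prev cur : State dx dy) : State dx dy :=
  let z' : Vec dx := (1 - a.beta) • (cur.z - p.gradEst I d prev) + p.gradEst I d cur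
  { x := cur.x - a.eta • z'
    y := fun i => cur.y i - (τ * a.tauT) • cur.s i
    s := fun i =>
      let new := batchMean (d.2.2 i) (fun ζ => gradY (fun x y => p.g i x y ζ) cur.x (cur.y i))
      let old := batchMean (d.2.2 i) (fun ζ => gradY (fun x y => p.g i x y ζ) prev.x (prev.y i))
      if i ∈ d.1 then
        (1 - a.alpha) • cur.s i + a.alpha • new + gammaOf m I a.alpha • (new - old)
      else cur.s i
    H := fun i =>
      let new := batchMean (d.2.2 i) (fun ζ => hessYY (fun x y => p.g i x y ζ) cur.x (cur.y i))
      let old := batchMean (d.2.2 i) (fun ζ => hessYY (fun x y => p.g i x y ζ) prev.x (prev.y i))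
      if i ∈ d.1 then
        matProj lam ((1 - a.alphaBar) • cur.H i + a.alphaBar • new
          + gammaOf m I a.alphaBar • (new - old))
      else cur.H i
    z := z' }

/-- The iterates of one stage: the value at `n` holds the variables with the indices `n` and
`n + 1`. The stage starts from `θ`, with `x_0 = x_1`, `y_0 = y_1`, `H_0 = H_1`; iteration `t`
uses the draw `d t`. -/
def Problem.iter (p : Problem m dx dy Ξ Z) (I : ℕ) {B : ℕ} (lam τ : ℝ) (a : Params)
    (d : ℕ → Draw m B Ξ Z) (θ : State dx dy) : ℕ → State dx dy × State dx dy
  | 0 => (θ, θ)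
  | n + 1 =>
    let r := p.iter I lam τ a d θ n
    (r.2, p.step I lam τ a (d (n + 1)) r.1 r.2)

/-- The restarted method: `Θ_0 = θ`, and `Θ_k` consists of the variables with the index `tt k` of
the stage that is run with the parameters `a k` from `Θ_{k-1}`. Iteration `t` of stage `k` uses the
draw `d k t`. -/
def Problem.restarted (p : Problem m dx dy Ξ Z) (I : ℕ) {B : ℕ} (lam τ : ℝ) (a : ℕ → Params)
    (d : ℕ → ℕ → Draw m B Ξ Z) (tt : ℕ → ℕ) (θ : State dx dy) : ℕ → State dx dy
  | 0 => θ
  | k + 1 =>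
    (p.iter I lam τ (a (k + 1)) (d (k + 1)) (p.restarted I lam τ a d tt θ k) (tt (k + 1) - 1)).2

/-- The law of the draw of one iteration: a uniformly distributed set of `I` blocks and, independent
of it and of each other, mini-batches of `B` independent samples from each `P_i` and `Q_i`. -/
def Problem.drawLaw (p : Problem m dx dy Ξ Z) (I B : ℕ) : Measure (Draw m B Ξ Z) :=
  (uniformOn {J : Finset (Fin m) | J.card = I}).prod
    ((Measure.pi fun i => Measure.pi fun _ : Fin B => p.P i).prod
      (Measure.pi fun i => Measure.pi fun _ : Fin B => p.Q i))

/-- The randomness of the restarted method on a probability space: the draws `d k t` have the law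
`drawLaw`, the output index `tt k` of stage `k` is uniform on `{1, …, T k}`, and all of these are
mutually independent. -/
structure Problem.IsSampling (p : Problem m dx dy Ξ Z) (I B : ℕ) (T : ℕ → ℕ)
    {Ω : Type w} [MeasurableSpace Ω] (Pr : Measure Ω)
    (d : ℕ → ℕ → Ω → Draw m B Ξ Z) (tt : ℕ → Ω → ℕ) : Prop where
  measurable_draw : ∀ k t, Measurable (d k t)
  measurable_index : ∀ k, Measurable (tt k)
  law_draw : ∀ k t, Pr.map (d k t) = p.drawLaw I B
  law_index : ∀ k, 1 ≤ k → Pr.map (tt k) = uniformOn (Set.Icc 1 (T k))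
  indep_draw : iIndepFun (fun (q : ℕ × ℕ) => d q.1 q.2) Pr
  indep_index : iIndepFun tt Pr
  indep_draw_index : IndepFun (fun ω (q : ℕ × ℕ) => d q.1 q.2 ω) (fun ω (k : ℕ) => tt k ω) Pr

/-! ### Parameters and initial errors -/

/-- `𝕀(I < m) / I + 1 / B`. -/
def noise (m I B : ℕ) : ℝ := (if I < m then 1 else 0) / (I : ℝ) + 1 / (B : ℝ)

/-- `ε_k = ε_1 / 2^(k-1)`, where `ε_1 = (7 C₁₀ (β₁ + α₁ + ᾱ₁) / μ) (𝕀(I < m) / I + 1 / B)` and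
`β₁ = α₁ = ᾱ₁`. -/
def epsStage (m I B : ℕ) (C10 μ α1 : ℝ) (k : ℕ) : ℝ :=
  (7 * C10 * (α1 + α1 + α1) / μ * noise m I B) / 2 ^ (k - 1)

/-- The scaled step size `τ_k = √(C₈ α_k) I / m` of the lower level. -/
def tauStage (m I : ℕ) (C8 α : ℝ) : ℝ := Real.sqrt (C8 * α) * I / m

/-- The upper-level step size: `η_1 = min {1/(2 L_F), √(C₉ I² α₁ / m²)}` and
`η_k = √C₉ √(min {τ_k², α_k I² / m²})` for `k ≥ 2`. -/
def etaStage (m I : ℕ) (LF C8 C9 α : ℝ) (k : ℕ) : ℝ :=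
  if k ≤ 1 then min (1 / (2 * LF)) (Real.sqrt (C9 * (I : ℝ) ^ 2 * α / (m : ℝ) ^ 2))
  else Real.sqrt C9 *
    Real.sqrt (min (tauStage m I C8 α ^ 2) (α * (I : ℝ) ^ 2 / (m : ℝ) ^ 2))

/-- The parameters of stage `k`, with `α_k = ᾱ_k = β_k`. -/
def stageParams (m I : ℕ) (LF C8 C9 : ℝ) (α : ℕ → ℝ) (k : ℕ) : Params where
  alpha := α k
  alphaBar := α k
  beta := α k
  tauT := tauStage m I C8 (α k)
  eta := etaStage m I LF C8 C9 (α k) k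

/-- `(1/m) ∑_i [∇_x f_i(x, y_i) - ∇²_xy g_i(x, y_i) H_i⁻¹ ∇_y f_i(x, y_i)]`, the mean of the
estimator `gradEst`. -/
def Problem.gradMean (p : Problem m dx dy Ξ Z) (θ : State dx dy) : Vec dx :=
  (1 / (m : ℝ)) • ∑ i, (gradX (p.fE i) θ.x (θ.y i) -
    jacXY (p.gE i) θ.x (θ.y i) ((θ.H i).inverse (gradY (p.fE i) θ.x (θ.y i))))

/-- The initial variables are admissible, with errors at most `D0`: the Hessian estimators lie in
the range of the projection, and the optimality gap and the squared errors of `z`, `y`, `s` and `H`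
are bounded by `D0`. -/
structure Problem.InitBound (p : Problem m dx dy Ξ Z) (lam : ℝ) (xstar : Vec dx) (θ : State dx dy)
    (D0 : ℝ) : Prop where
  hess_mem : ∀ i, θ.H i ∈ matGe (dy i) lam
  gap : p.F θ.x - p.F xstar ≤ D0
  err_z : ‖θ.z - p.gradMean θ‖ ^ 2 ≤ D0
  err_y : ∑ i, ‖θ.y i - p.ySol i θ.x‖ ^ 2 ≤ D0
  err_s : ∑ i, ‖θ.s i - gradY (p.gE i) θ.x (θ.y i)‖ ^ 2 ≤ D0
  err_H : ∑ i, ‖θ.H i - hessYY (p.gE i) θ.x (θ.y i)‖ ^ 2 ≤ D0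

end

end BSVRB

end

namespace BSVRB

open scoped RealInnerProductSpace

/-! ### Matrices bounded below -/

section matGe

variable {d : ℕ} {lam : ℝ} {A A' : Mat d d}

-- The proof follows one potential function of two consecutive states, the previous and the current
-- one. The estimators `s`, `H`, `z` are refreshed at a point that has become the previous one by
-- the time the update is complete. Hence `errS`, `errH`, `errZ` compare the newer estimators with
-- the older point, and `incX`, `incY`, `incH` measure the drift.
--
-- Regularity. Strong convexity makes the solution map y_i(x) exist and be Lipschitz, and
-- linearizing ∇_y g_i(x, y_i(x)) = 0 gives its derivative (`hasFDerivAt_ySol`). By the chain rule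
-- ∇F is the mean of `blockGrad` at y_i(x) and the true Hessian (`hasGradientAt_F`). Since
-- `blockGrad` is Lipschitz in (x, y, H) while H ⪰ λI, ∇F is Lipschitz, and the distance of `z` from
-- ∇F is controlled by `errZ`, `errY`, `errH` and the increments.
--
-- One iteration. The descent inequality `objective_step` and the contraction `lower_step` hold for
-- every draw and leave negative multiples of the squared increments of x and y. On average over the
-- draw the estimators contract up to increments and variance (`errS_step`, `errH_step`,
-- `errZ_step`). A block is refreshed only with probability q = I/m; the factor γ is exactly the one
-- for which the cross term between old error and drift cancels when the two cases are averaged, so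
-- that the squared error contracts by 1 - αq. The projection of `H` does no harm because it is
-- nonexpansive in the Frobenius norm. The weights of the potential are balanced in
-- `StepSizes.pathwise` and `StepSizes.expected`; the outcome is `potential_step`: expected new
-- potential + η · gain ≤ old potential + 16K⁴ηαρ, where the gain contains half the squared gradient
-- norm and every error of the current pair.
--
-- One stage. Telescoping and the uniform output index bound the expected gain at the output by
-- (initial potential)/(ηT) + 16K⁴αρ (`lintegral_gain_le`).
--
-- Restarting. Under the PL condition the optimality gap is at most 2/μ times the gain, and the
-- other terms of the potential at a restart are also multiples of the last gain
-- (`potential_restart_le`). Hence a stage of the prescribed length reduces the inherited part to an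
-- eighth, while the bound on α_k keeps the noise below 1/21 of the level ε_k μ; together the bound
-- on the gain halves. The first stage starts from a deterministic potential. Its constant must not
-- depend on μ, which is possible because smoothness and PL with μ > 2L_F force the gap to vanish
-- (`eq_min_of_lt`), and otherwise 1 ≤ 2L_F/μ.

lemma matGe_inner (hA : A ∈ matGe d lam) (v : Vec d) : lam * ‖v‖ ^ 2 ≤ ⟪A v, v⟫ := by
  have h := hA.2 v
  rw [ContinuousLinearMap.reApplyInnerSelf_apply] at h
  simp only [_root_.sub_apply, _root_.smul_apply,
    ContinuousLinearMap.id_apply, inner_sub_left, inner_smul_left, real_inner_self_eq_norm_sq] at h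
  simp at h
  linarith

lemma matGe_symm (hA : A ∈ matGe d lam) (v w : Vec d) : ⟪A v, w⟫ = ⟪v, A w⟫ := by
  have h := hA.1 v w
  simp [inner_sub_left, inner_sub_right, inner_smul_left, inner_smul_right] at h
  linarith

lemma mem_matGe_of_symm (h1 : ∀ v w : Vec d, ⟪A v, w⟫ = ⟪v, A w⟫)
    (h2 : ∀ v : Vec d, lam * ‖v‖ ^ 2 ≤ ⟪A v, v⟫) : A ∈ matGe d lam := by
  refine ⟨fun v w => ?_, fun v => ?_⟩
  · simp [inner_sub_left, inner_sub_right, inner_smul_left, inner_smul_right, h1 v w]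
  · rw [ContinuousLinearMap.reApplyInnerSelf_apply]
    have := h2 v
    simp [inner_sub_left, inner_smul_left]
    linarith

lemma matGe_norm_ge (hA : A ∈ matGe d lam) (v : Vec d) : lam * ‖v‖ ≤ ‖A v‖ := by
  have h := matGe_inner hA v
  have h2 := real_inner_le_norm (A v) v
  rcases (norm_nonneg v).eq_or_lt with h0 | h0
  · rw [← h0]; simp
  · nlinarith

/-- Coercivity gives injectivity, which suffices in finite dimension. It ensures that `inverse` is a
genuine inverse on admissible matrices and not its default value 0. -/
lemma matGe_exists_equiv (hlam : 0 < lam) (hA : A ∈ matGe d lam) :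
    ∃ e : Vec d ≃L[ℝ] Vec d, (e : Vec d →L[ℝ] Vec d) = A := by
  have hinj : Function.Injective A := by
    rw [injective_iff_map_eq_zero]
    intro v hv
    have := matGe_norm_ge hA v
    rw [hv, norm_zero] at this
    have h0 := norm_nonneg v
    exact norm_eq_zero.1 (le_antisymm (by nlinarith) h0)
  refine ⟨(LinearEquiv.ofInjectiveEndo (A : Vec d →ₗ[ℝ] Vec d) hinj).toContinuousLinearEquiv, ?_⟩
  ext v
  simp

lemma matGe_apply_inverse (hlam : 0 < lam) (hA : A ∈ matGe d lam) (v : Vec d) :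
    A (A.inverse v) = v := by
  obtain ⟨e, rfl⟩ := matGe_exists_equiv hlam hA
  simp

lemma matGe_inverse_apply (hlam : 0 < lam) (hA : A ∈ matGe d lam) (v : Vec d) :
    A.inverse (A v) = v := by
  obtain ⟨e, rfl⟩ := matGe_exists_equiv hlam hA
  simp

lemma matGe_norm_inverse_le (hlam : 0 < lam) (hA : A ∈ matGe d lam) (v : Vec d) :
    ‖A.inverse v‖ ≤ lam⁻¹ * ‖v‖ := by
  have h := matGe_norm_ge hA (A.inverse v)
  rw [matGe_apply_inverse hlam hA] at h
  rw [inv_mul_eq_div, le_div_iff₀ hlam]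
  linarith

lemma matGe_inverse_symm (hlam : 0 < lam) (hA : A ∈ matGe d lam) (v w : Vec d) :
    ⟪A.inverse v, w⟫ = ⟪v, A.inverse w⟫ := by
  conv_lhs => rw [← matGe_apply_inverse hlam hA w]
  rw [← matGe_symm hA, matGe_apply_inverse hlam hA]

/-- Resolvent identity: A⁻¹ - A'⁻¹ = A⁻¹ (A' - A) A'⁻¹. -/
lemma matGe_inverse_sub_le (hlam : 0 < lam) (hA : A ∈ matGe d lam) (hA' : A' ∈ matGe d lam)
    (v : Vec d) : ‖A.inverse v - A'.inverse v‖ ≤ lam⁻¹ * lam⁻¹ * ‖A - A'‖ * ‖v‖ := by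
  have h : A.inverse v - A'.inverse v = A.inverse ((A' - A) (A'.inverse v)) := by
    simp only [_root_.sub_apply, map_sub, matGe_inverse_apply hlam hA,
      matGe_apply_inverse hlam hA']
  rw [h]
  have hl : 0 ≤ lam⁻¹ := (inv_pos.2 hlam).le
  calc _ ≤ lam⁻¹ * (‖A' - A‖ * (lam⁻¹ * ‖v‖)) := by
        refine (matGe_norm_inverse_le hlam hA _).trans ?_
        gcongr
        refine ((A' - A).le_opNorm _).trans ?_
        gcongr
        exact matGe_norm_inverse_le hlam hA' v
    _ = _ := by rw [norm_sub_rev]; ring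

end matGe

/-! ### Jointly Lipschitz functions -/

section JointLip

variable {a b : ℕ} {V : Type*} [NormedAddCommGroup V] {L : ℝ} {h : Vec a → Vec b → V}

lemma JointLip.sq_le (hh : JointLip L h) (x : Vec a) (y : Vec b) (x' : Vec a) (y' : Vec b) :
    ‖h x y - h x' y'‖ ^ 2 ≤ L ^ 2 * (‖x - x'‖ ^ 2 + ‖y - y'‖ ^ 2) := by
  have h1 := hh x y x' y'
  calc _ ≤ (L * Real.sqrt (‖x - x'‖ ^ 2 + ‖y - y'‖ ^ 2)) ^ 2 := by gcongr
    _ = _ := by rw [mul_pow, Real.sq_sqrt (by positivity)]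

lemma JointLip.le_left (hh : JointLip L h) (x x' : Vec a) (y : Vec b) :
    ‖h x y - h x' y‖ ≤ L * ‖x - x'‖ := by
  simpa using hh x y x' y

lemma JointLip.le_right (hh : JointLip L h) (x : Vec a) (y y' : Vec b) :
    ‖h x y - h x y'‖ ≤ L * ‖y - y'‖ := by
  simpa using hh x y x y'

lemma JointLip.continuous (hh : JointLip L h) :
    Continuous fun q : Vec a × Vec b => h q.1 q.2 := by
  rw [continuous_iff_continuousAt]
  intro q
  rw [ContinuousAt, tendsto_iff_norm_sub_tendsto_zero]
  have hc : Continuous fun q' : Vec a × Vec b =>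
      L * Real.sqrt (‖q'.1 - q.1‖ ^ 2 + ‖q'.2 - q.2‖ ^ 2) := by fun_prop
  have h0 := hc.tendsto q
  simp only [sub_self, norm_zero] at h0
  norm_num at h0
  exact squeeze_zero (fun _ => norm_nonneg _) (fun q' => hh q'.1 q'.2 q.1 q.2) h0

/-- Transfers the Lipschitz constants, which are assumed for samples, to the mean functions. -/
lemma JointLip.integral {S : Type*} [MeasurableSpace S] {ν : Measure S} [IsProbabilityMeasure ν]
    [NormedSpace ℝ V] {hs : S → Vec a → Vec b → V} (hL : ∀ s, JointLip L (hs s))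
    (hint : ∀ x y, Integrable (fun s => hs s x y) ν) (hmean : ∀ x y, ∫ s, hs s x y ∂ν = h x y) :
    JointLip L h := by
  intro x y x' y'
  rw [← hmean, ← hmean, ← integral_sub (hint _ _) (hint _ _)]
  have := norm_integral_le_of_norm_le_const (μ := ν)
    (Filter.Eventually.of_forall fun s => hL s x y x' y')
  simpa using this

/-- The Jacobian is the adjoint of the x-derivative of an L-Lipschitz map. Applied to samples, it
makes the stochastic Jacobians bounded, which is not assumed separately. -/
lemma norm_jacXY_le {g : Vec a → Vec b → ℝ} (hL : 0 ≤ L) (hg : JointLip L (gradY g)) (x : Vec a)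
    (y : Vec b) : ‖jacXY g x y‖ ≤ L := by
  rw [jacXY, LinearIsometryEquiv.norm_map]
  exact norm_fderiv_le_of_lip' ℝ hL (Filter.Eventually.of_forall fun x' => hg.le_left x' x y)

end JointLip

/-! ### Strongly convex lower-level functions -/

section lower

variable {a b : ℕ} {g : Vec a → Vec b → ℝ} {lam L : ℝ}

lemma hasGradientAt_gradY (hg : Differentiable ℝ fun q : Vec a × Vec b => g q.1 q.2) (x : Vec a)
    (y : Vec b) : HasGradientAt (fun y' => g x y') (gradY g x y) y := by
  have : DifferentiableAt ℝ (fun y' => g x y') y :=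
    (hg (x, y)).comp y (f := fun y' => (x, y')) (by fun_prop)
  exact this.hasGradientAt

lemma hasGradientAt_gradX (hg : Differentiable ℝ fun q : Vec a × Vec b => g q.1 q.2) (x : Vec a)
    (y : Vec b) : HasGradientAt (fun x' => g x' y) (gradX g x y) x := by
  have : DifferentiableAt ℝ (fun x' => g x' y) x :=
    (hg (x, y)).comp x (f := fun x' => (x', y)) (by fun_prop)
  exact this.hasGradientAt

lemma hasFDerivAt_hessYY (hG : Differentiable ℝ fun q : Vec a × Vec b => gradY g q.1 q.2)
    (x : Vec a) (y : Vec b) : HasFDerivAt (fun y' => gradY g x y') (hessYY g x y) y := by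
  have : DifferentiableAt ℝ (fun y' => gradY g x y') y :=
    (hG (x, y)).comp y (f := fun y' => (x, y')) (by fun_prop)
  exact this.hasFDerivAt

lemma hasFDerivAt_gradY_left (hG : Differentiable ℝ fun q : Vec a × Vec b => gradY g q.1 q.2)
    (x : Vec a) (y : Vec b) :
    HasFDerivAt (fun x' => gradY g x' y) (ContinuousLinearMap.adjoint (jacXY g x y)) x := by
  have : DifferentiableAt ℝ (fun x' => gradY g x' y) x :=
    (hG (x, y)).comp x (f := fun x' => (x', y)) (by fun_prop)
  rw [jacXY, ContinuousLinearMap.adjoint_adjoint]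
  exact this.hasFDerivAt

/-- Integrates the Hessian bound along the segment from `y'` to `y`: the function φ is nondecreasing
because its derivative is ⟪∇²g v, v⟫ - λ‖v‖². -/
lemma gradY_strong_mono (hG : Differentiable ℝ fun q : Vec a × Vec b => gradY g q.1 q.2)
    (hpos : ∀ x y, hessYY g x y ∈ matGe b lam) (x : Vec a) (y y' : Vec b) :
    lam * ‖y - y'‖ ^ 2 ≤ ⟪gradY g x y - gradY g x y', y - y'⟫ := by
  set v := y - y' with hv
  let φ : ℝ → ℝ := fun t => ⟪gradY g x (y' + t • v), v⟫ - t * (lam * ‖v‖ ^ 2)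
  have hd : ∀ t, HasDerivAt φ (⟪hessYY g x (y' + t • v) v, v⟫ - lam * ‖v‖ ^ 2) t := by
    intro t
    have h1 : HasDerivAt (fun t : ℝ => y' + t • v) v t := by
      simpa using ((hasDerivAt_id t).smul_const v).const_add y'
    have h2 := (hasFDerivAt_hessYY hG x (y' + t • v)).comp_hasDerivAt t h1
    have h3 := (h2.inner ℝ (hasDerivAt_const t v)).sub
      ((hasDerivAt_id t).mul_const (lam * ‖v‖ ^ 2))
    refine HasDerivAt.congr_deriv (f := φ) h3 ?_
    simp
  have hmono : Monotone φ := monotone_of_deriv_nonneg (fun t => (hd t).differentiableAt) fun t => by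
    rw [(hd t).deriv]
    linarith [matGe_inner (hpos x (y' + t • v)) v]
  have := hmono zero_le_one
  simp only [φ, zero_smul, add_zero, one_smul, zero_mul, one_mul, sub_zero] at this
  rw [hv, add_sub_cancel, ← hv] at this
  rw [inner_sub_left]
  linarith

lemma strong_convex_lower (hg : Differentiable ℝ fun q : Vec a × Vec b => g q.1 q.2)
    (hG : Differentiable ℝ fun q : Vec a × Vec b => gradY g q.1 q.2)
    (hpos : ∀ x y, hessYY g x y ∈ matGe b lam) (x : Vec a) (y y' : Vec b) :
    g x y' + ⟪gradY g x y', y - y'⟫ + lam / 2 * ‖y - y'‖ ^ 2 ≤ g x y := by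
  set v := y - y' with hv
  let φ : ℝ → ℝ := fun t => g x (y' + t • v) - t * ⟪gradY g x y', v⟫ - t ^ 2 * (lam / 2 * ‖v‖ ^ 2)
  have hd : ∀ t, HasDerivAt φ (⟪gradY g x (y' + t • v), v⟫ - ⟪gradY g x y', v⟫ -
      2 * t * (lam / 2 * ‖v‖ ^ 2)) t := by
    intro t
    have h1 : HasDerivAt (fun t : ℝ => y' + t • v) v t := by
      simpa using ((hasDerivAt_id t).smul_const v).const_add y'
    have h2 := (hasGradientAt_gradY hg x (y' + t • v)).hasFDerivAt.comp_hasDerivAt t h1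
    have h3 := (h2.sub ((hasDerivAt_id t).mul_const ⟪gradY g x y', v⟫)).sub
      ((hasDerivAt_pow 2 t).mul_const (lam / 2 * ‖v‖ ^ 2))
    refine HasDerivAt.congr_deriv (f := φ) h3 ?_
    simp
  have hmono : MonotoneOn φ (Set.Icc 0 1) := by
    refine monotoneOn_of_deriv_nonneg (convex_Icc 0 1)
      (fun t _ => (hd t).continuousAt.continuousWithinAt)
      (fun t _ => (hd t).differentiableAt.differentiableWithinAt) fun t ht => ?_
    rw [interior_Icc] at ht
    rw [(hd t).deriv]
    have h := gradY_strong_mono hG hpos x (y' + t • v) y'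
    rw [add_sub_cancel_left, norm_smul, inner_smul_right, inner_sub_left, mul_pow,
      Real.norm_eq_abs, sq_abs] at h
    have : t * (lam * t * ‖v‖ ^ 2) ≤ t * (⟪gradY g x (y' + t • v), v⟫ - ⟪gradY g x y', v⟫) := by
      linarith
    have := le_of_mul_le_mul_left this ht.1
    linarith
  have := hmono (by simp) (by simp) zero_le_one
  simp only [φ, zero_smul, add_zero, one_smul, zero_mul, one_mul, sub_zero] at this
  rw [hv, add_sub_cancel, ← hv] at this
  norm_num at this
  linarith

lemma exists_minimizer (hlam : 0 < lam) (hg : Differentiable ℝ fun q : Vec a × Vec b => g q.1 q.2)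
    (hG : Differentiable ℝ fun q : Vec a × Vec b => gradY g q.1 q.2)
    (hpos : ∀ x y, hessYY g x y ∈ matGe b lam) (x : Vec a) : ∃ y, ∀ y', g x y ≤ g x y' := by
  have hc : Continuous (g x) := by
    have := hg.continuous
    exact this.comp (f := fun y => (x, y)) (by fun_prop)
  refine hc.exists_forall_le' 0 ?_
  -- Outside the ball of this radius the quadratic term of the strong convexity inequality at 0
  -- dominates the linear one, so g(x, ·) ≥ g(x, 0) there.
  set r := 2 * ‖gradY g x 0‖ / lam
  have : ∀ᶠ y in Filter.cocompact (Vec b), r ≤ ‖y‖ :=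
    (tendsto_norm_cocompact_atTop (E := Vec b)).eventually_ge_atTop r
  filter_upwards [this] with y hy
  have h := strong_convex_lower hg hG hpos x y 0
  simp only [sub_zero] at h
  have h2 := neg_le_of_abs_le (abs_real_inner_le_norm (gradY g x 0) y)
  rw [div_le_iff₀ hlam] at hy
  nlinarith [norm_nonneg y]

lemma gradY_eq_zero_of_min {x : Vec a} {y : Vec b} (h : ∀ y', g x y ≤ g x y') :
    gradY g x y = 0 := by
  have h1 : IsLocalMin (fun y' => g x y') y := Filter.Eventually.of_forall h
  rw [gradY, gradient, h1.fderiv_eq_zero, map_zero]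

end lower

end BSVRB

-- One constant for all regularity bounds, and the lower-level solution map

namespace BSVRB

open scoped RealInnerProductSpace

lemma JointLip.mono {a b : ℕ} {V : Type*} [NormedAddCommGroup V] {L M : ℝ}
    {h : Vec a → Vec b → V} (hh : JointLip L h) (hLM : L ≤ M) : JointLip M h :=
  fun x y x' y' => (hh x y x' y').trans (by gcongr)

lemma UnbiasedVar.mono {S : Type*} [MeasurableSpace S] {V : Type*} [NormedAddCommGroup V]
    [NormedSpace ℝ V] {ν : Measure S} {h : S → V} {v : V} {σ M : ℝ} (hh : UnbiasedVar ν h v σ)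
    (h0 : 0 ≤ σ) (hM : σ ≤ M) : UnbiasedVar ν h v M :=
  ⟨hh.1, hh.2.1, hh.2.2.trans (by gcongr)⟩

variable {m dx : ℕ} {dy : Fin m → ℕ} {Ξ : Type u} {Z : Type v}
  [MeasurableSpace Ξ] [MeasurableSpace Z]

/-- All the regularity that the analysis uses, with a single constant `M ≥ 1`. -/
structure Problem.Bounds (p : Problem m dx dy Ξ Z) (lam M : ℝ) : Prop where
  one_le : 1 ≤ M
  lam_pos : 0 < lam
  inv_lam_le : lam⁻¹ ≤ M
  dim_le : ∀ i, (dy i : ℝ) ≤ M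
  standing : p.Standing
  hess_mem : ∀ i x y, hessYY (p.gE i) x y ∈ matGe (dy i) lam
  lip_fx : ∀ i ξ, JointLip M (gradX fun x y => p.f i x y ξ)
  lip_fy : ∀ i ξ, JointLip M (gradY fun x y => p.f i x y ξ)
  lip_gy : ∀ i ζ, JointLip M (gradY fun x y => p.g i x y ζ)
  lip_gxy : ∀ i ζ, JointLip M (jacXY fun x y => p.g i x y ζ)
  lip_gyy : ∀ i ζ, JointLip M (hessYY fun x y => p.g i x y ζ)
  bdd_fx : ∀ i x y, ‖gradX (p.fE i) x y‖ ≤ M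
  bdd_fy : ∀ i x y, ‖gradY (p.fE i) x y‖ ≤ M
  var_fx : ∀ i x y, UnbiasedVar (p.P i) (fun ξ => gradX (fun x y => p.f i x y ξ) x y)
    (gradX (p.fE i) x y) M
  var_fy : ∀ i x y, UnbiasedVar (p.P i) (fun ξ => gradY (fun x y => p.f i x y ξ) x y)
    (gradY (p.fE i) x y) M
  var_gy : ∀ i x y, UnbiasedVar (p.Q i) (fun ζ => gradY (fun x y => p.g i x y ζ) x y)
    (gradY (p.gE i) x y) M
  var_gxy : ∀ i x y, UnbiasedVar (p.Q i) (fun ζ => jacXY (fun x y => p.g i x y ζ) x y)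
    (jacXY (p.gE i) x y) M
  var_gyy : ∀ i x y, UnbiasedVar (p.Q i) (fun ζ => hessYY (fun x y => p.g i x y ζ) x y)
    (hessYY (p.gE i) x y) M

/-- A bound for all the constants of the problem. -/
noncomputable def Consts.bound (c : Consts) (dmax : ℕ) : ℝ :=
  1 + c.lam⁻¹ + c.Lfx + c.Lfy + c.Lgy + c.Lgxy + c.Lgyy + c.Cfx + c.Cfy + c.sigma + dmax

lemma Problem.bounds_of_assumptions {p : Problem m dx dy Ξ Z} {c : Consts} {dmax : ℕ}
    (hd : ∀ i, dy i ≤ dmax) (hs : p.Standing) (h1 : p.Assumption1 c) (h2 : p.Assumption2 c) :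
    p.Bounds c.lam (c.bound dmax) := by
  have e1 := c.lam_pos
  have e2 := inv_pos.2 c.lam_pos
  have e3 := c.Lfx_nonneg
  have e4 := c.Lfy_nonneg
  have e5 := c.Lgy_nonneg
  have e6 := c.Lgxy_nonneg
  have e7 := c.Lgyy_nonneg
  have e8 := c.Cfx_nonneg
  have e9 := c.Cfy_nonneg
  have e10 := c.sigma_nonneg
  have e11 : (0 : ℝ) ≤ dmax := Nat.cast_nonneg _
  have hσ : c.sigma ≤ c.bound dmax := by unfold Consts.bound; linarith
  exact
  { one_le := by unfold Consts.bound; linarith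
    lam_pos := e1
    inv_lam_le := by unfold Consts.bound; linarith
    dim_le := fun i => by
      have : (dy i : ℝ) ≤ dmax := by exact_mod_cast hd i
      unfold Consts.bound; linarith
    standing := hs
    hess_mem := fun i x y => (h1 i x y).1
    lip_fx := fun i ξ => (h2.lip_fx i ξ).mono (by unfold Consts.bound; linarith)
    lip_fy := fun i ξ => (h2.lip_fy i ξ).mono (by unfold Consts.bound; linarith)
    lip_gy := fun i ξ => (h2.lip_gy i ξ).mono (by unfold Consts.bound; linarith)
    lip_gxy := fun i ξ => (h2.lip_gxy i ξ).mono (by unfold Consts.bound; linarith)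
    lip_gyy := fun i ξ => (h2.lip_gyy i ξ).mono (by unfold Consts.bound; linarith)
    bdd_fx := fun i x y => (abs_le_of_sq_le_sq' (h2.bdd_fx i x y) e8).2 |>.trans
      (by unfold Consts.bound; linarith)
    bdd_fy := fun i x y => (abs_le_of_sq_le_sq' (h2.bdd_fy i x y) e9).2 |>.trans
      (by unfold Consts.bound; linarith)
    var_fx := fun i x y => (h2.var_fx i x y).mono e10 hσ
    var_fy := fun i x y => (h2.var_fy i x y).mono e10 hσ
    var_gy := fun i x y => (h2.var_gy i x y).mono e10 hσ
    var_gxy := fun i x y => (h2.var_gxy i x y).mono e10 hσ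
    var_gyy := fun i x y => (h2.var_gyy i x y).mono e10 hσ }

namespace Problem.Bounds

variable {p : Problem m dx dy Ξ Z} {lam M : ℝ} (hp : p.Bounds lam M)
include hp

lemma nonneg : 0 ≤ M := zero_le_one.trans hp.one_le

lemma diff_fE (i : Fin m) :
    Differentiable ℝ (fun q : Vec dx × Vec (dy i) => p.fE i q.1 q.2) :=
  (hp.standing.diff_fE i).differentiable one_ne_zero

lemma diff_gE (i : Fin m) :
    Differentiable ℝ (fun q : Vec dx × Vec (dy i) => p.gE i q.1 q.2) :=
  (hp.standing.diff_gE i).differentiable one_ne_zero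

lemma mean_lip_fx (i : Fin m) : JointLip M (gradX (p.fE i)) := by
  have := hp.standing.isProb_P i
  exact JointLip.integral (hp.lip_fx i) (fun x y => (hp.var_fx i x y).1.integrable one_le_two)
    (fun x y => (hp.var_fx i x y).2.1)

lemma mean_lip_fy (i : Fin m) : JointLip M (gradY (p.fE i)) := by
  have := hp.standing.isProb_P i
  exact JointLip.integral (hp.lip_fy i) (fun x y => (hp.var_fy i x y).1.integrable one_le_two)
    (fun x y => (hp.var_fy i x y).2.1)

lemma mean_lip_gy (i : Fin m) : JointLip M (gradY (p.gE i)) := by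
  have := hp.standing.isProb_Q i
  exact JointLip.integral (hp.lip_gy i) (fun x y => (hp.var_gy i x y).1.integrable one_le_two)
    (fun x y => (hp.var_gy i x y).2.1)

lemma mean_lip_gxy (i : Fin m) : JointLip M (jacXY (p.gE i)) := by
  have := hp.standing.isProb_Q i
  exact JointLip.integral (hp.lip_gxy i) (fun x y => (hp.var_gxy i x y).1.integrable one_le_two)
    (fun x y => (hp.var_gxy i x y).2.1)

lemma mean_lip_gyy (i : Fin m) : JointLip M (hessYY (p.gE i)) := by
  have := hp.standing.isProb_Q i
  exact JointLip.integral (hp.lip_gyy i) (fun x y => (hp.var_gyy i x y).1.integrable one_le_two)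
    (fun x y => (hp.var_gyy i x y).2.1)

lemma norm_jac_le (i : Fin m) (x : Vec dx) (y : Vec (dy i)) : ‖jacXY (p.gE i) x y‖ ≤ M :=
  norm_jacXY_le hp.nonneg (hp.mean_lip_gy i) x y

lemma norm_inverse_le {i : Fin m} {H : Mat (dy i) (dy i)} (hH : H ∈ matGe (dy i) lam)
    (v : Vec (dy i)) : ‖H.inverse v‖ ≤ M * ‖v‖ :=
  (matGe_norm_inverse_le hp.lam_pos hH v).trans (by gcongr; exact hp.inv_lam_le)

lemma norm_inverse_sub_le {i : Fin m} {H H' : Mat (dy i) (dy i)} (hH : H ∈ matGe (dy i) lam)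
    (hH' : H' ∈ matGe (dy i) lam) (v : Vec (dy i)) :
    ‖H.inverse v - H'.inverse v‖ ≤ M ^ 2 * ‖H - H'‖ * ‖v‖ := by
  refine (matGe_inverse_sub_le hp.lam_pos hH hH' v).trans ?_
  have := inv_pos.2 hp.lam_pos
  have := hp.inv_lam_le
  have := hp.nonneg
  rw [pow_two]
  gcongr

lemma gE_ySol_le (i : Fin m) (x : Vec dx) (y : Vec (dy i)) :
    p.gE i x (p.ySol i x) ≤ p.gE i x y := by
  have h := exists_minimizer hp.lam_pos (hp.diff_gE i) (hp.standing.diff_gradY_gE i)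
    (hp.hess_mem i) x
  rw [Problem.ySol, dif_pos h]
  exact h.choose_spec y

lemma gradY_ySol (i : Fin m) (x : Vec dx) : gradY (p.gE i) x (p.ySol i x) = 0 :=
  gradY_eq_zero_of_min (hp.gE_ySol_le i x)

/-- Strong monotonicity at the two minimizers; one factor M is the Lipschitz constant of ∇_y g in x,
the other bounds λ⁻¹. -/
lemma ySol_lip (i : Fin m) (x x' : Vec dx) :
    ‖p.ySol i x - p.ySol i x'‖ ≤ M ^ 2 * ‖x - x'‖ := by
  set y := p.ySol i x
  set y' := p.ySol i x'
  have h1 := gradY_strong_mono (hp.standing.diff_gradY_gE i) (hp.hess_mem i) x y y'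
  -- Both optimality conditions have the value 0, so ∇_y g(x, y) may be replaced by ∇_y g(x', y').
  -- The remaining difference varies only the x-argument.
  rw [hp.gradY_ySol, ← hp.gradY_ySol i x'] at h1
  have h2 := real_inner_le_norm (gradY (p.gE i) x' y' - gradY (p.gE i) x y') (y - y')
  have h3 := (hp.mean_lip_gy i).le_left x' x y'
  have h4 : lam * ‖y - y'‖ ^ 2 ≤ M * ‖x - x'‖ * ‖y - y'‖ :=
    (h1.trans h2).trans (by rw [norm_sub_rev x x']; gcongr)
  rcases (norm_nonneg (y - y')).eq_or_lt with h0 | h0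
  · rw [← h0]
    have := hp.nonneg
    positivity
  · have h5 : lam * ‖y - y'‖ ≤ M * ‖x - x'‖ := by
      refine le_of_mul_le_mul_right ?_ h0
      linarith
    have h6 : ‖y - y'‖ = lam⁻¹ * (lam * ‖y - y'‖) := by
      rw [inv_mul_cancel_left₀ hp.lam_pos.ne']
    rw [h6, pow_two, mul_assoc]
    have := hp.inv_lam_le
    have := hp.lam_pos
    have := hp.nonneg
    gcongr

end Problem.Bounds

-- Derivatives of the solution map and of the objective

section partials

variable {a b : ℕ}

/-- Differentiability on the product is given; the partial derivatives only identify the derivative,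
by restriction to the two factors. -/
lemma hasFDerivAt_partials {V : Type*} [NormedAddCommGroup V] [NormedSpace ℝ V]
    {h : Vec a → Vec b → V} (hh : Differentiable ℝ fun q : Vec a × Vec b => h q.1 q.2)
    {x : Vec a} {y : Vec b} {D₁ : Vec a →L[ℝ] V} {D₂ : Vec b →L[ℝ] V}
    (h₁ : HasFDerivAt (fun x' => h x' y) D₁ x) (h₂ : HasFDerivAt (fun y' => h x y') D₂ y) :
    HasFDerivAt (fun q : Vec a × Vec b => h q.1 q.2) (D₁.coprod D₂) (x, y) := by
  have hD := (hh (x, y)).hasFDerivAt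
  set D := fderiv ℝ (fun q : Vec a × Vec b => h q.1 q.2) (x, y)
  have e₁ : D₁ = D ∘L ContinuousLinearMap.inl ℝ _ _ :=
    h₁.unique (HasFDerivAt.comp (g := fun q : Vec a × Vec b => h q.1 q.2) (f := fun e => (e, y)) x
      hD (hasFDerivAt_prodMk_left x y))
  have e₂ : D₂ = D ∘L ContinuousLinearMap.inr ℝ _ _ :=
    h₂.unique (HasFDerivAt.comp (g := fun q : Vec a × Vec b => h q.1 q.2) (f := fun e => (x, e)) y
      hD (hasFDerivAt_prodMk_right x y))
  convert hD using 1
  rw [e₁, e₂, ← ContinuousLinearMap.comp_coprod]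
  ext <;> simp

end partials

namespace Problem.Bounds

variable {p : Problem m dx dy Ξ Z} {lam M : ℝ} (hp : p.Bounds lam M)
include hp

lemma ySol_continuous (i : Fin m) : Continuous (p.ySol i) :=
  (LipschitzWith.of_dist_le_mul (K := ⟨M ^ 2, by positivity⟩) fun x x' => by
    rw [dist_eq_norm, dist_eq_norm]; exact hp.ySol_lip i x x').continuous

/-- Implicit differentiation without the implicit function theorem: the solution map is already
known to be Lipschitz, so the first-order remainder of ∇_y g along (x', y(x')) is o(x' - x). Since
∇_y g vanishes along this curve, applying the inverse Hessian to the linearization gives the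
derivative; differentiability of ∇_y g at the single point is enough. -/
lemma hasFDerivAt_ySol (i : Fin m) (x : Vec dx) :
    HasFDerivAt (p.ySol i) (-((hessYY (p.gE i) x (p.ySol i x)).inverse ∘L
      ContinuousLinearMap.adjoint (jacXY (p.gE i) x (p.ySol i x)))) x := by
  set y := p.ySol i with hy
  set A := hessYY (p.gE i) x (y x)
  set J := ContinuousLinearMap.adjoint (jacXY (p.gE i) x (y x))
  have hA : A ∈ matGe (dy i) lam := hp.hess_mem i x (y x)
  have hG := hasFDerivAt_partials (hp.standing.diff_gradY_gE i)
    (hasFDerivAt_gradY_left (hp.standing.diff_gradY_gE i) x (y x))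
    (hasFDerivAt_hessYY (hp.standing.diff_gradY_gE i) x (y x))
  have hc : Filter.Tendsto (fun x' => (x', y x')) (nhds x) (nhds (x, y x)) :=
    (continuous_id.prodMk (hp.ySol_continuous i)).tendsto x
  have h1 := hG.isLittleO.comp_tendsto hc
  have h2 : (fun x' => A (y x' - y x) + J (x' - x)) =o[nhds x] fun x' => x' - x := by
    have h3 : ((fun q : Vec dx × Vec (dy i) => q - (x, y x)) ∘ fun x' => (x', y x'))
        =O[nhds x] fun x' => x' - x := by
      refine Asymptotics.IsBigO.of_bound (1 + M ^ 2) (Filter.Eventually.of_forall fun x' => ?_)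
      have := hp.ySol_lip i x' x
      simp only [Function.comp_apply, Prod.mk_sub_mk, Prod.norm_mk]
      refine max_le ?_ (this.trans ?_) <;> nlinarith [sq_nonneg M, norm_nonneg (x' - x),
        mul_nonneg (sq_nonneg M) (norm_nonneg (x' - x))]
    have h4 := (h1.trans_isBigO h3).neg_left
    refine h4.congr_left fun x' => ?_
    simp only [Function.comp_apply, hy, hp.gradY_ySol]
    simp [A, J, hy, add_comm]
  rw [hasFDerivAt_iff_isLittleO]
  refine Asymptotics.IsLittleO.congr_left
    ((A.inverse.isBigO_comp _ _).trans_isLittleO h2) fun x' => ?_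
  rw [map_add, matGe_inverse_apply hp.lam_pos hA]
  simp only [_root_.neg_apply, ContinuousLinearMap.comp_apply, A, J]
  abel

end Problem.Bounds

/-- The summand `∇_x f_i(x, y) - ∇²_xy g_i(x, y) H⁻¹ ∇_y f_i(x, y)` of the gradient mapping. -/
noncomputable def Problem.blockGrad (p : Problem m dx dy Ξ Z) (i : Fin m) (x : Vec dx)
    (y : Vec (dy i)) (H : Mat (dy i) (dy i)) : Vec dx :=
  gradX (p.fE i) x y - jacXY (p.gE i) x y (H.inverse (gradY (p.fE i) x y))

namespace Problem.Bounds

variable {p : Problem m dx dy Ξ Z} {lam M : ℝ} (hp : p.Bounds lam M)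
include hp

lemma norm_blockGrad_le (i : Fin m) (x : Vec dx) (y : Vec (dy i)) {H : Mat (dy i) (dy i)}
    (hH : H ∈ matGe (dy i) lam) : ‖p.blockGrad i x y H‖ ≤ 2 * M ^ 3 := by
  have h0 := hp.nonneg
  have h1 := hp.one_le
  have h2 : ‖jacXY (p.gE i) x y (H.inverse (gradY (p.fE i) x y))‖ ≤ M * (M * M) := by
    refine (ContinuousLinearMap.le_opNorm _ _).trans ?_
    have := hp.norm_jac_le i x y
    have h3 := hp.norm_inverse_le hH (gradY (p.fE i) x y)
    have h4 := hp.bdd_fy i x y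
    gcongr
    exact h3.trans (by gcongr)
  refine (norm_sub_le _ _).trans ?_
  have h3 := hp.bdd_fx i x y
  have h4 : M ≤ M ^ 3 := le_self_pow₀ h1 (by norm_num)
  linarith

/-- The difference is split so that each of four terms varies one factor: ∇_x f, the Jacobian, the
inverse matrix, and ∇_y f. The other factors are bounded by M. -/
lemma blockGrad_lip (i : Fin m) (x x' : Vec dx) (y y' : Vec (dy i)) {H H' : Mat (dy i) (dy i)}
    (hH : H ∈ matGe (dy i) lam) (hH' : H' ∈ matGe (dy i) lam) :
    ‖p.blockGrad i x y H - p.blockGrad i x' y' H'‖ ^ 2 ≤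
      18 * M ^ 8 * (‖x - x'‖ ^ 2 + ‖y - y'‖ ^ 2 + ‖H - H'‖ ^ 2) := by
  have h0 := hp.nonneg
  have h1 := hp.one_le
  set δ := Real.sqrt (‖x - x'‖ ^ 2 + ‖y - y'‖ ^ 2) with hδ
  have hδ2 : δ ^ 2 = ‖x - x'‖ ^ 2 + ‖y - y'‖ ^ 2 := Real.sq_sqrt (by positivity)
  have hδ0 : 0 ≤ δ := Real.sqrt_nonneg _
  set fy := gradY (p.fE i) x y
  set fy' := gradY (p.fE i) x' y'
  set j := jacXY (p.gE i) x y
  set j' := jacXY (p.gE i) x' y'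
  have e : p.blockGrad i x y H - p.blockGrad i x' y' H' =
      (gradX (p.fE i) x y - gradX (p.fE i) x' y') - (j - j') (H.inverse fy)
        - j' (H.inverse fy - H'.inverse fy) - j' (H'.inverse (fy - fy')) := by
    simp only [blockGrad, map_sub, _root_.sub_apply, fy, fy', j, j']
    abel
  have b1 : ‖gradX (p.fE i) x y - gradX (p.fE i) x' y'‖ ≤ M * δ := hp.mean_lip_fx i x y x' y'
  have b2 : ‖(j - j') (H.inverse fy)‖ ≤ (M * δ) * (M * M) := by
    refine (ContinuousLinearMap.le_opNorm _ _).trans ?_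
    have := hp.mean_lip_gxy i x y x' y'
    have h3 := hp.norm_inverse_le hH fy
    have h4 := hp.bdd_fy i x y
    gcongr
    exact h3.trans (by gcongr)
  have b3 : ‖j' (H.inverse fy - H'.inverse fy)‖ ≤ M * (M ^ 2 * ‖H - H'‖ * M) := by
    refine (ContinuousLinearMap.le_opNorm _ _).trans ?_
    have := hp.norm_jac_le i x' y'
    have h3 := hp.norm_inverse_sub_le hH hH' fy
    have h4 := hp.bdd_fy i x y
    gcongr
    exact h3.trans (by gcongr)
  have b4 : ‖j' (H'.inverse (fy - fy'))‖ ≤ M * (M * (M * δ)) := by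
    refine (ContinuousLinearMap.le_opNorm _ _).trans ?_
    have := hp.norm_jac_le i x' y'
    have h3 := hp.norm_inverse_le hH' (fy - fy')
    have h4 := hp.mean_lip_fy i x y x' y'
    gcongr
    exact h3.trans (by gcongr)
  have b : ‖p.blockGrad i x y H - p.blockGrad i x' y' H'‖ ≤
      3 * M ^ 4 * δ + 3 * M ^ 4 * ‖H - H'‖ := by
    rw [e]
    refine (norm_sub_le _ _).trans ?_
    have := norm_sub_le ((gradX (p.fE i) x y - gradX (p.fE i) x' y') - (j - j') (H.inverse fy))
      (j' (H.inverse fy - H'.inverse fy))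
    have := norm_sub_le (gradX (p.fE i) x y - gradX (p.fE i) x' y') ((j - j') (H.inverse fy))
    have c1 : M * δ ≤ M ^ 4 * δ := by gcongr; exact le_self_pow₀ h1 (by norm_num)
    have c2 : M ^ 3 * δ ≤ M ^ 4 * δ := by gcongr; norm_num
    have c3 : 0 ≤ M ^ 4 * ‖H - H'‖ := by positivity
    linarith
  calc _ ≤ (3 * M ^ 4 * δ + 3 * M ^ 4 * ‖H - H'‖) ^ 2 := by gcongr
    _ = 9 * M ^ 8 * (δ + ‖H - H'‖) ^ 2 := by ring
    _ ≤ 9 * M ^ 8 * (2 * (δ ^ 2 + ‖H - H'‖ ^ 2)) := by gcongr; exact add_sq_le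
    _ = _ := by rw [hδ2]; ring

/-- The gradient of the objective. -/
lemma hasGradientAt_F (x : Vec dx) : HasGradientAt p.F ((1 / (m : ℝ)) • ∑ i,
    p.blockGrad i x (p.ySol i x) (hessYY (p.gE i) x (p.ySol i x))) x := by
  have hi : ∀ i, HasFDerivAt (fun x => p.fE i x (p.ySol i x)) (InnerProductSpace.toDual ℝ (Vec dx)
      (p.blockGrad i x (p.ySol i x) (hessYY (p.gE i) x (p.ySol i x)))) x := by
    intro i
    have h1 := hasFDerivAt_partials (hp.diff_fE i)
      (hasGradientAt_gradX (hp.diff_fE i) x (p.ySol i x)).hasFDerivAt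
      (hasGradientAt_gradY (hp.diff_fE i) x (p.ySol i x)).hasFDerivAt
    have h2 := (hasFDerivAt_id x).prodMk (hp.hasFDerivAt_ySol i x)
    refine HasFDerivAt.congr_fderiv (HasFDerivAt.comp
      (g := fun q : Vec dx × Vec (dy i) => p.fE i q.1 q.2) (f := fun x => (x, p.ySol i x)) x h1 h2) ?_
    ext v
    simp only [blockGrad, map_sub]
    simp [sub_eq_add_neg]
    -- The derivative of the solution map acts on `v`; the adjoint and the symmetry of the inverse
    -- Hessian move both factors onto ∇_y f.
    rw [← ContinuousLinearMap.adjoint_inner_right,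
      matGe_inverse_symm hp.lam_pos (hp.hess_mem i x (p.ySol i x))]
  rw [hasGradientAt_iff_hasFDerivAt]
  have h := (HasFDerivAt.fun_sum (u := Finset.univ) fun i _ => hi i).const_mul (1 / (m : ℝ))
  refine HasFDerivAt.congr_fderiv h ?_
  simp [map_sum]

end Problem.Bounds

end BSVRB

namespace BSVRB

open scoped RealInnerProductSpace

/-! ### The Frobenius norm and the projection -/

section frob

variable {d : ℕ} {lam : ℝ}

/-- The columns of a matrix, as an element of a Euclidean space: this realizes the Frobenius norm
as a Hilbert norm. -/
noncomputable def cols (d : ℕ) : Mat d d →ₗ[ℝ] PiLp 2 (fun _ : Fin d => Vec d) where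
  toFun A := WithLp.toLp 2 fun j => A (EuclideanSpace.single j 1)
  map_add' A B := by ext; simp
  map_smul' c A := by ext; simp

lemma norm_cols_sq (A : Mat d d) : ‖cols d A‖ ^ 2 = frobSq A := by
  rw [PiLp.norm_sq_eq_of_L2]
  rfl

lemma apply_eq_sum (A : Mat d d) (v : Vec d) :
    A v = ∑ j, v j • A (EuclideanSpace.single j 1) := by
  have h := (EuclideanSpace.basisFun (Fin d) ℝ).sum_repr v
  conv_lhs => rw [← h]
  simp [map_sum]

lemma norm_sq_le_frobSq (A : Mat d d) : ‖A‖ ^ 2 ≤ frobSq A := by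
  have h0 : 0 ≤ frobSq A := Finset.sum_nonneg fun _ _ => by positivity
  have h : ‖A‖ ≤ Real.sqrt (frobSq A) := by
    refine ContinuousLinearMap.opNorm_le_bound _ (Real.sqrt_nonneg _) fun v => ?_
    rw [apply_eq_sum A v, EuclideanSpace.norm_eq v, ← Real.sqrt_mul h0]
    refine Real.le_sqrt_of_sq_le ?_
    calc ‖∑ j, v j • A (EuclideanSpace.single j 1)‖ ^ 2
        ≤ (∑ j, ‖v j‖ * ‖A (EuclideanSpace.single j 1)‖) ^ 2 := by
          gcongr
          refine (norm_sum_le _ _).trans (Finset.sum_le_sum fun j _ => ?_)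
          rw [norm_smul]
      _ ≤ (∑ j, ‖v j‖ ^ 2) * ∑ j, ‖A (EuclideanSpace.single j 1)‖ ^ 2 :=
          Finset.sum_mul_sq_le_sq_mul_sq _ _ _
      _ = _ := by rw [mul_comm]; rfl
  calc _ ≤ (Real.sqrt (frobSq A)) ^ 2 := by gcongr
    _ = _ := Real.sq_sqrt h0

lemma frobSq_le (A : Mat d d) : frobSq A ≤ d * ‖A‖ ^ 2 := by
  have : ∀ j ∈ (Finset.univ : Finset (Fin d)), ‖A (EuclideanSpace.single j 1)‖ ^ 2 ≤ ‖A‖ ^ 2 := by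
    intro j _
    have := A.le_opNorm (EuclideanSpace.single j 1)
    simp at this
    gcongr
  have h := Finset.sum_le_card_nsmul _ _ _ this
  rw [Finset.card_univ, Fintype.card_fin, nsmul_eq_mul] at h
  exact h

lemma frobSq_nonneg (A : Mat d d) : 0 ≤ frobSq A := Finset.sum_nonneg fun _ _ => by positivity

/-- With injectivity, `cols` is a closed embedding of the finite-dimensional matrix space, so
projections onto `matGe` can be studied in a Hilbert space; the spectral norm is not Hilbertian. -/
lemma cols_injective : Function.Injective (cols d) := by
  rw [injective_iff_map_eq_zero]
  intro A hA
  have h1 := norm_sq_le_frobSq A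
  rw [← norm_cols_sq, hA, norm_zero] at h1
  have : ‖A‖ = 0 := by nlinarith [norm_nonneg A]
  exact norm_eq_zero.1 this

lemma convex_matGe : Convex ℝ (matGe d lam) := by
  intro A hA B hB s t hs ht hst
  refine mem_matGe_of_symm (fun v w => ?_) fun v => ?_
  · simp [inner_add_left, inner_add_right, inner_smul_left, inner_smul_right, matGe_symm hA,
      matGe_symm hB]
  · have h1 := mul_le_mul_of_nonneg_left (matGe_inner hA v) hs
    have h2 := mul_le_mul_of_nonneg_left (matGe_inner hB v) ht
    have h3 : lam * ‖v‖ ^ 2 = s * (lam * ‖v‖ ^ 2) + t * (lam * ‖v‖ ^ 2) := by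
      rw [← add_mul, hst, one_mul]
    simp only [_root_.add_apply, _root_.smul_apply, inner_add_left, real_inner_smul_left]
    linarith

lemma isClosed_matGe : IsClosed (matGe d lam) := by
  have : matGe d lam = (⋂ v : Vec d, ⋂ w : Vec d, {A : Mat d d | ⟪A v, w⟫ = ⟪v, A w⟫}) ∩
      ⋂ v : Vec d, {A : Mat d d | lam * ‖v‖ ^ 2 ≤ ⟪A v, v⟫} := by
    ext A
    simp only [Set.mem_inter_iff, Set.mem_iInter, Set.mem_ofPred_eq]
    exact ⟨fun h => ⟨matGe_symm h, matGe_inner h⟩, fun h => mem_matGe_of_symm h.1 h.2⟩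
  rw [this]
  refine IsClosed.inter (isClosed_iInter fun v => isClosed_iInter fun w => ?_)
    (isClosed_iInter fun v => ?_)
  · exact isClosed_eq (by fun_prop) (by fun_prop)
  · exact isClosed_le (by fun_prop) (by fun_prop)

lemma smul_id_mem_matGe : lam • ContinuousLinearMap.id ℝ (Vec d) ∈ matGe d lam :=
  mem_matGe_of_symm (fun v w => by simp [inner_smul_left, inner_smul_right])
    (fun v => by simp [inner_smul_left])

instance : ContinuousSMul ℝ (PiLp 2 fun _ : Fin d => Vec d) := IsBoundedSMul.continuousSMul

lemma isClosed_cols_image : IsClosed (cols d '' matGe d lam) :=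
  ((LinearMap.isClosedEmbedding_of_injective
    (LinearMap.ker_eq_bot.2 cols_injective)).isClosedMap) _ isClosed_matGe

lemma exists_matProj (A : Mat d d) :
    ∃ M ∈ matGe d lam, ∀ N ∈ matGe d lam, frobSq (A - M) ≤ frobSq (A - N) := by
  obtain ⟨_, ⟨M, hM, rfl⟩, h⟩ := exists_norm_eq_iInf_of_complete_convex
    (Set.image_nonempty.2 ⟨_, smul_id_mem_matGe (lam := lam)⟩) isClosed_cols_image.isComplete
    (convex_matGe.linear_image (cols d)) (cols d A)
  refine ⟨M, hM, fun N hN => ?_⟩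
  rw [← norm_cols_sq, ← norm_cols_sq, map_sub, map_sub, h]
  gcongr
  · exact Real.iInf_nonneg fun _ => norm_nonneg _
  · exact ciInf_le ⟨0, by rintro _ ⟨w, rfl⟩; exact norm_nonneg _⟩
      (⟨cols d N, N, hN, rfl⟩ : cols d '' matGe d lam)

lemma matProj_mem (A : Mat d d) : matProj lam A ∈ matGe d lam := by
  rw [matProj, dif_pos (exists_matProj A)]
  exact (exists_matProj A).choose_spec.1

lemma matProj_frobSq_le (A : Mat d d) {N : Mat d d} (hN : N ∈ matGe d lam) :
    frobSq (A - matProj lam A) ≤ frobSq (A - N) := by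
  rw [matProj, dif_pos (exists_matProj A)]
  exact (exists_matProj A).choose_spec.2 N hN

/-- The variational inequality of the projection. It holds for every minimizer, hence for the one
selected in `matProj`. -/
lemma matProj_inner_le (A : Mat d d) {N : Mat d d} (hN : N ∈ matGe d lam) :
    ⟪cols d A - cols d (matProj lam A), cols d N - cols d (matProj lam A)⟫ ≤ 0 := by
  refine (norm_eq_iInf_iff_real_inner_le_zero (convex_matGe.linear_image (cols d))
    ⟨_, matProj_mem A, rfl⟩).1 ?_ _ ⟨N, hN, rfl⟩
  have : Nonempty (cols d '' matGe d lam) := ⟨⟨_, _, hN, rfl⟩⟩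
  refine le_antisymm (le_ciInf ?_) (ciInf_le ⟨0, by rintro _ ⟨w, rfl⟩; exact norm_nonneg _⟩
    (⟨_, _, matProj_mem A, rfl⟩ : cols d '' matGe d lam))
  rintro ⟨_, N', hN', rfl⟩
  have := matProj_frobSq_le A hN'
  rw [← norm_cols_sq, ← norm_cols_sq, map_sub, map_sub] at this
  exact (abs_le_of_sq_le_sq' this (norm_nonneg _)).2

/-- Adding the variational inequalities at the two projections gives ‖x - y‖² ≤ ⟪a - b, x - y⟫, and
Cauchy–Schwarz finishes. -/
lemma frobSq_matProj_sub_le (A B : Mat d d) :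
    frobSq (matProj lam A - matProj lam B) ≤ frobSq (A - B) := by
  have h1 := matProj_inner_le (lam := lam) A (matProj_mem B)
  have h2 := matProj_inner_le (lam := lam) B (matProj_mem A)
  rw [← norm_cols_sq, ← norm_cols_sq, map_sub, map_sub]
  set a := cols d A
  set b := cols d B
  set x := cols d (matProj lam A)
  set y := cols d (matProj lam B)
  have h3 : ‖x - y‖ ^ 2 ≤ ⟪a - b, x - y⟫ := by
    rw [← real_inner_self_eq_norm_sq]
    simp only [inner_sub_left, inner_sub_right] at h1 h2 ⊢
    linarith
  have h4 := real_inner_le_norm (a - b) (x - y)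
  have h5 : ‖x - y‖ ≤ ‖a - b‖ := by
    by_contra! hlt
    nlinarith [norm_nonneg (a - b)]
  gcongr

lemma matProj_eq_self {A : Mat d d} (hA : A ∈ matGe d lam) : matProj lam A = A := by
  have h := matProj_frobSq_le A hA
  rw [sub_self, ← norm_cols_sq (0 : Mat d d), map_zero, norm_zero] at h
  have h2 := norm_sq_le_frobSq (A - matProj lam A)
  have : ‖A - matProj lam A‖ = 0 := by nlinarith [norm_nonneg (A - matProj lam A)]
  exact (sub_eq_zero.1 (norm_eq_zero.1 this)).symm

/-- Needed for measurability of the iterates. The factor √d is the cost of passing between the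
spectral and the Frobenius norm. -/
lemma continuous_matProj : Continuous (matProj (d := d) lam) := by
  refine (LipschitzWith.of_dist_le_mul (K := ⟨Real.sqrt d, Real.sqrt_nonneg _⟩)
    fun A B => ?_).continuous
  rw [dist_eq_norm, dist_eq_norm]
  have h1 := ((norm_sq_le_frobSq _).trans (frobSq_matProj_sub_le (lam := lam) A B)).trans
    (frobSq_le (A - B))
  refine (abs_le_of_sq_le_sq' ?_ (mul_nonneg (Real.sqrt_nonneg _) (norm_nonneg _))).2
  rw [mul_pow, Real.sq_sqrt (Nat.cast_nonneg d)]
  exact h1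

end frob

end BSVRB

namespace BSVRB

open scoped RealInnerProductSpace

variable {m dx : ℕ} {dy : Fin m → ℕ} {Ξ : Type u} {Z : Type v}
  [MeasurableSpace Ξ] [MeasurableSpace Z]

lemma norm_mean_sq_le {V ι : Type*} [NormedAddCommGroup V] [NormedSpace ℝ V] (s : Finset ι)
    {n : ℕ} (hn : s.card = n) (h : ι → V) :
    ‖(1 / (n : ℝ)) • ∑ i ∈ s, h i‖ ^ 2 ≤ 1 / (n : ℝ) * ∑ i ∈ s, ‖h i‖ ^ 2 := by
  rcases Nat.eq_zero_or_pos n with rfl | hpos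
  · simp
  have hn0 : (0 : ℝ) < n := by exact_mod_cast hpos
  have h1 : ‖∑ i ∈ s, h i‖ ^ 2 ≤ n * ∑ i ∈ s, ‖h i‖ ^ 2 := by
    calc _ ≤ (∑ i ∈ s, ‖h i‖) ^ 2 := by gcongr; exact norm_sum_le _ _
      _ ≤ _ := by rw [← hn]; exact sq_sum_le_card_mul_sum_sq
  rw [norm_smul, mul_pow, Real.norm_of_nonneg (by positivity)]
  calc _ ≤ (1 / (n : ℝ)) ^ 2 * (n * ∑ i ∈ s, ‖h i‖ ^ 2) := by gcongr
    _ = _ := by field_simp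

lemma norm_add_three_sq_le {V : Type*} [NormedAddCommGroup V] (a b c : V) :
    ‖a + b + c‖ ^ 2 ≤ 3 * (‖a‖ ^ 2 + ‖b‖ ^ 2 + ‖c‖ ^ 2) := by
  have := norm_add₃_le (a := a) (b := b) (c := c)
  calc _ ≤ (‖a‖ + ‖b‖ + ‖c‖) ^ 2 := by gcongr
    _ ≤ _ := by nlinarith [sq_nonneg (‖a‖ - ‖b‖), sq_nonneg (‖a‖ - ‖c‖), sq_nonneg (‖b‖ - ‖c‖)]

/-! ### Error functionals of two consecutive states -/

/-- The squared upper-level increment, counted once for each block. -/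
noncomputable def incX (r : State dx dy × State dx dy) : ℝ := m * ‖r.2.x - r.1.x‖ ^ 2

/-- The squared lower-level increments. -/
noncomputable def incY (r : State dx dy × State dx dy) : ℝ := ∑ i, ‖r.2.y i - r.1.y i‖ ^ 2

/-- The squared increments of the Hessian estimators. -/
noncomputable def incH (r : State dx dy × State dx dy) : ℝ := ∑ i, ‖r.2.H i - r.1.H i‖ ^ 2

namespace Problem

/-- The squared distance to the lower-level solutions. -/
noncomputable def errY (p : Problem m dx dy Ξ Z) (θ : State dx dy) : ℝ :=
  ∑ i, ‖θ.y i - p.ySol i θ.x‖ ^ 2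

/-- The squared error of the lower-level gradient estimators, which track the previous state. -/
noncomputable def errS (p : Problem m dx dy Ξ Z) (r : State dx dy × State dx dy) : ℝ :=
  ∑ i, ‖r.2.s i - gradY (p.gE i) r.1.x (r.1.y i)‖ ^ 2

/-- The squared Frobenius error of the Hessian estimators, which track the previous state. -/
noncomputable def errH (p : Problem m dx dy Ξ Z) (r : State dx dy × State dx dy) : ℝ :=
  ∑ i, frobSq (r.2.H i - hessYY (p.gE i) r.1.x (r.1.y i))

/-- The squared error of the upper-level gradient estimator, which tracks the previous state. -/
noncomputable def errZ (p : Problem m dx dy Ξ Z) (r : State dx dy × State dx dy) : ℝ :=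
  ‖r.2.z - p.gradMean r.1‖ ^ 2

end Problem

lemma incX_nonneg (r : State dx dy × State dx dy) : 0 ≤ incX r := by unfold incX; positivity
lemma incY_nonneg (r : State dx dy × State dx dy) : 0 ≤ incY r := by unfold incY; positivity
lemma incH_nonneg (r : State dx dy × State dx dy) : 0 ≤ incH r := by unfold incH; positivity

namespace Problem

variable {p : Problem m dx dy Ξ Z}

lemma gradMean_eq (θ : State dx dy) :
    p.gradMean θ = (1 / (m : ℝ)) • ∑ i, p.blockGrad i θ.x (θ.y i) (θ.H i) := rfl

lemma errY_nonneg (θ : State dx dy) : 0 ≤ p.errY θ := by unfold errY; positivity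
lemma errS_nonneg (r : State dx dy × State dx dy) : 0 ≤ p.errS r := by unfold errS; positivity
lemma errH_nonneg (r : State dx dy × State dx dy) : 0 ≤ p.errH r :=
  Finset.sum_nonneg fun _ _ => frobSq_nonneg _
lemma errZ_nonneg (r : State dx dy × State dx dy) : 0 ≤ p.errZ r := by unfold errZ; positivity

end Problem

lemma incX_add_incY (r : State dx dy × State dx dy) :
    incX r + incY r = ∑ i, (‖r.2.x - r.1.x‖ ^ 2 + ‖r.2.y i - r.1.y i‖ ^ 2) := by
  simp [incX, incY, Finset.sum_add_distrib]

/-- The Hessian estimators of both states are admissible. -/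
def Admissible (lam : ℝ) (r : State dx dy × State dx dy) : Prop :=
  ∀ i, r.1.H i ∈ matGe (dy i) lam ∧ r.2.H i ∈ matGe (dy i) lam

namespace Problem.Bounds

variable {p : Problem m dx dy Ξ Z} {lam M : ℝ} (hp : p.Bounds lam M)
include hp

/-! ### Smoothness of the objective -/

lemma gradient_F (x : Vec dx) : gradient p.F x = (1 / (m : ℝ)) • ∑ i,
    p.blockGrad i x (p.ySol i x) (hessYY (p.gE i) x (p.ySol i x)) :=
  (hp.hasGradientAt_F x).gradient

lemma differentiable_F : Differentiable ℝ p.F := fun x => (hp.hasGradientAt_F x).differentiableAt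

lemma hasGradientAt_gradient (x : Vec dx) : HasGradientAt p.F (gradient p.F x) x := by
  rw [hp.gradient_F]; exact hp.hasGradientAt_F x

lemma gradient_lip (x x' : Vec dx) :
    ‖gradient p.F x - gradient p.F x'‖ ≤ 9 * M ^ 7 * ‖x - x'‖ := by
  have h0 := hp.nonneg
  have h1 := hp.one_le
  rw [hp.gradient_F, hp.gradient_F, ← smul_sub, ← Finset.sum_sub_distrib]
  refine (abs_le_of_sq_le_sq' ?_ (by positivity)).2
  refine (norm_mean_sq_le Finset.univ (by simp) _).trans ?_
  have hi : ∀ i ∈ (Finset.univ : Finset (Fin m)),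
      ‖p.blockGrad i x (p.ySol i x) (hessYY (p.gE i) x (p.ySol i x)) -
        p.blockGrad i x' (p.ySol i x') (hessYY (p.gE i) x' (p.ySol i x'))‖ ^ 2 ≤
        (9 * M ^ 7 * ‖x - x'‖) ^ 2 := by
    intro i _
    refine (hp.blockGrad_lip i x x' _ _ (hp.hess_mem i _ _) (hp.hess_mem i _ _)).trans ?_
    have e1 := (hp.mean_lip_gyy i).sq_le x (p.ySol i x) x' (p.ySol i x')
    have e2 : ‖p.ySol i x - p.ySol i x'‖ ^ 2 ≤ M ^ 4 * ‖x - x'‖ ^ 2 := by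
      calc _ ≤ (M ^ 2 * ‖x - x'‖) ^ 2 := by gcongr; exact hp.ySol_lip i x x'
        _ = _ := by ring
    have e3 : M ^ 2 * ‖p.ySol i x - p.ySol i x'‖ ^ 2 ≤ M ^ 2 * (M ^ 4 * ‖x - x'‖ ^ 2) := by gcongr
    have f1 : ‖x - x'‖ ^ 2 ≤ M ^ 6 * ‖x - x'‖ ^ 2 :=
      le_mul_of_one_le_left (by positivity) (one_le_pow₀ h1)
    have f2 : M ^ 4 * ‖x - x'‖ ^ 2 ≤ M ^ 6 * ‖x - x'‖ ^ 2 := by gcongr; norm_num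
    have f3 : M ^ 2 * ‖x - x'‖ ^ 2 ≤ M ^ 6 * ‖x - x'‖ ^ 2 := by gcongr; norm_num
    -- The increments of x, of y_i(x) and of the Hessian (which contributes two terms) each give at
    -- most M⁶‖x - x'‖². The final 72 M¹⁴ is rounded up to the square of 9 M⁷.
    calc _ ≤ 18 * M ^ 8 * (4 * (M ^ 6 * ‖x - x'‖ ^ 2)) := by gcongr; linarith
      _ ≤ _ := by nlinarith [show 0 ≤ M ^ 14 * ‖x - x'‖ ^ 2 by positivity]
  have := Finset.sum_le_card_nsmul _ _ _ hi
  rw [Finset.card_univ, Fintype.card_fin, nsmul_eq_mul] at this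
  rcases Nat.eq_zero_or_pos m with rfl | hm
  · simp; positivity
  · have hm0 : (0 : ℝ) < m := by exact_mod_cast hm
    rw [one_div, inv_mul_le_iff₀ hm0]
    exact this

lemma descent (x v : Vec dx) :
    p.F (x + v) ≤ p.F x + ⟪gradient p.F x, v⟫ + 9 * M ^ 7 / 2 * ‖v‖ ^ 2 := by
  let φ : ℝ → ℝ := fun t => t * ⟪gradient p.F x, v⟫ + t ^ 2 * (9 * M ^ 7 / 2 * ‖v‖ ^ 2)
    - p.F (x + t • v)
  have hd : ∀ t, HasDerivAt φ (⟪gradient p.F x, v⟫ + 2 * t * (9 * M ^ 7 / 2 * ‖v‖ ^ 2)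
      - ⟪gradient p.F (x + t • v), v⟫) t := by
    intro t
    have h1 : HasDerivAt (fun t : ℝ => x + t • v) v t := by
      simpa using ((hasDerivAt_id t).smul_const v).const_add x
    have h2 := (hp.hasGradientAt_gradient (x + t • v)).hasFDerivAt.comp_hasDerivAt t h1
    have h3 := (((hasDerivAt_id t).mul_const ⟪gradient p.F x, v⟫).add
      ((hasDerivAt_pow 2 t).mul_const (9 * M ^ 7 / 2 * ‖v‖ ^ 2))).sub h2
    refine HasDerivAt.congr_deriv (f := φ) h3 ?_
    simp
  have hmono : MonotoneOn φ (Set.Icc 0 1) := by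
    refine monotoneOn_of_deriv_nonneg (convex_Icc 0 1)
      (fun t _ => (hd t).continuousAt.continuousWithinAt)
      (fun t _ => (hd t).differentiableAt.differentiableWithinAt) fun t ht => ?_
    rw [interior_Icc] at ht
    rw [(hd t).deriv]
    have h1 := hp.gradient_lip (x + t • v) x
    rw [add_sub_cancel_left, norm_smul, Real.norm_of_nonneg ht.1.le] at h1
    have h2 := real_inner_le_norm (gradient p.F (x + t • v) - gradient p.F x) v
    rw [inner_sub_left] at h2
    have h3 := mul_le_mul_of_nonneg_right h1 (norm_nonneg v)
    nlinarith
  have h01 := hmono (by simp) (by simp) zero_le_one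
  have e0 : φ 0 = -p.F x := by simp [φ]
  have e1 : φ 1 = ⟪gradient p.F x, v⟫ + 9 * M ^ 7 / 2 * ‖v‖ ^ 2 - p.F (x + v) := by simp [φ]
  rw [e0, e1] at h01
  linarith

/-- A gradient step of length 1/L_F with L_F = 9M⁷ cannot fall below the minimum. This limits the PL
constants that are possible at a point which is not a minimizer. -/
lemma norm_gradient_sq_le {xstar : Vec dx} (hx : ∀ x, p.F xstar ≤ p.F x) (x : Vec dx) :
    ‖gradient p.F x‖ ^ 2 ≤ 18 * M ^ 7 * (p.F x - p.F xstar) := by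
  have hM : 0 < 9 * M ^ 7 := by have := hp.one_le; positivity
  have h := hp.descent x (-(9 * M ^ 7)⁻¹ • gradient p.F x)
  have h2 := hx (x + -(9 * M ^ 7)⁻¹ • gradient p.F x)
  rw [inner_smul_right, real_inner_self_eq_norm_sq, norm_smul, mul_pow, norm_neg,
    Real.norm_of_nonneg (by positivity)] at h
  have h3 : 9 * M ^ 7 / 2 * ((9 * M ^ 7)⁻¹ ^ 2 * ‖gradient p.F x‖ ^ 2) =
      (9 * M ^ 7)⁻¹ * ‖gradient p.F x‖ ^ 2 / 2 := by field_simp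
  have h4 : (9 * M ^ 7)⁻¹ * ‖gradient p.F x‖ ^ 2 ≤ 2 * (p.F x - p.F xstar) := by
    rw [h3] at h; linarith
  rw [inv_mul_le_iff₀ hM] at h4
  linarith

/-! ### The gradient mapping -/

lemma gradMean_sub_le {r : State dx dy × State dx dy} (hr : Admissible lam r) :
    ‖p.gradMean r.2 - p.gradMean r.1‖ ^ 2 ≤ 18 * M ^ 8 / m * (incX r + incY r + incH r) := by
  rw [Problem.gradMean_eq, Problem.gradMean_eq, ← smul_sub, ← Finset.sum_sub_distrib, incX_add_incY, incH,
    ← Finset.sum_add_distrib]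
  refine (norm_mean_sq_le Finset.univ (by simp) _).trans ?_
  rw [div_eq_mul_one_div (18 * M ^ 8), mul_comm _ (1 / (m : ℝ)), mul_assoc]
  refine mul_le_mul_of_nonneg_left ?_ (by positivity : (0 : ℝ) ≤ 1 / (m : ℝ))
  rw [Finset.mul_sum]
  exact Finset.sum_le_sum fun i _ => hp.blockGrad_lip i _ _ _ _ (hr i).2 (hr i).1

lemma hess_track_le (i : Fin m) (r : State dx dy × State dx dy) :
    ‖hessYY (p.gE i) r.2.x (r.2.y i) - hessYY (p.gE i) r.1.x (r.1.y i)‖ ^ 2 ≤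
      M ^ 2 * (‖r.2.x - r.1.x‖ ^ 2 + ‖r.2.y i - r.1.y i‖ ^ 2) :=
  (hp.mean_lip_gyy i).sq_le _ _ _ _

/-- The estimate `H` is compared with the Hessian at the lower-level solution in three legs: its
error at the previous point, the drift of the Hessian to the current point, and the move from the
current y to y(x). -/
lemma gradMean_sub_gradient_le {r : State dx dy × State dx dy} (hr : Admissible lam r) :
    ‖p.gradMean r.2 - gradient p.F r.2.x‖ ^ 2 ≤
      72 * M ^ 10 / m * (p.errY r.2 + p.errH r + (incX r + incY r)) := by
  have h1 := hp.one_le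
  have h0 := hp.nonneg
  rw [Problem.gradMean_eq, hp.gradient_F, ← smul_sub, ← Finset.sum_sub_distrib, incX_add_incY,
    Problem.errY, Problem.errH, ← Finset.sum_add_distrib, ← Finset.sum_add_distrib]
  refine (norm_mean_sq_le Finset.univ (by simp) _).trans ?_
  rw [div_eq_mul_one_div (72 * M ^ 10), mul_comm _ (1 / (m : ℝ)), mul_assoc]
  refine mul_le_mul_of_nonneg_left ?_ (by positivity : (0 : ℝ) ≤ 1 / (m : ℝ))
  rw [Finset.mul_sum]
  refine Finset.sum_le_sum fun i _ => ?_
  refine (hp.blockGrad_lip i _ _ _ _ (hr i).2 (hp.hess_mem i _ _)).trans ?_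
  have e1 := hp.hess_track_le i r
  rw [norm_sub_rev] at e1
  have e2 := (hp.mean_lip_gyy i).sq_le r.2.x (r.2.y i) r.2.x (p.ySol i r.2.x)
  have e3 := norm_add_three_sq_le (r.2.H i - hessYY (p.gE i) r.1.x (r.1.y i))
    (hessYY (p.gE i) r.1.x (r.1.y i) - hessYY (p.gE i) r.2.x (r.2.y i))
    (hessYY (p.gE i) r.2.x (r.2.y i) - hessYY (p.gE i) r.2.x (p.ySol i r.2.x))
  rw [sub_add_sub_cancel, sub_add_sub_cancel] at e3
  have e4 := norm_sq_le_frobSq (r.2.H i - hessYY (p.gE i) r.1.x (r.1.y i))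
  have e5 := frobSq_nonneg (r.2.H i - hessYY (p.gE i) r.1.x (r.1.y i))
  rw [sub_self, norm_zero] at e2 ⊢
  set u := ‖r.2.y i - p.ySol i r.2.x‖ ^ 2
  set w := ‖r.2.x - r.1.x‖ ^ 2 + ‖r.2.y i - r.1.y i‖ ^ 2
  set f := frobSq (r.2.H i - hessYY (p.gE i) r.1.x (r.1.y i))
  have hu : 0 ≤ u := by positivity
  have hw : 0 ≤ w := by positivity
  have hM2 : 1 ≤ M ^ 2 := one_le_pow₀ h1
  calc _ ≤ 18 * M ^ 8 * (4 * M ^ 2 * (u + f + w)) := by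
        gcongr
        nlinarith [mul_nonneg (sub_nonneg.2 hM2) hu, mul_nonneg (sub_nonneg.2 hM2) e5,
          mul_nonneg (sub_nonneg.2 hM2) hw]
    _ = _ := by ring

/-! ### Pathwise one-step inequalities -/

/-- The inner product in the descent inequality is written as -η⟪∇F, z⟫ = (η/2)(‖z - ∇F‖² - ‖z‖² -
‖∇F‖²). Since η ≤ 1/(2L_F), the curvature term takes only half of -(η/2)‖z‖²; the rest is the
negative multiple of `incX`. -/
lemma objective_step {r : State dx dy × State dx dy} {θ : State dx dy} {η : ℝ} (hm : 0 < m)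
    (hr : Admissible lam r) (hη : 0 < η) (hη' : η ≤ 1 / (2 * (9 * M ^ 7)))
    (hx : θ.x = r.2.x - η • θ.z) :
    p.F θ.x ≤ p.F r.2.x - η / 2 * ‖gradient p.F r.2.x‖ ^ 2 - 1 / (4 * η * m) * incX (r.2, θ)
      + η * p.errZ (r.2, θ)
      + 72 * M ^ 10 * η / m * (p.errY r.2 + p.errH r + (incX r + incY r)) := by
  have hM : 0 < 9 * M ^ 7 := by have := hp.one_le; positivity
  have hm0 : (0 : ℝ) < m := by exact_mod_cast hm
  have h1 := hp.descent r.2.x (-η • θ.z)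
  have hx' : r.2.x + -η • θ.z = θ.x := by rw [hx]; module
  rw [hx'] at h1
  set g := gradient p.F r.2.x
  have h2 : ‖θ.z - g‖ ^ 2 = ‖θ.z‖ ^ 2 - 2 * ⟪g, θ.z⟫ + ‖g‖ ^ 2 := by
    rw [norm_sub_sq_real, real_inner_comm]
  have h3 : ‖θ.z - g‖ ^ 2 ≤ 2 * (p.errZ (r.2, θ) + ‖p.gradMean r.2 - g‖ ^ 2) := by
    have : ‖θ.z - g‖ ≤ ‖θ.z - p.gradMean r.2‖ + ‖p.gradMean r.2 - g‖ := norm_sub_le_norm_sub_add_norm_sub _ _ _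
    calc _ ≤ (‖θ.z - p.gradMean r.2‖ + ‖p.gradMean r.2 - g‖) ^ 2 := by gcongr
      _ ≤ _ := add_sq_le
  have h4 : incX (r.2, θ) = m * η ^ 2 * ‖θ.z‖ ^ 2 := by
    rw [incX, hx, sub_sub_cancel_left, norm_neg, norm_smul, mul_pow, Real.norm_of_nonneg hη.le]
    ring
  have h5 := hp.gradMean_sub_gradient_le hr
  rw [inner_smul_right, norm_smul, mul_pow, norm_neg, Real.norm_of_nonneg hη.le] at h1
  have h6 : 1 / (4 * η * m) * incX (r.2, θ) = η / 4 * ‖θ.z‖ ^ 2 := by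
    rw [h4]; field_simp
  have h7 : 9 * M ^ 7 / 2 * (η ^ 2 * ‖θ.z‖ ^ 2) ≤ η / 4 * ‖θ.z‖ ^ 2 := by
    rw [le_div_iff₀ (by positivity)] at hη'
    have : 0 ≤ η * ‖θ.z‖ ^ 2 := by positivity
    nlinarith
  rw [h6]
  have h8 : η * ‖p.gradMean r.2 - g‖ ^ 2 ≤
      η * (72 * M ^ 10 / m * (p.errY r.2 + p.errH r + (incX r + incY r))) := by gcongr
  have h9 : η * (72 * M ^ 10 / m * (p.errY r.2 + p.errH r + (incX r + incY r))) =
      72 * M ^ 10 * η / m * (p.errY r.2 + p.errH r + (incX r + incY r)) := by ring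
  nlinarith

set_option maxHeartbeats 400000 in
-- An inexact gradient step on a strongly convex smooth function contracts towards y(x); Young's
-- inequality then replaces y(x) by y(x') and costs half of the contraction. A negative multiple of
-- the squared step is kept, because it must later pay for the drift of y in the estimator errors.
lemma block_step (i : Fin m) (x x₀ x' : Vec dx) (y y₀ s : Vec (dy i)) {a : ℝ} (ha : 0 < a)
    (ha' : a ≤ 1 / (8 * M ^ 3)) :
    ‖y - a • s - p.ySol i x'‖ ^ 2 ≤ (1 - a / (2 * M)) * ‖y - p.ySol i x‖ ^ 2
      + 12 * M ^ 3 * a * (‖s - gradY (p.gE i) x₀ y₀‖ ^ 2 + (‖x - x₀‖ ^ 2 + ‖y - y₀‖ ^ 2))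
      - 1 / (8 * M ^ 3 * a) * ‖y - a • s - y‖ ^ 2 + 3 * M ^ 5 / a * ‖x' - x‖ ^ 2 := by
  have h1 := hp.one_le
  have h0 : 0 < M := by linarith
  set ys := p.ySol i x with hys
  set G := gradY (p.gE i) x y with hG
  set u := y - ys with hu
  have hM3 : 1 ≤ M ^ 3 := one_le_pow₀ h1
  have hM2 : 1 ≤ M ^ 2 := one_le_pow₀ h1
  have ha1 : 8 * M ^ 3 * a ≤ 1 := by rwa [le_div_iff₀ (by positivity), mul_comm] at ha'
  have hmono : M⁻¹ * ‖u‖ ^ 2 ≤ ⟪G, u⟫ := by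
    have h := gradY_strong_mono (hp.standing.diff_gradY_gE i) (hp.hess_mem i) x y ys
    rw [hys, hp.gradY_ySol, sub_zero, ← hys] at h
    refine le_trans ?_ h
    gcongr
    rw [inv_le_comm₀ h0 hp.lam_pos]
    exact hp.inv_lam_le
  have hGn : ‖G‖ ≤ M * ‖u‖ := by
    have := (hp.mean_lip_gy i).le_right x y ys
    rwa [hys, hp.gradY_ySol, sub_zero] at this
  set q := ‖s - G‖ ^ 2 with hq
  have hq0 : 0 ≤ q := by positivity
  have hU0 : 0 ≤ ‖u‖ ^ 2 := by positivity
  have hS0 : 0 ≤ ‖s‖ ^ 2 := by positivity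
  have hqle : q ≤ 2 * M ^ 2 *
      (‖s - gradY (p.gE i) x₀ y₀‖ ^ 2 + (‖x - x₀‖ ^ 2 + ‖y - y₀‖ ^ 2)) := by
    have e1 := (hp.mean_lip_gy i).sq_le x y x₀ y₀
    rw [norm_sub_rev] at e1
    have e2 : ‖s - G‖ ≤ ‖s - gradY (p.gE i) x₀ y₀‖ + ‖gradY (p.gE i) x₀ y₀ - G‖ :=
      norm_sub_le_norm_sub_add_norm_sub _ _ _
    have e3 : q ≤ 2 * (‖s - gradY (p.gE i) x₀ y₀‖ ^ 2 + ‖gradY (p.gE i) x₀ y₀ - G‖ ^ 2) := by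
      calc q ≤ (‖s - gradY (p.gE i) x₀ y₀‖ + ‖gradY (p.gE i) x₀ y₀ - G‖) ^ 2 := by
            rw [hq]; gcongr
        _ ≤ _ := add_sq_le
    nlinarith [mul_nonneg (sub_nonneg.2 hM2) (sq_nonneg ‖s - gradY (p.gE i) x₀ y₀‖)]
  have hsu : 3 / 4 * (M⁻¹ * ‖u‖ ^ 2) - M * q ≤ ⟪s, u⟫ := by
    have e1 : ⟪s, u⟫ = ⟪G, u⟫ + ⟪s - G, u⟫ := by rw [← inner_add_left]; congr 1; abel
    have e2 := neg_le_of_abs_le (abs_real_inner_le_norm (s - G) u)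
    have e3 : ‖s - G‖ * ‖u‖ ≤ M * q + 1 / 4 * (M⁻¹ * ‖u‖ ^ 2) := by
      have e4 : M * q + 1 / 4 * (M⁻¹ * ‖u‖ ^ 2) - ‖s - G‖ * ‖u‖ =
          M⁻¹ * (M * ‖s - G‖ - 1 / 2 * ‖u‖) ^ 2 := by
        rw [hq]; field_simp; ring
      have : 0 ≤ M⁻¹ * (M * ‖s - G‖ - 1 / 2 * ‖u‖) ^ 2 := by positivity
      linarith
    linarith
  have hs2 : ‖s‖ ^ 2 ≤ 2 * M ^ 2 * ‖u‖ ^ 2 + 2 * q := by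
    have e2 : ‖s‖ ≤ ‖G‖ + ‖s - G‖ := by
      calc ‖s‖ = ‖G + (s - G)‖ := by congr 1; abel
        _ ≤ _ := norm_add_le _ _
    calc ‖s‖ ^ 2 ≤ (M * ‖u‖ + ‖s - G‖) ^ 2 := by gcongr; linarith
      _ ≤ 2 * ((M * ‖u‖) ^ 2 + ‖s - G‖ ^ 2) := add_sq_le
      _ = _ := by rw [hq]; ring
  have hMi : M⁻¹ * M = 1 := inv_mul_cancel₀ h0.ne'
  have hMi1 : M⁻¹ ≤ 1 := inv_le_one_of_one_le₀ h1
  have hMi0 : 0 < M⁻¹ := inv_pos.2 h0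
  -- This number has two roles: it bounds `a`, so that a²‖s‖² ≤ a k ‖s‖², and it is the coefficient
  -- of the extra a k ‖s‖² that is kept on the left. Together they use only half of 1/M out of the
  -- available 3/2 of 1/M.
  set k := 1 / (8 * M ^ 3) with hk
  have hk0 : 0 < k := by positivity
  have hk1 : k * (2 * M ^ 2) = M⁻¹ / 4 := by rw [hk]; field_simp; norm_num
  have hk2 : 4 * k ≤ M := by
    rw [hk]
    have : 1 / (8 * M ^ 3) ≤ 1 / 8 := by
      apply one_div_le_one_div_of_le <;> linarith
    linarith
  have hmain : ‖y - a • s - ys‖ ^ 2 + a * k * ‖s‖ ^ 2 ≤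
      (1 - a / M) * ‖u‖ ^ 2 + 3 * M * a * q := by
    have e1 : ‖y - a • s - ys‖ ^ 2 = ‖u‖ ^ 2 - 2 * a * ⟪s, u⟫ + a ^ 2 * ‖s‖ ^ 2 := by
      have : y - a • s - ys = u - a • s := by rw [hu]; abel
      rw [this, norm_sub_sq_real, inner_smul_right, norm_smul, mul_pow,
        Real.norm_of_nonneg ha.le, real_inner_comm]
      ring
    have e2 : a ^ 2 * ‖s‖ ^ 2 ≤ a * k * ‖s‖ ^ 2 := by rw [pow_two]; gcongr
    have e3 : a * k * ‖s‖ ^ 2 ≤ a * (M⁻¹ / 4 * ‖u‖ ^ 2 + 2 * k * q) := by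
      rw [mul_assoc]
      refine mul_le_mul_of_nonneg_left ?_ ha.le
      calc k * ‖s‖ ^ 2 ≤ k * (2 * M ^ 2 * ‖u‖ ^ 2 + 2 * q) := by gcongr
        _ = k * (2 * M ^ 2) * ‖u‖ ^ 2 + 2 * k * q := by ring
        _ = _ := by rw [hk1]
    have e4 : a * (3 / 4 * (M⁻¹ * ‖u‖ ^ 2) - M * q) ≤ a * ⟪s, u⟫ := by gcongr
    have e5 : a * (4 * k * q) ≤ a * (M * q) := by gcongr
    rw [e1, div_eq_mul_inv]
    nlinarith
  have haM : a / M = 2 * (a / (2 * M)) := by field_simp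
  -- Half of the contraction rate a/M: (1 + ε)(1 - 2ε) ≤ 1 - ε.
  set ε := a / (2 * M) with hε
  have hε0 : 0 < ε := by positivity
  have ha2 : a ≤ 1 / 8 := by nlinarith
  have hε1 : ε ≤ 1 := by
    rw [hε, div_le_one (by positivity)]; linarith
  have hyoung : ‖y - a • s - p.ySol i x'‖ ^ 2 ≤
      (1 + ε) * ‖y - a • s - ys‖ ^ 2 + (1 + 1 / ε) * (M ^ 4 * ‖x' - x‖ ^ 2) := by
    have e1 := hp.ySol_lip i x' x
    rw [norm_sub_rev, ← hys] at e1
    have e2 : ‖y - a • s - p.ySol i x'‖ ≤ ‖y - a • s - ys‖ + ‖ys - p.ySol i x'‖ :=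
      norm_sub_le_norm_sub_add_norm_sub _ _ _
    set A := ‖y - a • s - ys‖
    set B := ‖ys - p.ySol i x'‖
    have hB : B ^ 2 ≤ M ^ 4 * ‖x' - x‖ ^ 2 := by
      calc B ^ 2 ≤ (M ^ 2 * ‖x' - x‖) ^ 2 := by gcongr
        _ = _ := by ring
    have e3 : (A + B) ^ 2 ≤ (1 + ε) * A ^ 2 + (1 + 1 / ε) * B ^ 2 := by
      have : (1 + ε) * A ^ 2 + (1 + 1 / ε) * B ^ 2 - (A + B) ^ 2 = (1 / ε) * (ε * A - B) ^ 2 := by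
        field_simp; ring
      have : 0 ≤ (1 / ε) * (ε * A - B) ^ 2 := by positivity
      linarith
    calc _ ≤ (A + B) ^ 2 := by gcongr
      _ ≤ _ := e3
      _ ≤ _ := by gcongr
  have hx : (1 + 1 / ε) * (M ^ 4 * ‖x' - x‖ ^ 2) ≤ 3 * M ^ 5 / a * ‖x' - x‖ ^ 2 := by
    rw [← mul_assoc]
    gcongr
    rw [le_div_iff₀ ha, hε]
    have : (1 + 1 / (a / (2 * M))) * M ^ 4 * a = M ^ 4 * a + 2 * M ^ 5 := by field_simp
    rw [this]
    have : M ^ 4 * a ≤ M ^ 5 * 1 := by gcongr <;> [norm_num; linarith]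
    linarith
  have hinc : 1 / (8 * M ^ 3 * a) * ‖y - a • s - y‖ ^ 2 = a * k * ‖s‖ ^ 2 := by
    rw [sub_sub_cancel_left, norm_neg, norm_smul, mul_pow, Real.norm_of_nonneg ha.le, hk]
    field_simp
  rw [hinc]
  have hm1 := mul_le_mul_of_nonneg_left hmain (by linarith : 0 ≤ 1 + ε)
  rw [haM] at hm1
  have hak : 0 ≤ a * k * ‖s‖ ^ 2 := by positivity
  have hf1 : (1 + ε) * ((1 - 2 * ε) * ‖u‖ ^ 2) ≤ (1 - ε) * ‖u‖ ^ 2 := by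
    have e : (1 + ε) * ((1 - 2 * ε) * ‖u‖ ^ 2) = (1 - ε) * ‖u‖ ^ 2 - 2 * (ε ^ 2 * ‖u‖ ^ 2) := by
      ring
    have : 0 ≤ ε ^ 2 * ‖u‖ ^ 2 := by positivity
    linarith
  have hf2 : (1 + ε) * (3 * M * a * q) ≤ 6 * M * a * q := by
    calc (1 + ε) * (3 * M * a * q) ≤ 2 * (3 * M * a * q) := by gcongr; linarith
      _ = _ := by ring
  have hf0 : a * k * ‖s‖ ^ 2 ≤ (1 + ε) * (a * k * ‖s‖ ^ 2) :=
    le_mul_of_one_le_left hak (by linarith)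
  rw [mul_add, mul_add] at hm1
  have hf3 : 6 * M * a * q ≤ 12 * M ^ 3 * a *
      (‖s - gradY (p.gE i) x₀ y₀‖ ^ 2 + (‖x - x₀‖ ^ 2 + ‖y - y₀‖ ^ 2)) := by
    calc 6 * M * a * q ≤ 6 * M * a * (2 * M ^ 2 *
        (‖s - gradY (p.gE i) x₀ y₀‖ ^ 2 + (‖x - x₀‖ ^ 2 + ‖y - y₀‖ ^ 2))) := by gcongr
      _ = _ := by ring
  linarith

lemma lower_step {r : State dx dy × State dx dy} {θ : State dx dy} {a : ℝ} (ha : 0 < a)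
    (ha' : a ≤ 1 / (8 * M ^ 3)) (hy : ∀ i, θ.y i = r.2.y i - a • r.2.s i) :
    p.errY θ ≤ (1 - a / (2 * M)) * p.errY r.2
      + 12 * M ^ 3 * a * (p.errS r + (incX r + incY r))
      - 1 / (8 * M ^ 3 * a) * incY (r.2, θ) + 3 * M ^ 5 / a * incX (r.2, θ) := by
  have h := Finset.sum_le_sum fun i (_ : i ∈ Finset.univ) =>
    hp.block_step i r.2.x r.1.x θ.x (r.2.y i) (r.1.y i) (r.2.s i) ha ha'
  simp only [Finset.sum_add_distrib, Finset.sum_sub_distrib, ← Finset.mul_sum, ← hy] at h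
  simpa [Problem.errY, Problem.errS, incX, incY] using h

end Problem.Bounds

end BSVRB

namespace BSVRB

open scoped RealInnerProductSpace

/-! ### Second moments -/

section moments

variable {S : Type*} [MeasurableSpace S] {ν : Measure S}
  {V : Type*} [NormedAddCommGroup V] [InnerProductSpace ℝ V]

lemma MeasurePreserving.integral_comp_ae {S' W : Type*} [MeasurableSpace S'] {ν' : Measure S'}
    [NormedAddCommGroup W] [NormedSpace ℝ W] {φ : S → S'} (hφ : MeasurePreserving φ ν ν')
    {f : S' → W} (hf : AEStronglyMeasurable f ν') : ∫ s, f (φ s) ∂ν = ∫ s, f s ∂ν' := by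
  rw [← hφ.map_eq] at hf ⊢
  rw [integral_map hφ.measurable.aemeasurable hf]

lemma integrable_norm_sq {W : Type*} [NormedAddCommGroup W] {f : S → W} (hf : MemLp f 2 ν) :
    Integrable (fun s => ‖f s‖ ^ 2) ν :=
  (memLp_two_iff_integrable_sq_norm hf.1).1 hf

lemma integrable_inner_of_memLp {f g : S → V} (hf : MemLp f 2 ν) (hg : MemLp g 2 ν) :
    Integrable (fun s => ⟪f s, g s⟫) ν := by
  refine ((integrable_norm_sq hf).add (integrable_norm_sq hg)).mono' (hf.1.inner hg.1)
    (Filter.Eventually.of_forall fun s => ?_)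
  have h := norm_inner_le_norm (𝕜 := ℝ) (f s) (g s)
  simp only [Pi.add_apply]
  nlinarith [sq_nonneg (‖f s‖ - ‖g s‖), norm_nonneg (f s), norm_nonneg (g s)]

variable [CompleteSpace V] [IsProbabilityMeasure ν]

lemma integral_norm_const_add_sq (A : V) {N : S → V} (hN : MemLp N 2 ν) (h0 : ∫ s, N s ∂ν = 0) :
    ∫ s, ‖A + N s‖ ^ 2 ∂ν = ‖A‖ ^ 2 + ∫ s, ‖N s‖ ^ 2 ∂ν := by
  have hi := hN.integrable one_le_two
  have h1 : Integrable (fun s => ‖A‖ ^ 2 + 2 * ⟪A, N s⟫) ν :=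
    (integrable_const _).add ((hi.const_inner A).const_mul 2)
  simp_rw [norm_add_sq_real]
  rw [integral_add h1 (integrable_norm_sq hN),
    integral_add (integrable_const _) ((hi.const_inner A).const_mul 2), integral_const_mul,
    integral_inner hi, h0]
  simp

lemma integral_norm_sub_mean_sq_le {N : S → V} (hN : MemLp N 2 ν) {v : V}
    (hv : ∫ s, N s ∂ν = v) : ∫ s, ‖N s - v‖ ^ 2 ∂ν ≤ ∫ s, ‖N s‖ ^ 2 ∂ν := by
  have hc : MemLp (fun s => N s - v) 2 ν := hN.sub (memLp_const v)
  have h := integral_norm_const_add_sq v hc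
    (by rw [integral_sub (hN.integrable one_le_two) (integrable_const _), hv]; simp)
  simp only [add_sub_cancel] at h
  rw [h]
  linarith [sq_nonneg ‖v‖]

omit [CompleteSpace V] [IsProbabilityMeasure ν] [InnerProductSpace ℝ V] in
lemma integral_norm_add_sq_le {f g : S → V} (hf : MemLp f 2 ν) (hg : MemLp g 2 ν) :
    ∫ s, ‖f s + g s‖ ^ 2 ∂ν ≤ 2 * ∫ s, ‖f s‖ ^ 2 ∂ν + 2 * ∫ s, ‖g s‖ ^ 2 ∂ν := by
  rw [← integral_const_mul, ← integral_const_mul,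
    ← integral_add ((integrable_norm_sq hf).const_mul 2) ((integrable_norm_sq hg).const_mul 2)]
  refine integral_mono (integrable_norm_sq (hf.add hg))
    (((integrable_norm_sq hf).const_mul 2).add ((integrable_norm_sq hg).const_mul 2)) fun s => ?_
  have := norm_add_le (f s) (g s)
  calc ‖f s + g s‖ ^ 2 ≤ (‖f s‖ + ‖g s‖) ^ 2 := by gcongr
    _ ≤ 2 * (‖f s‖ ^ 2 + ‖g s‖ ^ 2) := add_sq_le
    _ = _ := by ring

end moments

/-! ### Mini-batches -/

section batch

variable {S : Type*} {B : ℕ}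

section

variable [MeasurableSpace S] {ν : Measure S} [IsProbabilityMeasure ν]
  {V : Type*} [NormedAddCommGroup V] [NormedSpace ℝ V]

lemma memLp_batchMean {h : S → V} (hh : MemLp h 2 ν) :
    MemLp (fun b : Fin B → S => batchMean b h) 2 (Measure.pi fun _ => ν) :=
  (memLp_finsetSum _ fun j _ =>
    hh.comp_measurePreserving (measurePreserving_eval (fun _ => ν) j)).const_smul _

lemma integral_batchMean (hB : 1 ≤ B) {h : S → V} (hh : Integrable h ν) :
    ∫ b : Fin B → S, batchMean b h ∂(Measure.pi fun _ => ν) = ∫ s, h s ∂ν := by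
  have hj : ∀ j : Fin B, Integrable (fun b : Fin B → S => h (b j)) (Measure.pi fun _ => ν) :=
    fun j => (measurePreserving_eval (fun _ => ν) j).integrable_comp_of_integrable hh
  have e : ∀ j : Fin B, ∫ b : Fin B → S, h (b j) ∂(Measure.pi fun _ => ν) = ∫ s, h s ∂ν :=
    fun j => MeasurePreserving.integral_comp_ae (measurePreserving_eval (fun _ => ν) j) hh.1
  have hB0 : (B : ℝ) ≠ 0 := by positivity
  simp only [batchMean]
  rw [integral_smul, integral_finsetSum _ fun j _ => hj j]
  simp only [e, Finset.sum_const, Finset.card_univ, Fintype.card_fin]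
  rw [← Nat.cast_smul_eq_nsmul ℝ, smul_smul, one_div, inv_mul_cancel₀ hB0, one_smul]

end

variable {V : Type*} [NormedAddCommGroup V]

lemma batchMean_sub_const [NormedSpace ℝ V] (hB : 1 ≤ B) (b : Fin B → S) (h : S → V) (v : V) :
    batchMean b (fun s => h s - v) = batchMean b h - v := by
  have hB0 : (B : ℝ) ≠ 0 := by positivity
  simp only [batchMean, Finset.sum_sub_distrib, smul_sub, Finset.sum_const, Finset.card_univ,
    Fintype.card_fin]
  rw [← Nat.cast_smul_eq_nsmul ℝ, smul_smul, one_div, inv_mul_cancel₀ hB0, one_smul]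

lemma norm_batchMean_sq_le [NormedSpace ℝ V] (b : Fin B → S) (h : S → V) :
    ‖batchMean b h‖ ^ 2 ≤ batchMean b fun s => ‖h s‖ ^ 2 :=
  norm_mean_sq_le Finset.univ (by simp) _

lemma norm_batchMean_le [NormedSpace ℝ V] (hB : 1 ≤ B) (b : Fin B → S) {h : S → V} {C : ℝ}
    (hC : ∀ s, ‖h s‖ ≤ C) : ‖batchMean b h‖ ≤ C := by
  have hB0 : (0 : ℝ) < B := by positivity
  rw [batchMean, norm_smul, Real.norm_of_nonneg (by positivity), one_div, inv_mul_le_iff₀ hB0]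
  refine (norm_sum_le_of_le _ fun j _ => hC (b j)).trans ?_
  simp

lemma batchMean_map {W : Type*} [NormedSpace ℝ V] [AddCommGroup W] [Module ℝ W] (L : V →ₗ[ℝ] W)
    (b : Fin B → S) (h : S → V) : L (batchMean b h) = batchMean b fun s => L (h s) := by
  simp [batchMean, map_sum]

lemma batchMean_sub [NormedSpace ℝ V] (b : Fin B → S) (h h' : S → V) :
    batchMean b (fun s => h s - h' s) = batchMean b h - batchMean b h' := by
  simp [batchMean, Finset.sum_sub_distrib, smul_sub]

lemma batchMean_smul [NormedSpace ℝ V] (b : Fin B → S) (c : ℝ) (h : S → V) :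
    batchMean b (fun s => c • h s) = c • batchMean b h := by
  simp only [batchMean, ← Finset.smul_sum]
  rw [smul_comm]

lemma batchMean_add [NormedSpace ℝ V] (b : Fin B → S) (h h' : S → V) :
    batchMean b (fun s => h s + h' s) = batchMean b h + batchMean b h' := by
  simp [batchMean, Finset.sum_add_distrib, smul_add]

variable [MeasurableSpace S] {ν : Measure S} [IsProbabilityMeasure ν]
  [InnerProductSpace ℝ V] [CompleteSpace V]

/-- Distinct coordinates of a product measure are independent, so the expectation factors through ∫
h = 0. -/
lemma integral_inner_pair {h : S → V} (hh : MemLp h 2 ν) (h0 : ∫ s, h s ∂ν = 0) {j k : Fin B}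
    (hjk : j ≠ k) :
    ∫ b : Fin B → S, ⟪h (b j), h (b k)⟫ ∂(Measure.pi fun _ => ν) = 0 := by
  have hind : iIndepFun (fun (i : Fin B) (b : Fin B → S) => b i) (Measure.pi fun _ => ν) :=
    iIndepFun_pi (X := fun (_ : Fin B) (s : S) => s) fun _ => aemeasurable_id
  have h2 := hind.indepFun hjk
  rw [indepFun_iff_map_prod_eq_prod_map_map (measurable_pi_apply j).aemeasurable
    (measurable_pi_apply k).aemeasurable] at h2
  have e : ∀ i : Fin B, Measure.map (fun b : Fin B → S => b i) (Measure.pi fun _ => ν) = ν :=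
    fun i => (measurePreserving_eval (fun _ : Fin B => ν) i).map_eq
  rw [e j, e k] at h2
  have hmp : MeasurePreserving (fun b : Fin B → S => (b j, b k)) (Measure.pi fun _ => ν)
      (ν.prod ν) := ⟨by fun_prop, h2⟩
  have hm : AEStronglyMeasurable (fun q : S × S => ⟪h q.1, h q.2⟫) (ν.prod ν) :=
    (hh.1.comp_fst).inner (hh.1.comp_snd)
  have hint : Integrable (fun q : S × S => ⟪h q.1, h q.2⟫) (ν.prod ν) :=
    integrable_inner_of_memLp (f := fun q : S × S => h q.1) (g := fun q : S × S => h q.2)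
      (hh.comp_measurePreserving measurePreserving_fst)
      (hh.comp_measurePreserving measurePreserving_snd)
  rw [MeasurePreserving.integral_comp_ae (f := fun q : S × S => ⟪h q.1, h q.2⟫) hmp hm,
    integral_prod _ hint]
  simp [integral_inner (hh.integrable one_le_two), h0]

/-- The variance of a mini-batch average. -/
lemma integral_norm_batchMean_sq_le (hB : 1 ≤ B) {h : S → V} (hh : MemLp h 2 ν)
    (h0 : ∫ s, h s ∂ν = 0) :
    ∫ b : Fin B → S, ‖batchMean b h‖ ^ 2 ∂(Measure.pi fun _ => ν) =
      1 / B * ∫ s, ‖h s‖ ^ 2 ∂ν := by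
  have hB0 : (B : ℝ) ≠ 0 := by positivity
  have hj : ∀ j : Fin B, MemLp (fun b : Fin B → S => h (b j)) 2 (Measure.pi fun _ => ν) :=
    fun j => hh.comp_measurePreserving (measurePreserving_eval (fun _ => ν) j)
  have e : ∀ j : Fin B, ∫ b : Fin B → S, ⟪h (b j), h (b j)⟫ ∂(Measure.pi fun _ => ν) =
      ∫ s, ‖h s‖ ^ 2 ∂ν := fun j => by
    simp_rw [real_inner_self_eq_norm_sq]
    exact MeasurePreserving.integral_comp_ae (f := fun s => ‖h s‖ ^ 2)
      (measurePreserving_eval (fun _ => ν) j) (hh.1.norm.pow 2)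
  have key : ∀ b : Fin B → S, ‖batchMean b h‖ ^ 2 =
      (1 / (B : ℝ)) ^ 2 * ∑ j, ∑ k, ⟪h (b j), h (b k)⟫ := fun b => by
    rw [batchMean, norm_smul, mul_pow, Real.norm_of_nonneg (by positivity),
      ← real_inner_self_eq_norm_sq, sum_inner]
    simp_rw [inner_sum]
  simp_rw [key]
  rw [integral_const_mul, integral_finsetSum _ fun j _ => integrable_finsetSum _ fun k _ =>
    integrable_inner_of_memLp (hj j) (hj k)]
  have e2 : ∀ j : Fin B, ∫ b : Fin B → S, ∑ k, ⟪h (b j), h (b k)⟫ ∂(Measure.pi fun _ => ν) =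
      ∫ s, ‖h s‖ ^ 2 ∂ν := fun j => by
    rw [integral_finsetSum _ fun k _ => integrable_inner_of_memLp (hj j) (hj k),
      Finset.sum_eq_single j (fun k _ hk => integral_inner_pair hh h0 hk.symm) (by simp), e]
  simp only [e2, Finset.sum_const, Finset.card_univ, Fintype.card_fin, nsmul_eq_mul]
  field_simp

end batch

/-! ### Sampled blocks -/

section blocks

variable {m : ℕ} (I : ℕ)

/-- The uniform distribution on the sets of `I` blocks. -/
noncomputable abbrev blockLaw (m I : ℕ) : Measure (Finset (Fin m)) :=
  uniformOn {J : Finset (Fin m) | J.card = I}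

variable {I}

lemma isProbabilityMeasure_blockLaw (hI : I ≤ m) : IsProbabilityMeasure (blockLaw m I) := by
  refine isProbabilityMeasure_uniformOn (Set.toFinite _) ?_
  obtain ⟨J, -, hJ⟩ := Finset.exists_subset_card_eq (s := (Finset.univ : Finset (Fin m)))
    (by simpa using hI)
  exact ⟨J, hJ⟩

lemma blockLaw_ae_card : ∀ᵐ J ∂(blockLaw m I), J.card = I := by
  rw [ae_iff]
  rw [uniformOn_eq_zero_iff (Set.toFinite _)]
  ext J
  simp

lemma blockLaw_real_congr {J J' : Finset (Fin m)} (h : J.card = J'.card) :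
    (blockLaw m I).real {J} = (blockLaw m I).real {J'} := by
  have e : ∀ J : Finset (Fin m), blockLaw m I {J} =
      (Measure.count {J : Finset (Fin m) | J.card = I})⁻¹ * (if J.card = I then 1 else 0) := by
    intro J
    rw [blockLaw, uniformOn, cond_apply (Set.toFinite _).measurableSet]
    split_ifs with hJ
    · rw [Set.inter_eq_self_of_subset_right (by simpa using hJ), Measure.count_singleton]
    · have : {J : Finset (Fin m) | J.card = I} ∩ {J} = ∅ := by
        ext K
        simp only [Set.mem_inter_iff, Set.mem_ofPred_eq, Set.mem_singleton_iff,
          Set.mem_empty_iff_false, iff_false, not_and]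
        rintro hK rfl
        exact hJ hK
      rw [this]; simp
  rw [measureReal_def, measureReal_def, e, e, h]

section

variable (hI : I ≤ m)
include hI

lemma integrable_blockLaw {W : Type*} [NormedAddCommGroup W] (f : Finset (Fin m) → W) :
    Integrable f (blockLaw m I) := by
  have := isProbabilityMeasure_blockLaw hI
  exact Integrable.of_finite

/-- The mass of a set of blocks depends only on its cardinality. This symmetry yields the first and
second moments of the selection indicators without counting subsets. -/
lemma integral_blockLaw_perm (σ : Equiv.Perm (Fin m)) (f : Finset (Fin m) → ℝ) :
    ∫ J, f (J.map σ.toEmbedding) ∂(blockLaw m I) = ∫ J, f J ∂(blockLaw m I) := by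
  rw [integral_fintype (integrable_blockLaw hI _), integral_fintype (integrable_blockLaw hI _)]
  rw [← Equiv.sum_comp (Equiv.finsetCongr σ) fun J => (blockLaw m I).real {J} • f J]
  refine Finset.sum_congr rfl fun J _ => ?_
  rw [blockLaw_real_congr (J' := J.map σ.toEmbedding) (by simp)]
  rfl

/-- The indicator of the event that block `i` is sampled. -/
noncomputable def sel (i : Fin m) (J : Finset (Fin m)) : ℝ := if i ∈ J then 1 else 0

omit hI in
lemma sum_sel (J : Finset (Fin m)) : ∑ i, sel i J = J.card := by
  simp [sel]

omit hI in
lemma sel_map {σ : Equiv.Perm (Fin m)} {i j : Fin m} (h : σ i = j) (J : Finset (Fin m)) :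
    sel j (J.map σ.toEmbedding) = sel i J := by
  simp [sel, ← h]

lemma integral_sel (i : Fin m) : ∫ J, sel i J ∂(blockLaw m I) = I / m := by
  have := isProbabilityMeasure_blockLaw hI
  have h1 : ∀ j, ∫ J, sel j J ∂(blockLaw m I) = ∫ J, sel i J ∂(blockLaw m I) := fun j => by
    rw [← integral_blockLaw_perm hI (Equiv.swap i j)]
    congr 1
    ext J
    exact sel_map (Equiv.swap_apply_left i j) J
  -- All m inclusion probabilities are equal, and they add up to I.
  have h2 : ∑ j, ∫ J, sel j J ∂(blockLaw m I) = I := by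
    rw [← integral_finsetSum _ fun j _ => integrable_blockLaw hI _]
    simp_rw [sum_sel]
    rw [integral_congr_ae (g := fun _ => (I : ℝ))]
    · simp
    · filter_upwards [blockLaw_ae_card] with J hJ
      rw [hJ]
  simp only [h1, Finset.sum_const, Finset.card_univ, Fintype.card_fin, nsmul_eq_mul] at h2
  have hm : (m : ℝ) ≠ 0 := by
    have := i.pos
    positivity
  rw [eq_div_iff hm]
  linarith

lemma integral_sel_mul_sel {i j : Fin m} (hij : i ≠ j) :
    ∫ J, sel i J * sel j J ∂(blockLaw m I) = (I - 1) * (I / m) / (m - 1) := by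
  have := isProbabilityMeasure_blockLaw hI
  have h1 : ∀ k, k ≠ j → ∫ J, sel k J * sel j J ∂(blockLaw m I) =
      ∫ J, sel i J * sel j J ∂(blockLaw m I) := fun k hk => by
    rw [← integral_blockLaw_perm hI (Equiv.swap i k)]
    congr 1
    ext J
    rw [sel_map (Equiv.swap_apply_left i k),
      sel_map (Equiv.swap_apply_of_ne_of_ne hij.symm hk.symm)]
  -- Fixing j and summing over k gives I times the probability of j; the term k = j is known and the
  -- other m - 1 terms are equal.
  have h2 : ∑ k, ∫ J, sel k J * sel j J ∂(blockLaw m I) = I * (I / m) := by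
    rw [← integral_finsetSum _ fun j _ => integrable_blockLaw hI _]
    simp_rw [← Finset.sum_mul, sum_sel]
    rw [integral_congr_ae (g := fun J => (I : ℝ) * sel j J)]
    · rw [integral_const_mul, integral_sel hI]
    · filter_upwards [blockLaw_ae_card] with J hJ
      rw [hJ]
  have h3 : ∫ J, sel j J * sel j J ∂(blockLaw m I) = I / m := by
    rw [← integral_sel hI j]
    congr 1
    ext J
    simp [sel]
  rw [← Finset.add_sum_erase _ _ (Finset.mem_univ j), h3,
    Finset.sum_congr rfl fun k hk => h1 k (Finset.ne_of_mem_erase hk)] at h2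
  rw [Finset.sum_const, Finset.card_erase_of_mem (Finset.mem_univ j), Finset.card_univ,
    Fintype.card_fin, nsmul_eq_mul, Nat.cast_sub j.pos] at h2
  have hm2 : 2 ≤ m := by
    by_contra! h
    have h4 := i.isLt
    have h5 := j.isLt
    exact hij (Fin.ext (by omega))
  have hm : (0 : ℝ) < m - 1 := by
    have : (2 : ℝ) ≤ m := by exact_mod_cast hm2
    linarith
  rw [eq_div_iff hm.ne']
  push_cast at h2
  linarith

variable {V : Type*} [NormedAddCommGroup V] [InnerProductSpace ℝ V]

/-- All off-diagonal moments equal q, and ∑ⱼ ⟪b_i, b_j⟫ = 0, so the double sum collapses to (I/m -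
q) ∑ ‖b_i‖². Sampling without replacement is thus no worse than independent sampling. -/
lemma integral_norm_sum_sel_sq_le (hI1 : 1 ≤ I) (b : Fin m → V)
    (hb : ∑ i, b i = 0) :
    ∫ J, ‖∑ i, sel i J • b i‖ ^ 2 ∂(blockLaw m I) ≤ I / m * ∑ i, ‖b i‖ ^ 2 := by
  have := isProbabilityMeasure_blockLaw hI
  have key : ∀ J : Finset (Fin m), ‖∑ i, sel i J • b i‖ ^ 2 =
      ∑ i, ∑ j, (sel i J * sel j J) * ⟪b i, b j⟫ := fun J => by
    rw [← real_inner_self_eq_norm_sq, sum_inner]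
    simp_rw [inner_sum, real_inner_smul_left, real_inner_smul_right, mul_assoc]
  simp_rw [key]
  rw [integral_finsetSum _ fun i _ => integrable_blockLaw hI _]
  set q : ℝ := (I - 1) * (I / m) / (m - 1) with hq
  have hq0 : 0 ≤ q := by
    have h1 : (1 : ℝ) ≤ I := by exact_mod_cast hI1
    have h2 : (1 : ℝ) ≤ m := by exact_mod_cast hI1.trans hI
    exact div_nonneg (mul_nonneg (by linarith) (by positivity)) (by linarith)
  have h1 : ∀ i, ∫ J, ∑ j, (sel i J * sel j J) * ⟪b i, b j⟫ ∂(blockLaw m I) =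
      (I / m - q) * ‖b i‖ ^ 2 := fun i => by
    rw [integral_finsetSum _ fun i _ => integrable_blockLaw hI _]
    simp_rw [integral_mul_const]
    have h2 : ∀ j, (∫ J, sel i J * sel j J ∂(blockLaw m I)) * ⟪b i, b j⟫ =
        q * ⟪b i, b j⟫ + if i = j then (I / m - q) * ⟪b i, b i⟫ else 0 := fun j => by
      split_ifs with h
      · subst h
        have h3 : ∫ J, sel i J * sel i J ∂(blockLaw m I) = I / m := by
          rw [← integral_sel hI i]
          congr 1
          ext J
          simp [sel]
        rw [h3]; ring
      · rw [integral_sel_mul_sel hI h, add_zero]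
    simp_rw [h2]
    rw [Finset.sum_add_distrib, ← Finset.mul_sum, ← inner_sum, hb]
    simp
  simp_rw [h1]
  rw [← Finset.mul_sum]
  gcongr
  linarith

end

end blocks

end BSVRB

namespace BSVRB

open scoped RealInnerProductSpace

/-! ### The recursive estimators with error correction -/

section correction

variable {S : Type*} {B : ℕ} [MeasurableSpace S] {ν : Measure S} [IsProbabilityMeasure ν]
  {V : Type*} [NormedAddCommGroup V] [InnerProductSpace ℝ V] [CompleteSpace V]

/-- The corrected update `(1 - α) s + α h_new + γ (h_new - h_old)`. -/
noncomputable def corrected (α γ : ℝ) (s : V) (hn ho : S → V) (b : Fin B → S) : V :=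
  (1 - α) • s + α • batchMean b hn + γ • (batchMean b hn - batchMean b ho)

omit [CompleteSpace V] in
lemma memLp_corrected {α γ : ℝ} {s : V} {hn ho : S → V} (h1 : MemLp hn 2 ν) (h2 : MemLp ho 2 ν) :
    MemLp (fun b : Fin B → S => corrected α γ s hn ho b) 2 (Measure.pi fun _ => ν) := by
  have m1 := memLp_batchMean (B := B) h1
  have m2 := memLp_batchMean (B := B) h2
  have c1 : MemLp (fun _ : Fin B → S => (1 - α) • s) 2 (Measure.pi fun _ => ν) := memLp_const _
  have c2 : MemLp (fun b : Fin B → S => α • batchMean b hn) 2 (Measure.pi fun _ => ν) :=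
    m1.const_smul α
  have c3 : MemLp (fun b : Fin B → S => γ • (batchMean b hn - batchMean b ho)) 2
      (Measure.pi fun _ => ν) := (m1.sub m2).const_smul γ
  exact (c1.add c2).add c3

variable {α γ σ δ : ℝ} {s v u : V} {hn ho : S → V}

lemma integral_norm_batch_sub_le (hB : 1 ≤ B) (h1 : MemLp hn 2 ν) (e1 : ∫ x, hn x ∂ν = v)
    (hσ : ∫ x, ‖hn x - v‖ ^ 2 ∂ν ≤ σ) :
    ∫ b : Fin B → S, ‖batchMean b hn - v‖ ^ 2 ∂(Measure.pi fun _ => ν) ≤ σ / B := by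
  have hc : MemLp (fun x => hn x - v) 2 ν := h1.sub (memLp_const v)
  have h0 : ∫ x, (hn x - v) ∂ν = 0 := by
    rw [integral_sub (h1.integrable one_le_two) (integrable_const _), e1]; simp
  have h := integral_norm_batchMean_sq_le hB hc h0
  simp_rw [batchMean_sub_const hB] at h
  rw [h, one_div, inv_mul_eq_div]
  gcongr

/-- The new error is a deterministic combination of the old error s - u and the drift v - u, plus
the batch mean of a centred variable, so squared norms add. The noise is α times the centred sample
plus γ times the centred sample difference; only the first part keeps its factor 1/B. -/
lemma integral_corrected_sub_mean_le (hB : 1 ≤ B) (h1 : MemLp hn 2 ν) (h2 : MemLp ho 2 ν)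
    (e1 : ∫ x, hn x ∂ν = v) (e2 : ∫ x, ho x ∂ν = u) (hσ : ∫ x, ‖hn x - v‖ ^ 2 ∂ν ≤ σ)
    (hδ : ∀ x, ‖hn x - ho x‖ ^ 2 ≤ δ) :
    ∫ b : Fin B → S, ‖corrected α γ s hn ho b - v‖ ^ 2 ∂(Measure.pi fun _ => ν) ≤
      ‖(1 - α) • (s - u) + (γ - (1 - α)) • (v - u)‖ ^ 2 + 2 * α ^ 2 * σ / B
        + 2 * γ ^ 2 * δ := by
  set N : S → V := fun x => α • (hn x - v) + γ • ((hn x - ho x) - (v - u)) with hN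
  have i1 := h1.integrable one_le_two
  have i2 := h2.integrable one_le_two
  have m1 : MemLp (fun x => hn x - v) 2 ν := h1.sub (memLp_const v)
  have m2 : MemLp (fun x => hn x - ho x) 2 ν := h1.sub h2
  have m3 : MemLp (fun x => (hn x - ho x) - (v - u)) 2 ν := m2.sub (memLp_const _)
  have n1 : MemLp (fun x => α • (hn x - v)) 2 ν := m1.const_smul α
  have n3 : MemLp (fun x => γ • ((hn x - ho x) - (v - u))) 2 ν := m3.const_smul γ
  have mN : MemLp N 2 ν := n1.add n3
  have z1 : ∫ x, (hn x - v) ∂ν = 0 := by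
    rw [integral_sub i1 (integrable_const _), e1]; simp
  have zd : ∫ x, (hn x - ho x) ∂ν = v - u := by rw [integral_sub i1 i2, e1, e2]
  have z3 : ∫ x, ((hn x - ho x) - (v - u)) ∂ν = 0 := by
    rw [integral_sub (m2.integrable one_le_two) (integrable_const _), zd]; simp
  have zN : ∫ x, N x ∂ν = 0 := by
    simp only [hN]
    rw [integral_add (n1.integrable one_le_two) (n3.integrable one_le_two),
      integral_smul, integral_smul, z1, z3]
    simp
  have hdec : ∀ b : Fin B → S, corrected α γ s hn ho b - v =
      ((1 - α) • (s - u) + (γ - (1 - α)) • (v - u)) + batchMean b N := fun b => by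
    rw [hN, batchMean_add, batchMean_smul, batchMean_smul, batchMean_sub_const hB,
      batchMean_sub_const hB, batchMean_sub, corrected]
    module
  simp_rw [hdec]
  rw [integral_norm_const_add_sq _ (memLp_batchMean mN)
    (by rw [integral_batchMean hB (mN.integrable one_le_two), zN]),
    integral_norm_batchMean_sq_le hB mN zN, add_assoc]
  have b1 := integral_norm_add_sq_le n1 n3
  simp only [norm_smul, mul_pow, integral_const_mul, Real.norm_eq_abs,
    sq_abs] at b1
  have b2 := integral_norm_sub_mean_sq_le m2 zd
  have b3 : ∫ x, ‖hn x - ho x‖ ^ 2 ∂ν ≤ δ := by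
    have := integral_mono (integrable_norm_sq m2) (integrable_const δ) hδ
    simpa using this
  have hB1 : (1 : ℝ) ≤ B := by exact_mod_cast hB
  have hδ0 : 0 ≤ δ := (integral_nonneg fun x => by positivity).trans b3
  have b4 : ∫ x, ‖N x‖ ^ 2 ∂ν ≤ 2 * α ^ 2 * σ + 2 * γ ^ 2 * δ := by
    refine b1.trans ?_
    nlinarith [mul_le_mul_of_nonneg_left hσ (sq_nonneg α),
      mul_le_mul_of_nonneg_left (b2.trans b3) (sq_nonneg γ)]
  gcongr
  calc 1 / (B : ℝ) * ∫ x, ‖N x‖ ^ 2 ∂ν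
      ≤ 1 / (B : ℝ) * (2 * α ^ 2 * σ + 2 * γ ^ 2 * δ) := by gcongr
    _ = 2 * α ^ 2 * σ / B + 1 / B * (2 * γ ^ 2 * δ) := by ring
    _ ≤ 2 * α ^ 2 * σ / B + 1 * (2 * γ ^ 2 * δ) := by
        gcongr
        rw [div_le_one (by linarith)]; exact hB1
    _ = _ := by ring

/-- Bounds the move of the estimator itself. It is needed for `H`, whose increments enter the error
of `z`. -/
lemma integral_corrected_sub_self_le (hB : 1 ≤ B) (h1 : MemLp hn 2 ν) (h2 : MemLp ho 2 ν)
    (e1 : ∫ x, hn x ∂ν = v) (hσ : ∫ x, ‖hn x - v‖ ^ 2 ∂ν ≤ σ)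
    (hδ : ∀ x, ‖hn x - ho x‖ ^ 2 ≤ δ) (huv : ‖v - u‖ ^ 2 ≤ δ) :
    ∫ b : Fin B → S, ‖corrected α γ s hn ho b - s‖ ^ 2 ∂(Measure.pi fun _ => ν) ≤
      4 * α ^ 2 * ‖s - u‖ ^ 2 + (4 * α ^ 2 + 2 * γ ^ 2) * δ + 2 * α ^ 2 * σ / B := by
  have m1 : MemLp (fun x => hn x - v) 2 ν := h1.sub (memLp_const v)
  have z1 : ∫ x, (hn x - v) ∂ν = 0 := by
    rw [integral_sub (h1.integrable one_le_two) (integrable_const _), e1]; simp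
  have hdec : ∀ b : Fin B → S, corrected α γ s hn ho b - s =
      α • ((v - s) + batchMean b fun x => hn x - v) + γ • (batchMean b fun x => hn x - ho x) :=
    fun b => by
      rw [batchMean_sub_const hB, batchMean_sub, corrected]
      module
  have mb : MemLp (fun b : Fin B → S => batchMean b fun x => hn x - v) 2
      (Measure.pi fun _ => ν) := memLp_batchMean m1
  have mb1 : MemLp (fun b : Fin B → S => (v - s) + batchMean b fun x => hn x - v) 2
      (Measure.pi fun _ => ν) := by
    have hc : MemLp (fun _ : Fin B → S => v - s) 2 (Measure.pi fun _ => ν) := memLp_const _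
    exact hc.add mb
  have mb2 : MemLp (fun b : Fin B → S => batchMean b fun x => hn x - ho x) 2
      (Measure.pi fun _ => ν) := memLp_batchMean (h1.sub h2)
  simp_rw [hdec]
  have n1 : MemLp (fun b : Fin B → S => α • ((v - s) + batchMean b fun x => hn x - v)) 2
      (Measure.pi fun _ => ν) := mb1.const_smul α
  have n2 : MemLp (fun b : Fin B → S => γ • batchMean b fun x => hn x - ho x) 2
      (Measure.pi fun _ => ν) := mb2.const_smul γ
  refine (integral_norm_add_sq_le n1 n2).trans ?_
  simp only [norm_smul, mul_pow, integral_const_mul, Real.norm_eq_abs, sq_abs]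
  rw [integral_norm_const_add_sq _ mb
    (by rw [integral_batchMean hB (m1.integrable one_le_two), z1]),
    integral_norm_batchMean_sq_le hB m1 z1]
  have c1 : ∫ b : Fin B → S, ‖batchMean b fun x => hn x - ho x‖ ^ 2 ∂(Measure.pi fun _ => ν) ≤
      δ := by
    have := integral_mono (integrable_norm_sq mb2) (integrable_const δ) fun b => by
      refine (norm_batchMean_sq_le b _).trans ?_
      have h3 := norm_batchMean_le hB b (h := fun x => ‖hn x - ho x‖ ^ 2) (C := δ) fun x => by
        rw [Real.norm_of_nonneg (by positivity)]; exact hδ x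
      exact (le_abs_self _).trans h3
    simpa using this
  have c2 : ‖v - s‖ ^ 2 ≤ 2 * (δ + ‖s - u‖ ^ 2) := by
    have := norm_sub_le_norm_sub_add_norm_sub v u s
    rw [norm_sub_rev u s] at this
    calc ‖v - s‖ ^ 2 ≤ (‖v - u‖ + ‖s - u‖) ^ 2 := by gcongr
      _ ≤ 2 * (‖v - u‖ ^ 2 + ‖s - u‖ ^ 2) := add_sq_le
      _ ≤ _ := by gcongr
  have c3 : 1 / (B : ℝ) * ∫ x, ‖hn x - v‖ ^ 2 ∂ν ≤ σ / B := by
    rw [one_div, inv_mul_eq_div]; gcongr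
  have c4 := mul_le_mul_of_nonneg_left (add_le_add c2 c3) (sq_nonneg α)
  have c5 := mul_le_mul_of_nonneg_left c1 (sq_nonneg γ)
  have e : 4 * α ^ 2 * ‖s - u‖ ^ 2 + (4 * α ^ 2 + 2 * γ ^ 2) * δ + 2 * α ^ 2 * σ / B =
      2 * (α ^ 2 * (2 * (δ + ‖s - u‖ ^ 2) + σ / B)) + 2 * (γ ^ 2 * δ) := by ring
  rw [e]
  linarith

end correction

/-! ### Expectations over the draw of one iteration -/

variable {m dx : ℕ} {dy : Fin m → ℕ} {Ξ : Type u} {Z : Type v}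
  [MeasurableSpace Ξ] [MeasurableSpace Z]

/-- The law of the mini-batches of block `i`. -/
noncomputable def Problem.batchLaw (p : Problem m dx dy Ξ Z) (B : ℕ) (i : Fin m) :
    Measure ((Fin B → Ξ) × (Fin B → Z)) :=
  (Measure.pi fun _ => p.P i).prod (Measure.pi fun _ => p.Q i)

namespace Problem.Bounds

variable {p : Problem m dx dy Ξ Z} {lam M : ℝ} (hp : p.Bounds lam M) {I B : ℕ} (hI : I ≤ m)
include hp

lemma isProbabilityMeasure_batchLaw (i : Fin m) : IsProbabilityMeasure (p.batchLaw B i) := by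
  have := hp.standing.isProb_P
  have := hp.standing.isProb_Q
  unfold Problem.batchLaw
  infer_instance

include hI

lemma isProbabilityMeasure_drawLaw : IsProbabilityMeasure (p.drawLaw I B) := by
  have := hp.standing.isProb_P
  have := hp.standing.isProb_Q
  have := isProbabilityMeasure_blockLaw hI
  unfold Problem.drawLaw
  infer_instance

/-- Reduces every expectation that involves a single block to the product of the law of the sampled
set and the law of the batches of that block. -/
lemma measurePreserving_block (i : Fin m) :
    MeasurePreserving (fun d : Draw m B Ξ Z => (d.1, (d.2.1 i, d.2.2 i))) (p.drawLaw I B)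
      ((blockLaw m I).prod (p.batchLaw B i)) := by
  have := hp.standing.isProb_P
  have := hp.standing.isProb_Q
  have := isProbabilityMeasure_blockLaw hI
  exact (MeasurePreserving.id _).prod
    ((measurePreserving_eval (fun i => Measure.pi fun _ : Fin B => p.P i) i).prod
      (measurePreserving_eval (fun i => Measure.pi fun _ : Fin B => p.Q i) i))

lemma drawLaw_ae_card : ∀ᵐ d ∂(p.drawLaw I B), d.1.card = I := by
  have := hp.standing.isProb_P
  have := hp.standing.isProb_Q
  have := isProbabilityMeasure_blockLaw hI
  have h : MeasurePreserving (fun d : Draw m B Ξ Z => d.1) (p.drawLaw I B) (blockLaw m I) :=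
    measurePreserving_fst
  exact h.quasiMeasurePreserving.ae blockLaw_ae_card

section

variable {W : Type*} [NormedAddCommGroup W] [NormedSpace ℝ W]
  {ψ : (Fin B → Ξ) × (Fin B → Z) → W} {i : Fin m}

lemma integrable_sel_smul (hψ : Integrable ψ (p.batchLaw B i)) :
    Integrable (fun d : Draw m B Ξ Z => sel i d.1 • ψ (d.2.1 i, d.2.2 i)) (p.drawLaw I B) :=
  (hp.measurePreserving_block hI i).integrable_comp_of_integrable
    (Integrable.smul_prod (integrable_blockLaw hI (sel i)) hψ)

lemma integral_sel_smul (hψ : Integrable ψ (p.batchLaw B i)) :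
    ∫ d, sel i d.1 • ψ (d.2.1 i, d.2.2 i) ∂(p.drawLaw I B) =
      (I / m : ℝ) • ∫ b, ψ b ∂(p.batchLaw B i) := by
  have := hp.isProbabilityMeasure_batchLaw (B := B) i
  have := isProbabilityMeasure_blockLaw hI
  rw [MeasurePreserving.integral_comp_ae
    (f := fun q : Finset (Fin m) × ((Fin B → Ξ) × (Fin B → Z)) => sel i q.1 • ψ q.2)
    (hp.measurePreserving_block hI i)
    (Integrable.smul_prod (integrable_blockLaw hI (sel i)) hψ).1,
    integral_prod_smul, integral_sel hI]

lemma memLp_sel_smul (hψ : MemLp ψ 2 (p.batchLaw B i)) :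
    MemLp (fun d : Draw m B Ξ Z => sel i d.1 • ψ (d.2.1 i, d.2.2 i)) 2 (p.drawLaw I B) := by
  have := hp.isProbabilityMeasure_batchLaw (B := B) i
  have := isProbabilityMeasure_blockLaw hI
  have h1 : MemLp (fun d : Draw m B Ξ Z => ψ (d.2.1 i, d.2.2 i)) 2 (p.drawLaw I B) :=
    (hψ.comp_measurePreserving measurePreserving_snd).comp_measurePreserving
      (hp.measurePreserving_block hI i)
  refine h1.of_le (hp.integrable_sel_smul hI (hψ.integrable one_le_two)).1
    (Filter.Eventually.of_forall fun d => ?_)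
  rw [sel, norm_smul]
  split_ifs <;> simp

lemma integral_switch [CompleteSpace W] (hψ : Integrable ψ (p.batchLaw B i)) (c : W) :
    Integrable (fun d : Draw m B Ξ Z => if i ∈ d.1 then ψ (d.2.1 i, d.2.2 i) else c)
      (p.drawLaw I B) ∧
    ∫ d : Draw m B Ξ Z, (if i ∈ d.1 then ψ (d.2.1 i, d.2.2 i) else c) ∂(p.drawLaw I B) =
      (I / m : ℝ) • ∫ b, ψ b ∂(p.batchLaw B i) + (1 - I / m : ℝ) • c := by
  have := hp.isProbabilityMeasure_batchLaw (B := B) i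
  have := hp.isProbabilityMeasure_drawLaw (B := B) hI
  have h0 : Integrable (fun b => ψ b - c) (p.batchLaw B i) := hψ.sub (integrable_const c)
  have e : (fun d : Draw m B Ξ Z => if i ∈ d.1 then ψ (d.2.1 i, d.2.2 i) else c) =
      fun d => sel i d.1 • (ψ (d.2.1 i, d.2.2 i) - c) + c := by
    ext d
    rw [sel]
    split_ifs <;> simp
  rw [e]
  refine ⟨(hp.integrable_sel_smul hI h0).add (integrable_const c), ?_⟩
  rw [integral_add (hp.integrable_sel_smul hI h0) (integrable_const c),
    hp.integral_sel_smul hI h0, integral_sub hψ (integrable_const c)]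
  simp only [integral_const, probReal_univ, one_smul]
  module

end

end Problem.Bounds

end BSVRB

-- The correction factor and the contraction of `s` and `H`

namespace BSVRB

open scoped RealInnerProductSpace

variable {m dx : ℕ} {dy : Fin m → ℕ} {Ξ : Type u} {Z : Type v}
  [MeasurableSpace Ξ] [MeasurableSpace Z]

section gamma

variable {m I : ℕ} {α : ℝ}

/-- The identity for which γ is chosen. With probability q the new error has mean (1 - α)(s - u) +
(γ - (1 - α))(v - u), and otherwise it is (s - u) - (v - u); in the average of the squared norms the
two cross terms are then opposite. -/
lemma gammaOf_sub (hI1 : 1 ≤ I) (hI : I ≤ m) (hα : α ≤ 1 / 2) :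
    (I / m : ℝ) * ((gammaOf m I α - (1 - α)) * (1 - α)) = 1 - I / m := by
  have h1 : (0 : ℝ) < I := by exact_mod_cast hI1
  have h2 : (0 : ℝ) < m := by exact_mod_cast hI1.trans hI
  have h3 : (1 - α) ≠ 0 := by linarith
  unfold gammaOf
  field_simp
  ring

lemma gammaOf_sub_sq_le (hI1 : 1 ≤ I) (hI : I ≤ m) (hα0 : 0 < α) (hα : α ≤ 1 / 2) :
    (I / m : ℝ) * (gammaOf m I α - (1 - α)) ^ 2 + (1 - I / m) ≤ 5 * (I / m : ℝ)⁻¹ ∧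
      (I / m : ℝ) * gammaOf m I α ^ 2 ≤ 4 * (I / m : ℝ)⁻¹ := by
  have h := gammaOf_sub hI1 hI hα
  set q : ℝ := I / m with hq
  set κ := gammaOf m I α - (1 - α) with hκ
  have hg : gammaOf m I α = κ + (1 - α) := by rw [hκ]; ring
  have h1 : (0 : ℝ) < I := by exact_mod_cast hI1
  have h2 : (0 : ℝ) < m := by exact_mod_cast hI1.trans hI
  have hq0 : 0 < q := by positivity
  have hq1 : q ≤ 1 := by
    rw [hq, div_le_one h2]; exact_mod_cast hI
  have hκ0 : 0 ≤ κ := by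
    by_contra! hn
    have : κ * (1 - α) ≤ 0 := mul_nonpos_of_nonpos_of_nonneg hn.le (by linarith)
    have h3 : q * (κ * (1 - α)) < 0 := by
      refine mul_neg_of_pos_of_neg hq0 (mul_neg_of_neg_of_pos hn (by linarith))
    linarith
  have hqκ : q * κ ≤ 2 * (1 - q) := by
    have : q * κ * (1 - α) = 1 - q := by rw [← h]; ring
    have : 0 ≤ q * κ := by positivity
    nlinarith
  have hqg : q * gammaOf m I α ≤ 2 := by rw [hg]; nlinarith
  have hg0 : 0 ≤ gammaOf m I α := by rw [hg]; linarith
  have hinv : q * q⁻¹ = 1 := mul_inv_cancel₀ hq0.ne'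
  have hinv1 : 1 ≤ q⁻¹ := (one_le_inv₀ hq0).2 hq1
  constructor
  · have e : q * κ ^ 2 = (q * κ) ^ 2 * q⁻¹ := by field_simp
    have : (q * κ) ^ 2 ≤ 4 := by
      have : 0 ≤ q * κ := by positivity
      nlinarith
    rw [e]
    nlinarith
  · have e : q * gammaOf m I α ^ 2 = (q * gammaOf m I α) ^ 2 * q⁻¹ := by field_simp
    have : (q * gammaOf m I α) ^ 2 ≤ 4 := by
      have : 0 ≤ q * gammaOf m I α := by positivity
      nlinarith
    rw [e]
    nlinarith

end gamma

namespace Problem.Bounds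

variable {p : Problem m dx dy Ξ Z} {lam M : ℝ} (hp : p.Bounds lam M) {I B : ℕ} (hI : I ≤ m)
include hp hI

section

variable {V : Type*} [NormedAddCommGroup V] [InnerProductSpace ℝ V] [CompleteSpace V]
  {α σ δ : ℝ} {s v u : V} {hn ho : Z → V} {i : Fin m}

lemma integral_switch_snd {W : Type*} [NormedAddCommGroup W] [NormedSpace ℝ W] [CompleteSpace W]
    {ψ : (Fin B → Z) → W} (hψ : Integrable ψ (Measure.pi fun _ => p.Q i)) (c : W) :
    Integrable (fun d : Draw m B Ξ Z => if i ∈ d.1 then ψ (d.2.2 i) else c) (p.drawLaw I B) ∧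
    ∫ d : Draw m B Ξ Z, (if i ∈ d.1 then ψ (d.2.2 i) else c) ∂(p.drawLaw I B) =
      (I / m : ℝ) • ∫ b, ψ b ∂(Measure.pi fun _ => p.Q i) + (1 - I / m : ℝ) • c := by
  have := hp.standing.isProb_P
  have := hp.standing.isProb_Q
  have hsnd : MeasurePreserving (Prod.snd : (Fin B → Ξ) × (Fin B → Z) → _) (p.batchLaw B i)
      (Measure.pi fun _ => p.Q i) := measurePreserving_snd
  have h1 := hp.integral_switch hI (hsnd.integrable_comp_of_integrable hψ) c
  have h2 := MeasurePreserving.integral_comp_ae hsnd hψ.1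
  refine ⟨h1.1, ?_⟩
  rw [← h2]
  exact h1.2

lemma integral_corrected_step (hI1 : 1 ≤ I) (hB : 1 ≤ B) (hα0 : 0 < α) (hα : α ≤ 1 / 2)
    (h1 : MemLp hn 2 (p.Q i)) (h2 : MemLp ho 2 (p.Q i))
    (e1 : ∫ x, hn x ∂(p.Q i) = v) (e2 : ∫ x, ho x ∂(p.Q i) = u)
    (hσ : ∫ x, ‖hn x - v‖ ^ 2 ∂(p.Q i) ≤ σ) (hδ : ∀ x, ‖hn x - ho x‖ ^ 2 ≤ δ) :
    Integrable (fun d : Draw m B Ξ Z => ‖(if i ∈ d.1 then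
      corrected α (gammaOf m I α) s hn ho (d.2.2 i) else s) - v‖ ^ 2) (p.drawLaw I B) ∧
    ∫ d : Draw m B Ξ Z, ‖(if i ∈ d.1 then
      corrected α (gammaOf m I α) s hn ho (d.2.2 i) else s) - v‖ ^ 2 ∂(p.drawLaw I B) ≤
      (1 - α * (I / m)) * ‖s - u‖ ^ 2 + 13 * (I / m : ℝ)⁻¹ * δ
        + 2 * (I / m) * α ^ 2 * σ / B := by
  have := hp.standing.isProb_Q
  have hc := memLp_corrected (B := B) (α := α) (γ := gammaOf m I α) (s := s) h1 h2
  have hcv : MemLp (fun b => corrected α (gammaOf m I α) s hn ho b - v) 2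
      (Measure.pi fun _ : Fin B => p.Q i) := hc.sub (memLp_const v)
  have key := hp.integral_switch_snd hI (integrable_norm_sq hcv) (‖s - v‖ ^ 2)
  have e : (fun d : Draw m B Ξ Z => ‖(if i ∈ d.1 then
      corrected α (gammaOf m I α) s hn ho (d.2.2 i) else s) - v‖ ^ 2) = fun d => if i ∈ d.1 then
      ‖corrected α (gammaOf m I α) s hn ho (d.2.2 i) - v‖ ^ 2 else ‖s - v‖ ^ 2 := by
    ext d; split_ifs <;> rfl
  rw [e]
  refine ⟨key.1, key.2.le.trans ?_⟩
  have hX := integral_corrected_sub_mean_le (α := α) (γ := gammaOf m I α) (s := s) hB h1 h2 e1 e2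
    hσ hδ
  -- The drift of the means inherits the pointwise bound. Nonemptiness of the sample space gives δ ≥
  -- 0.
  have hδ1 : ‖v - u‖ ^ 2 ≤ δ := by
    have hd : MemLp (fun x => hn x - ho x) 2 (p.Q i) := h1.sub h2
    have hm : ∫ x, (hn x - ho x) ∂(p.Q i) = v - u := by
      rw [integral_sub (h1.integrable one_le_two) (h2.integrable one_le_two), e1, e2]
    have hb : ∀ x, ‖hn x - ho x‖ ≤ Real.sqrt δ := fun x => Real.le_sqrt_of_sq_le (hδ x)
    have hn1 := norm_integral_le_of_norm_le_const (μ := p.Q i) (Filter.Eventually.of_forall hb)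
    rw [hm] at hn1
    simp only [probReal_univ, mul_one] at hn1
    obtain ⟨x⟩ : Nonempty Z := (p.Q i).nonempty_of_neZero
    have hδ0 : 0 ≤ δ := (sq_nonneg _).trans (hδ x)
    calc _ ≤ (Real.sqrt δ) ^ 2 := by gcongr
      _ = _ := Real.sq_sqrt hδ0
  have hg1 := gammaOf_sub hI1 hI hα
  obtain ⟨hg2, hg3⟩ := gammaOf_sub_sq_le hI1 hI hα0 hα
  have hm0 : (0 : ℝ) < m := by exact_mod_cast hI1.trans hI
  have hI0 : (0 : ℝ) < I := by exact_mod_cast hI1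
  have hq0 : 0 < (I / m : ℝ) := by positivity
  set q : ℝ := I / m with hq
  set γ := gammaOf m I α
  set a := s - u
  set b := v - u
  have hsv : s - v = a - b := by simp [a, b]
  -- No cross term ⟪a, b⟫ survives, so the factor of ‖a‖² is not enlarged by a Young inequality. The
  -- constant 13 of the drift is 5 from this line plus 2 · 4 from the noise.
  have hexp : q * ‖(1 - α) • a + (γ - (1 - α)) • b‖ ^ 2 + (1 - q) * ‖a - b‖ ^ 2 =
      (q * (1 - α) ^ 2 + (1 - q)) * ‖a‖ ^ 2 + (q * (γ - (1 - α)) ^ 2 + (1 - q)) * ‖b‖ ^ 2 := by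
    rw [norm_add_sq_real, norm_sub_sq_real, norm_smul, norm_smul, mul_pow, mul_pow,
      Real.norm_eq_abs, Real.norm_eq_abs, sq_abs, sq_abs, real_inner_smul_left,
      real_inner_smul_right]
    linear_combination 2 * ⟪a, b⟫ * hg1
  have hb0 : 0 ≤ ‖b‖ ^ 2 := by positivity
  have ha0 : 0 ≤ ‖a‖ ^ 2 := by positivity
  have hc1 : (q * (1 - α) ^ 2 + (1 - q)) * ‖a‖ ^ 2 ≤ (1 - α * q) * ‖a‖ ^ 2 := by
    gcongr
    nlinarith [mul_pos hα0 hq0]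
  have hc2 : (q * (γ - (1 - α)) ^ 2 + (1 - q)) * ‖b‖ ^ 2 ≤ 5 * q⁻¹ * δ := by
    have : 0 ≤ 5 * q⁻¹ := by positivity
    calc _ ≤ 5 * q⁻¹ * ‖b‖ ^ 2 := by gcongr
      _ ≤ _ := by gcongr
  have hc3 : q * γ ^ 2 * δ ≤ 4 * q⁻¹ * δ := by
    have : 0 ≤ δ := hb0.trans hδ1
    gcongr
  have hX' := mul_le_mul_of_nonneg_left hX hq0.le
  simp only [smul_eq_mul]
  rw [hsv]
  have e3 : q * (‖(1 - α) • a + (γ - (1 - α)) • b‖ ^ 2 + 2 * α ^ 2 * σ / B + 2 * γ ^ 2 * δ) =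
    q * ‖(1 - α) • a + (γ - (1 - α)) • b‖ ^ 2 + 2 * q * α ^ 2 * σ / B + 2 * (q * γ ^ 2 * δ) := by
    ring
  rw [e3] at hX'
  linarith

lemma integral_corrected_increment (hI1 : 1 ≤ I) (hB : 1 ≤ B) (hα0 : 0 < α) (hα : α ≤ 1 / 2)
    (h1 : MemLp hn 2 (p.Q i)) (h2 : MemLp ho 2 (p.Q i)) (e1 : ∫ x, hn x ∂(p.Q i) = v)
    (hσ : ∫ x, ‖hn x - v‖ ^ 2 ∂(p.Q i) ≤ σ) (hδ : ∀ x, ‖hn x - ho x‖ ^ 2 ≤ δ)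
    (hδ1 : ‖v - u‖ ^ 2 ≤ δ) :
    Integrable (fun d : Draw m B Ξ Z => ‖(if i ∈ d.1 then
      corrected α (gammaOf m I α) s hn ho (d.2.2 i) else s) - s‖ ^ 2) (p.drawLaw I B) ∧
    ∫ d : Draw m B Ξ Z, ‖(if i ∈ d.1 then
      corrected α (gammaOf m I α) s hn ho (d.2.2 i) else s) - s‖ ^ 2 ∂(p.drawLaw I B) ≤
      4 * (I / m) * α ^ 2 * ‖s - u‖ ^ 2 + 9 * (I / m : ℝ)⁻¹ * δ
        + 2 * (I / m) * α ^ 2 * σ / B := by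
  have := hp.standing.isProb_Q
  have hc := memLp_corrected (B := B) (α := α) (γ := gammaOf m I α) (s := s) h1 h2
  have hcv : MemLp (fun b => corrected α (gammaOf m I α) s hn ho b - s) 2
      (Measure.pi fun _ : Fin B => p.Q i) := hc.sub (memLp_const s)
  have key := hp.integral_switch_snd hI (integrable_norm_sq hcv) (0 : ℝ)
  have e : (fun d : Draw m B Ξ Z => ‖(if i ∈ d.1 then
      corrected α (gammaOf m I α) s hn ho (d.2.2 i) else s) - s‖ ^ 2) = fun d => if i ∈ d.1 then
      ‖corrected α (gammaOf m I α) s hn ho (d.2.2 i) - s‖ ^ 2 else 0 := by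
    ext d; split_ifs
    · rfl
    · simp
  rw [e]
  refine ⟨key.1, key.2.le.trans ?_⟩
  have hX := integral_corrected_sub_self_le (α := α) (γ := gammaOf m I α) (s := s) (u := u) hB h1
    h2 e1 hσ hδ hδ1
  obtain ⟨-, hg3⟩ := gammaOf_sub_sq_le hI1 hI hα0 hα
  have hm0 : (0 : ℝ) < m := by exact_mod_cast hI1.trans hI
  have hI0 : (0 : ℝ) < I := by exact_mod_cast hI1
  have hq0 : 0 < (I / m : ℝ) := by positivity
  have hq1 : (I / m : ℝ) ≤ 1 := by
    rw [div_le_one hm0]; exact_mod_cast hI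
  set q : ℝ := I / m with hq
  set γ := gammaOf m I α
  have hδ0 : 0 ≤ δ := (sq_nonneg _).trans hδ1
  have hinv1 : 1 ≤ q⁻¹ := (one_le_inv₀ hq0).2 hq1
  have hX' := mul_le_mul_of_nonneg_left hX hq0.le
  have hc : q * ((4 * α ^ 2 + 2 * γ ^ 2) * δ) ≤ 9 * q⁻¹ * δ := by
    rw [← mul_assoc]
    refine mul_le_mul_of_nonneg_right ?_ hδ0
    have : α ^ 2 ≤ 1 / 4 := by nlinarith
    have : q * α ^ 2 ≤ 1 * (1 / 4) := by gcongr
    linarith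
  simp only [smul_eq_mul, mul_zero, add_zero]
  have e3 : q * (4 * α ^ 2 * ‖s - u‖ ^ 2 + (4 * α ^ 2 + 2 * γ ^ 2) * δ + 2 * α ^ 2 * σ / B) =
    4 * q * α ^ 2 * ‖s - u‖ ^ 2 + q * ((4 * α ^ 2 + 2 * γ ^ 2) * δ) + 2 * q * α ^ 2 * σ / B := by
    ring
  rw [e3] at hX'
  linarith

end

variable {τ : ℝ} {a : Params} {r : State dx dy × State dx dy}

lemma errS_step (hI1 : 1 ≤ I) (hB : 1 ≤ B) (hα0 : 0 < a.alpha) (hα : a.alpha ≤ 1 / 2) :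
    Integrable (fun d : Draw m B Ξ Z => p.errS (r.2, p.step I lam τ a d r.1 r.2))
      (p.drawLaw I B) ∧
    ∫ d : Draw m B Ξ Z, p.errS (r.2, p.step I lam τ a d r.1 r.2) ∂(p.drawLaw I B) ≤
      (1 - a.alpha * (I / m)) * p.errS r + 13 * M ^ 3 * (I / m : ℝ)⁻¹ * (incX r + incY r)
        + 2 * M ^ 3 * (I / m) * m * a.alpha ^ 2 / B := by
  have h := fun i : Fin m => hp.integral_corrected_step (B := B) (s := r.2.s i) hI hI1 hB hα0 hα
    (hp.var_gy i r.2.x (r.2.y i)).1 (hp.var_gy i r.1.x (r.1.y i)).1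
    (hp.var_gy i r.2.x (r.2.y i)).2.1 (hp.var_gy i r.1.x (r.1.y i)).2.1
    (hp.var_gy i r.2.x (r.2.y i)).2.2
    (fun ζ => (hp.lip_gy i ζ).sq_le r.2.x (r.2.y i) r.1.x (r.1.y i))
  refine ⟨integrable_finsetSum _ fun i _ => (h i).1, ?_⟩
  have h2 := Finset.sum_le_sum fun i (_ : i ∈ Finset.univ) => (h i).2
  rw [← integral_finsetSum _ fun i _ => (h i).1] at h2
  refine h2.trans ?_
  simp only [Finset.sum_add_distrib, ← Finset.mul_sum, Problem.errS, Finset.sum_const,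
    Finset.card_univ, Fintype.card_fin, nsmul_eq_mul, incX, incY]
  have h1 := hp.one_le
  have hM : M ^ 2 ≤ M ^ 3 := by gcongr; norm_num
  set W := (m : ℝ) * ‖r.2.x - r.1.x‖ ^ 2 + ∑ i, ‖r.2.y i - r.1.y i‖ ^ 2
  have hW : 0 ≤ W := by positivity
  have c1 : 13 * (I / m : ℝ)⁻¹ * (M ^ 2 * W) ≤ 13 * M ^ 3 * (I / m : ℝ)⁻¹ * W := by
    calc _ = 13 * M ^ 2 * (I / m : ℝ)⁻¹ * W := by ring
      _ ≤ _ := by gcongr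
  have c2 : (m : ℝ) * (2 * (I / m) * a.alpha ^ 2 * M ^ 2 / B) ≤
      2 * M ^ 3 * (I / m) * m * a.alpha ^ 2 / B := by
    calc _ = 2 * M ^ 2 * (I / m) * m * a.alpha ^ 2 / B := by ring
      _ ≤ _ := by gcongr
  linarith

omit hp hI in
lemma memLp_cols {i : Fin m} {h : Z → Mat (dy i) (dy i)} (hh : MemLp h 2 (p.Q i)) :
    MemLp (fun ζ => cols (dy i) (h ζ)) 2 (p.Q i) :=
  (LinearMap.toContinuousLinearMap (cols (dy i))).comp_memLp' hh

omit hp hI in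
lemma integral_cols {i : Fin m} {h : Z → Mat (dy i) (dy i)} (hh : Integrable h (p.Q i)) :
    ∫ ζ, cols (dy i) (h ζ) ∂(p.Q i) = cols (dy i) (∫ ζ, h ζ ∂(p.Q i)) :=
  (LinearMap.toContinuousLinearMap (cols (dy i))).integral_comp_comm hh

omit hI in
lemma norm_cols_sq_le (i : Fin m) (A : Mat (dy i) (dy i)) : ‖cols (dy i) A‖ ^ 2 ≤ M * ‖A‖ ^ 2 := by
  rw [norm_cols_sq]
  refine (frobSq_le A).trans ?_
  have := hp.dim_le i
  gcongr

/-- The Hessian estimator before the projection. -/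
noncomputable def _root_.BSVRB.Problem.preH (p : Problem m dx dy Ξ Z) (I : ℕ) {B : ℕ} (α : ℝ)
    (r : State dx dy × State dx dy) (i : Fin m) (d : Draw m B Ξ Z) : Mat (dy i) (dy i) :=
  if i ∈ d.1 then (1 - α) • r.2.H i
    + α • batchMean (d.2.2 i) (fun ζ => hessYY (fun x y => p.g i x y ζ) r.2.x (r.2.y i))
    + gammaOf m I α •
      (batchMean (d.2.2 i) (fun ζ => hessYY (fun x y => p.g i x y ζ) r.2.x (r.2.y i))
        - batchMean (d.2.2 i) (fun ζ => hessYY (fun x y => p.g i x y ζ) r.1.x (r.1.y i)))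
  else r.2.H i

omit hp hI in
-- For an unsampled block the old estimate is admissible and hence fixed by the projection. Thus the
-- projection may be written outside the case distinction.
lemma step_H_eq (hr : Admissible lam r) (i : Fin m) (d : Draw m B Ξ Z) :
    (p.step I lam τ a d r.1 r.2).H i = matProj lam (p.preH I a.alphaBar r i d) := by
  simp only [Problem.step, Problem.preH]
  split_ifs
  · rfl
  · rw [matProj_eq_self (hr i).2]

omit hp hI in
lemma cols_preH (α : ℝ) (i : Fin m) (d : Draw m B Ξ Z) :
    cols (dy i) (p.preH I α r i d) = if i ∈ d.1 then
      corrected α (gammaOf m I α) (cols (dy i) (r.2.H i))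
        (fun ζ => cols (dy i) (hessYY (fun x y => p.g i x y ζ) r.2.x (r.2.y i)))
        (fun ζ => cols (dy i) (hessYY (fun x y => p.g i x y ζ) r.1.x (r.1.y i))) (d.2.2 i)
      else cols (dy i) (r.2.H i) := by
  rw [Problem.preH]
  split_ifs
  · simp only [map_add, map_sub, map_smul, corrected, batchMean_map]
  · rfl

lemma aestronglyMeasurable_preH (α : ℝ) (i : Fin m) :
    AEStronglyMeasurable (p.preH (B := B) I α r i) (p.drawLaw I B) := by
  have := hp.standing.isProb_Q
  have m1 := memLp_batchMean (B := B) (hp.var_gyy i r.2.x (r.2.y i)).1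
  have m2 := memLp_batchMean (B := B) (hp.var_gyy i r.1.x (r.1.y i)).1
  exact (hp.integral_switch_snd hI
    (((integrable_const ((1 - α) • r.2.H i)).add ((m1.integrable one_le_two).smul α)).add
      (((m1.integrable one_le_two).sub (m2.integrable one_le_two)).smul (gammaOf m I α)))
    (r.2.H i)).1.1

omit hp hI in
lemma _root_.BSVRB.continuous_frobSq {d : ℕ} : Continuous (frobSq (d := d)) := by
  unfold frobSq; fun_prop

/-- The estimates for the unprojected update apply to the columns, where the norm is Hilbertian;
passing from spectral bounds to these costs the dimension, hence M³ in place of M². The projection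
is then removed: the true Hessian and the old estimate are both fixed by it, so by nonexpansiveness
it increases neither the error nor the increment. -/
lemma errH_step (hI1 : 1 ≤ I) (hB : 1 ≤ B) (hα0 : 0 < a.alphaBar) (hα : a.alphaBar ≤ 1 / 2)
    (hr : Admissible lam r) :
    (Integrable (fun d : Draw m B Ξ Z => p.errH (r.2, p.step I lam τ a d r.1 r.2))
      (p.drawLaw I B) ∧
    ∫ d : Draw m B Ξ Z, p.errH (r.2, p.step I lam τ a d r.1 r.2) ∂(p.drawLaw I B) ≤
      (1 - a.alphaBar * (I / m)) * p.errH r + 13 * M ^ 3 * (I / m : ℝ)⁻¹ * (incX r + incY r)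
        + 2 * M ^ 3 * (I / m) * m * a.alphaBar ^ 2 / B) ∧
    (Integrable (fun d : Draw m B Ξ Z => incH (r.2, p.step I lam τ a d r.1 r.2))
      (p.drawLaw I B) ∧
    ∫ d : Draw m B Ξ Z, incH (r.2, p.step I lam τ a d r.1 r.2) ∂(p.drawLaw I B) ≤
      4 * (I / m) * a.alphaBar ^ 2 * p.errH r + 9 * M ^ 3 * (I / m : ℝ)⁻¹ * (incX r + incY r)
        + 2 * M ^ 3 * (I / m) * m * a.alphaBar ^ 2 / B) := by
  have hM0 := hp.nonneg
  have mem := fun (i : Fin m) (θ : State dx dy) => (hp.var_gyy i θ.x (θ.y i)).1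
  have mean : ∀ (i : Fin m) (θ : State dx dy), ∫ ζ, cols (dy i)
      (hessYY (fun x y => p.g i x y ζ) θ.x (θ.y i)) ∂(p.Q i) =
      cols (dy i) (hessYY (p.gE i) θ.x (θ.y i)) := fun i θ => by
    have := hp.standing.isProb_Q
    rw [integral_cols ((mem i θ).integrable one_le_two), (hp.var_gyy i θ.x (θ.y i)).2.1]
  have hvar : ∀ i, ∫ ζ, ‖cols (dy i) (hessYY (fun x y => p.g i x y ζ) r.2.x (r.2.y i)) -
      cols (dy i) (hessYY (p.gE i) r.2.x (r.2.y i))‖ ^ 2 ∂(p.Q i) ≤ M * M ^ 2 := fun i => by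
    have := hp.standing.isProb_Q
    have hi : MemLp (fun ζ => hessYY (fun x y => p.g i x y ζ) r.2.x (r.2.y i) -
      hessYY (p.gE i) r.2.x (r.2.y i)) 2 (p.Q i) := (mem i r.2).sub (memLp_const _)
    have h1 : ∫ ζ, ‖cols (dy i) (hessYY (fun x y => p.g i x y ζ) r.2.x (r.2.y i)) -
      cols (dy i) (hessYY (p.gE i) r.2.x (r.2.y i))‖ ^ 2 ∂(p.Q i) ≤
      ∫ ζ, M * ‖hessYY (fun x y => p.g i x y ζ) r.2.x (r.2.y i) -
        hessYY (p.gE i) r.2.x (r.2.y i)‖ ^ 2 ∂(p.Q i) := by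
      simp_rw [← map_sub]
      exact integral_mono (integrable_norm_sq (memLp_cols hi))
        ((integrable_norm_sq hi).const_mul M) fun ζ => hp.norm_cols_sq_le i _
    refine h1.trans ?_
    rw [integral_const_mul]
    gcongr
    exact (hp.var_gyy i r.2.x (r.2.y i)).2.2
  have hlip : ∀ (i : Fin m) ζ, ‖cols (dy i) (hessYY (fun x y => p.g i x y ζ) r.2.x (r.2.y i)) -
      cols (dy i) (hessYY (fun x y => p.g i x y ζ) r.1.x (r.1.y i))‖ ^ 2 ≤
      M * (M ^ 2 * (‖r.2.x - r.1.x‖ ^ 2 + ‖r.2.y i - r.1.y i‖ ^ 2)) := fun i ζ => by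
    rw [← map_sub]
    refine (hp.norm_cols_sq_le i _).trans ?_
    gcongr
    exact (hp.lip_gyy i ζ).sq_le _ _ _ _
  have hlip' : ∀ i : Fin m, ‖cols (dy i) (hessYY (p.gE i) r.2.x (r.2.y i)) -
      cols (dy i) (hessYY (p.gE i) r.1.x (r.1.y i))‖ ^ 2 ≤
      M * (M ^ 2 * (‖r.2.x - r.1.x‖ ^ 2 + ‖r.2.y i - r.1.y i‖ ^ 2)) := fun i => by
    rw [← map_sub]
    refine (hp.norm_cols_sq_le i _).trans ?_
    gcongr
    exact (hp.mean_lip_gyy i).sq_le _ _ _ _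
  have hA := fun i : Fin m => hp.integral_corrected_step (B := B)
    (s := cols (dy i) (r.2.H i)) hI hI1 hB hα0 hα (memLp_cols (mem i r.2))
    (memLp_cols (mem i r.1)) (mean i r.2) (mean i r.1) (hvar i) (hlip i)
  have hD := fun i : Fin m => hp.integral_corrected_increment (B := B)
    (s := cols (dy i) (r.2.H i)) hI hI1 hB hα0 hα (memLp_cols (mem i r.2))
    (memLp_cols (mem i r.1)) (mean i r.2) (hvar i) (hlip i) (hlip' i)
  simp_rw [← cols_preH, ← map_sub, norm_cols_sq] at hA hD
  have hmeas := fun i : Fin m => (continuous_matProj (lam := lam)).comp_aestronglyMeasurable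
    (hp.aestronglyMeasurable_preH (B := B) hI (r := r) a.alphaBar i)
  have hA' : ∀ i : Fin m, Integrable (fun d : Draw m B Ξ Z =>
      frobSq ((p.step I lam τ a d r.1 r.2).H i - hessYY (p.gE i) r.2.x (r.2.y i)))
      (p.drawLaw I B) ∧ ∫ d : Draw m B Ξ Z,
      frobSq ((p.step I lam τ a d r.1 r.2).H i - hessYY (p.gE i) r.2.x (r.2.y i))
      ∂(p.drawLaw I B) ≤ ∫ d : Draw m B Ξ Z, frobSq (p.preH I a.alphaBar r i d -
      hessYY (p.gE i) r.2.x (r.2.y i)) ∂(p.drawLaw I B) := fun i => by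
    simp_rw [step_H_eq hr i]
    have hle : ∀ d : Draw m B Ξ Z, frobSq (matProj lam (p.preH I a.alphaBar r i d) -
        hessYY (p.gE i) r.2.x (r.2.y i)) ≤ frobSq (p.preH I a.alphaBar r i d -
        hessYY (p.gE i) r.2.x (r.2.y i)) := fun d => by
      have := frobSq_matProj_sub_le (lam := lam) (p.preH I a.alphaBar r i d)
        (hessYY (p.gE i) r.2.x (r.2.y i))
      rwa [matProj_eq_self (hp.hess_mem i _ _)] at this
    have hint := (hA i).1.mono' (continuous_frobSq.comp_aestronglyMeasurable
      ((hmeas i).sub aestronglyMeasurable_const)) (Filter.Eventually.of_forall fun d => by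
        simp only [Pi.sub_apply]
        rw [Real.norm_of_nonneg (frobSq_nonneg _)]; exact hle d)
    exact ⟨hint, integral_mono hint (hA i).1 hle⟩
  have hD' : ∀ i : Fin m, Integrable (fun d : Draw m B Ξ Z =>
      ‖(p.step I lam τ a d r.1 r.2).H i - r.2.H i‖ ^ 2)
      (p.drawLaw I B) ∧ ∫ d : Draw m B Ξ Z,
      ‖(p.step I lam τ a d r.1 r.2).H i - r.2.H i‖ ^ 2
      ∂(p.drawLaw I B) ≤ ∫ d : Draw m B Ξ Z, frobSq (p.preH I a.alphaBar r i d - r.2.H i)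
      ∂(p.drawLaw I B) := fun i => by
    simp_rw [step_H_eq hr i]
    have hle : ∀ d : Draw m B Ξ Z, ‖matProj lam (p.preH I a.alphaBar r i d) - r.2.H i‖ ^ 2 ≤
        frobSq (p.preH I a.alphaBar r i d - r.2.H i) := fun d => by
      have := frobSq_matProj_sub_le (lam := lam) (p.preH I a.alphaBar r i d) (r.2.H i)
      rw [matProj_eq_self (hr i).2] at this
      exact (norm_sq_le_frobSq _).trans this
    have hint := (hD i).1.mono' (((hmeas i).sub aestronglyMeasurable_const).norm.pow 2)
      (Filter.Eventually.of_forall fun d => by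
        simp only [Pi.pow_apply, Pi.sub_apply]
        rw [Real.norm_of_nonneg (by positivity)]; exact hle d)
    exact ⟨hint, integral_mono hint (hD i).1 hle⟩
  rw [incX_add_incY]
  set W := ∑ i, (‖r.2.x - r.1.x‖ ^ 2 + ‖r.2.y i - r.1.y i‖ ^ 2) with hW
  refine ⟨⟨integrable_finsetSum _ fun i _ => (hA' i).1, ?_⟩,
    ⟨integrable_finsetSum _ fun i _ => (hD' i).1, ?_⟩⟩
  · simp only [Problem.errH]
    rw [integral_finsetSum _ fun i _ => (hA' i).1]
    refine (Finset.sum_le_sum fun i _ => (hA' i).2.trans (hA i).2).trans (le_of_eq ?_)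
    simp only [Finset.sum_add_distrib, ← Finset.mul_sum, Finset.sum_const,
      Finset.card_univ, Fintype.card_fin, nsmul_eq_mul] at hW ⊢
    rw [hW]
    ring
  · simp only [incH]
    rw [integral_finsetSum _ fun i _ => (hD' i).1]
    refine (Finset.sum_le_sum fun i _ => (hD' i).2.trans (hD i).2).trans (le_of_eq ?_)
    simp only [Finset.sum_add_distrib, ← Finset.mul_sum, Finset.sum_const,
      Finset.card_univ, Fintype.card_fin, nsmul_eq_mul, Problem.errH] at hW ⊢
    rw [hW]
    ring

end Problem.Bounds

end BSVRB

namespace BSVRB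

open scoped RealInnerProductSpace

variable {m dx : ℕ} {dy : Fin m → ℕ} {Ξ : Type u} {Z : Type v}
  [MeasurableSpace Ξ] [MeasurableSpace Z]

/-- The mini-batch estimator of `blockGrad`. -/
noncomputable def Problem.blockEst (p : Problem m dx dy Ξ Z) {B : ℕ} (i : Fin m) (x : Vec dx)
    (y : Vec (dy i)) (H : Mat (dy i) (dy i)) (b : (Fin B → Ξ) × (Fin B → Z)) : Vec dx :=
  batchMean b.1 (fun ξ => gradX (fun x y => p.f i x y ξ) x y) -
    batchMean b.2 (fun ζ => jacXY (fun x y => p.g i x y ζ) x y)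
      (H.inverse (batchMean b.1 (fun ξ => gradY (fun x y => p.f i x y ξ) x y)))

lemma Problem.gradEst_eq (p : Problem m dx dy Ξ Z) (I : ℕ) {B : ℕ} (d : Draw m B Ξ Z)
    (θ : State dx dy) : p.gradEst I d θ = (1 / (I : ℝ)) •
      ∑ i ∈ d.1, p.blockEst i θ.x (θ.y i) (θ.H i) (d.2.1 i, d.2.2 i) := rfl

lemma sum_sel_smul {V : Type*} [AddCommGroup V] [Module ℝ V] (J : Finset (Fin m)) (v : Fin m → V) :
    ∑ i, sel i J • v i = ∑ i ∈ J, v i := by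
  simp only [sel, ite_smul, one_smul, zero_smul, Finset.sum_ite_mem, Finset.univ_inter]

namespace Problem.Bounds

variable {p : Problem m dx dy Ξ Z} {lam M : ℝ} (hp : p.Bounds lam M) {I B : ℕ}
include hp

/-! ### The estimator of one block -/

lemma norm_batch_jac_le (hB : 1 ≤ B) (i : Fin m) (x : Vec dx) (y : Vec (dy i)) (b : Fin B → Z) :
    ‖batchMean b (fun ζ => jacXY (fun x y => p.g i x y ζ) x y)‖ ≤ M :=
  norm_batchMean_le hB b fun ζ => norm_jacXY_le hp.nonneg (hp.lip_gy i ζ) x y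

section block

variable (i : Fin m) (x : Vec dx) (y : Vec (dy i))

lemma memLp_batch_fx :
    MemLp (fun b : (Fin B → Ξ) × (Fin B → Z) =>
      batchMean b.1 (fun ξ => gradX (fun x y => p.f i x y ξ) x y)) 2 (p.batchLaw B i) := by
  have := hp.standing.isProb_P
  have := hp.standing.isProb_Q
  exact (memLp_batchMean (B := B) (hp.var_fx i x y).1).comp_measurePreserving
    (μ := p.batchLaw B i) measurePreserving_fst

lemma memLp_batch_fy :
    MemLp (fun b : (Fin B → Ξ) × (Fin B → Z) =>
      batchMean b.1 (fun ξ => gradY (fun x y => p.f i x y ξ) x y)) 2 (p.batchLaw B i) := by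
  have := hp.standing.isProb_P
  have := hp.standing.isProb_Q
  exact (memLp_batchMean (B := B) (hp.var_fy i x y).1).comp_measurePreserving
    (μ := p.batchLaw B i) measurePreserving_fst

lemma memLp_batch_jac :
    MemLp (fun b : (Fin B → Ξ) × (Fin B → Z) =>
      batchMean b.2 (fun ζ => jacXY (fun x y => p.g i x y ζ) x y)) 2 (p.batchLaw B i) := by
  have := hp.standing.isProb_P
  have := hp.standing.isProb_Q
  exact (memLp_batchMean (B := B) (hp.var_gxy i x y).1).comp_measurePreserving
    (μ := p.batchLaw B i) measurePreserving_snd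

variable {H : Mat (dy i) (dy i)} (hH : H ∈ matGe (dy i) lam)
include hH

lemma memLp_batch_prod (hB : 1 ≤ B) :
    MemLp (fun b : (Fin B → Ξ) × (Fin B → Z) =>
      batchMean b.2 (fun ζ => jacXY (fun x y => p.g i x y ζ) x y)
      (H.inverse (batchMean b.1 (fun ξ => gradY (fun x y => p.f i x y ξ) x y)))) 2
      (p.batchLaw B i) := by
  have h1 := hp.memLp_batch_fy (B := B) i x y
  have h2 := hp.memLp_batch_jac (B := B) i x y
  have hM := hp.nonneg
  refine h1.of_le_mul (c := M * M)
    ((isBoundedBilinearMap_apply (𝕜 := ℝ) (E := Vec (dy i)) (F := Vec dx)).continuous.comp_aestronglyMeasurable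
      (h2.1.prodMk (H.inverse.continuous.comp_aestronglyMeasurable h1.1)))
    (Filter.Eventually.of_forall fun b => ?_)
  refine (ContinuousLinearMap.le_opNorm _ _).trans ?_
  have h3 := hp.norm_batch_jac_le hB i x y b.2
  have h4 := hp.norm_inverse_le hH (batchMean b.1 (fun ξ => gradY (fun x y => p.f i x y ξ) x y))
  rw [mul_assoc]
  gcongr

lemma memLp_blockEst (hB : 1 ≤ B) :
    MemLp (p.blockEst (B := B) i x y H) 2 (p.batchLaw B i) :=
  (hp.memLp_batch_fx i x y).sub (hp.memLp_batch_prod i x y hH hB)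

/-- The Jacobian batch is independent of the batch for f and `H` is fixed, so the expectation of the
product is the product of expectations; Fubini integrates the Jacobian first. -/
lemma integral_blockEst (hB : 1 ≤ B) :
    ∫ b, p.blockEst (B := B) i x y H b ∂(p.batchLaw B i) = p.blockGrad i x y H := by
  have := hp.standing.isProb_P
  have := hp.standing.isProb_Q
  have i1 := (hp.var_fx i x y).1.integrable one_le_two
  have i2 := (hp.var_fy i x y).1.integrable one_le_two
  have i3 := (hp.var_gxy i x y).1.integrable one_le_two
  have := hp.isProbabilityMeasure_batchLaw (B := B) i
  have m2 := (memLp_batchMean (B := B) (hp.var_fy i x y).1).integrable one_le_two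
  have m3 := (memLp_batchMean (B := B) (hp.var_gxy i x y).1).integrable one_le_two
  simp only [Problem.blockEst, Problem.blockGrad]
  rw [integral_sub ((hp.memLp_batch_fx i x y).integrable one_le_two)
    ((hp.memLp_batch_prod i x y hH hB).integrable one_le_two)]
  congr 1
  · have h := MeasurePreserving.integral_comp_ae (ν := p.batchLaw B i)
      (φ := (Prod.fst : (Fin B → Ξ) × (Fin B → Z) → _)) measurePreserving_fst
      (memLp_batchMean (B := B) (hp.var_fx i x y).1).1
    rw [h, integral_batchMean hB i1, (hp.var_fx i x y).2.1]
  · have h := (hp.memLp_batch_prod (B := B) i x y hH hB).integrable one_le_two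
    rw [Problem.batchLaw] at h ⊢
    rw [integral_prod _ h]
    simp only
    have e1 : ∀ w : Vec (dy i), ∫ b : Fin B → Z,
        batchMean b (fun ζ => jacXY (fun x y => p.g i x y ζ) x y) w
          ∂(Measure.pi fun _ => p.Q i) = jacXY (p.gE i) x y w := fun w => by
      rw [← ContinuousLinearMap.integral_apply m3, integral_batchMean hB i3, (hp.var_gxy i x y).2.1]
    simp_rw [e1]
    have e2 := (jacXY (p.gE i) x y ∘L H.inverse).integral_comp_comm m2
    simp only [ContinuousLinearMap.comp_apply] at e2
    rw [e2, integral_batchMean hB i2, (hp.var_fy i x y).2.1]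

/-- In the product, the error of ∇_y f is multiplied by the sampled Jacobian, which is bounded, and
the error of the Jacobian by the deterministic vector `w`. No product of two unbounded sample
quantities occurs. -/
lemma integral_blockEst_sub_le (hB : 1 ≤ B) :
    ∫ b, ‖p.blockEst (B := B) i x y H b - p.blockGrad i x y H‖ ^ 2 ∂(p.batchLaw B i) ≤
      9 * M ^ 6 / B := by
  have := hp.standing.isProb_P
  have := hp.standing.isProb_Q
  have := hp.isProbabilityMeasure_batchLaw (B := B) i
  have h0 := hp.nonneg
  have h1 := hp.one_le
  set w := H.inverse (gradY (p.fE i) x y) with hw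
  have hwn : ‖w‖ ≤ M * M := (hp.norm_inverse_le hH _).trans (by gcongr; exact hp.bdd_fy i x y)
  have A1 := integral_norm_batch_sub_le hB (hp.var_fx i x y).1 (hp.var_fx i x y).2.1
    (hp.var_fx i x y).2.2
  have A2 := integral_norm_batch_sub_le hB (hp.var_fy i x y).1 (hp.var_fy i x y).2.1
    (hp.var_fy i x y).2.2
  have mj : MemLp (fun ζ => jacXY (fun x y => p.g i x y ζ) x y w) 2 (p.Q i) :=
    (ContinuousLinearMap.apply ℝ (Vec dx) w).comp_memLp' (hp.var_gxy i x y).1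
  have vj : ∫ ζ, ‖jacXY (fun x y => p.g i x y ζ) x y w - jacXY (p.gE i) x y w‖ ^ 2 ∂(p.Q i) ≤
      M ^ 6 := by
    have hm : MemLp (fun ζ => jacXY (fun x y => p.g i x y ζ) x y - jacXY (p.gE i) x y) 2 (p.Q i) :=
      (hp.var_gxy i x y).1.sub (memLp_const _)
    have hm2 : MemLp (fun ζ => jacXY (fun x y => p.g i x y ζ) x y w - jacXY (p.gE i) x y w) 2
      (p.Q i) := mj.sub (memLp_const _)
    have := integral_mono (integrable_norm_sq hm2) ((integrable_norm_sq hm).mul_const (‖w‖ ^ 2))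
      fun ζ => by
        have := (jacXY (fun x y => p.g i x y ζ) x y - jacXY (p.gE i) x y).le_opNorm w
        calc _ ≤ (‖jacXY (fun x y => p.g i x y ζ) x y - jacXY (p.gE i) x y‖ * ‖w‖) ^ 2 := by
              gcongr; exact this
          _ = _ := by ring
    refine this.trans ?_
    rw [integral_mul_const]
    calc _ ≤ M ^ 2 * (M * M) ^ 2 := by
          gcongr
          exact (hp.var_gxy i x y).2.2
      _ = _ := by ring
  have A3 := integral_norm_batch_sub_le hB mj
    (by rw [← ContinuousLinearMap.integral_apply ((hp.var_gxy i x y).1.integrable one_le_two),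
      (hp.var_gxy i x y).2.1]) vj
  have c1 : MemLp (fun b : Fin B → Ξ => batchMean b (fun ξ => gradX (fun x y => p.f i x y ξ) x y) -
      gradX (p.fE i) x y) 2 (Measure.pi fun _ => p.P i) :=
    (memLp_batchMean (B := B) (hp.var_fx i x y).1).sub (memLp_const _)
  have c2 : MemLp (fun b : Fin B → Ξ => batchMean b (fun ξ => gradY (fun x y => p.f i x y ξ) x y) -
      gradY (p.fE i) x y) 2 (Measure.pi fun _ => p.P i) :=
    (memLp_batchMean (B := B) (hp.var_fy i x y).1).sub (memLp_const _)
  have c3 : MemLp (fun b : Fin B → Z => batchMean b (fun ζ => jacXY (fun x y => p.g i x y ζ) x y w)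
      - jacXY (p.gE i) x y w) 2 (Measure.pi fun _ => p.Q i) :=
    (memLp_batchMean (B := B) mj).sub (memLp_const _)
  have hfst : MeasurePreserving (Prod.fst : (Fin B → Ξ) × (Fin B → Z) → _) (p.batchLaw B i)
      (Measure.pi fun _ => p.P i) := measurePreserving_fst
  have hsnd : MeasurePreserving (Prod.snd : (Fin B → Ξ) × (Fin B → Z) → _) (p.batchLaw B i)
      (Measure.pi fun _ => p.Q i) := measurePreserving_snd
  have i1 := integrable_norm_sq c1
  have i2 := integrable_norm_sq c2
  have i3 := integrable_norm_sq c3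
  rw [← MeasurePreserving.integral_comp_ae hfst i1.1] at A1
  rw [← MeasurePreserving.integral_comp_ae hfst i2.1] at A2
  rw [← MeasurePreserving.integral_comp_ae hsnd i3.1] at A3
  have j1 := hfst.integrable_comp_of_integrable i1
  have j2 := hfst.integrable_comp_of_integrable i2
  have j3 := hsnd.integrable_comp_of_integrable i3
  simp only [Function.comp_def] at j1 j2 j3
  have hbE : MemLp (fun b => p.blockEst (B := B) i x y H b - p.blockGrad i x y H) 2
      (p.batchLaw B i) := (hp.memLp_blockEst i x y hH hB).sub (memLp_const _)
  have hle := integral_mono (integrable_norm_sq hbE)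
    (((j1.add (j2.const_mul (M ^ 4))).add j3).const_mul 3) fun b => by
      have e : p.blockEst (B := B) i x y H b - p.blockGrad i x y H =
        (batchMean b.1 (fun ξ => gradX (fun x y => p.f i x y ξ) x y) - gradX (p.fE i) x y) +
        (-(batchMean b.2 (fun ζ => jacXY (fun x y => p.g i x y ζ) x y) (H.inverse
          (batchMean b.1 (fun ξ => gradY (fun x y => p.f i x y ξ) x y) - gradY (p.fE i) x y)))) +
        (-(batchMean b.2 (fun ζ => jacXY (fun x y => p.g i x y ζ) x y w)
          - jacXY (p.gE i) x y w)) := by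
        have e1 : batchMean b.2 (fun ζ => jacXY (fun x y => p.g i x y ζ) x y w) =
            batchMean b.2 (fun ζ => jacXY (fun x y => p.g i x y ζ) x y) w := by
          simp [batchMean]
        rw [e1]
        simp only [Problem.blockEst, Problem.blockGrad, map_sub, hw]
        abel
      have e2 := norm_add_three_sq_le
        (batchMean b.1 (fun ξ => gradX (fun x y => p.f i x y ξ) x y) - gradX (p.fE i) x y)
        (-(batchMean b.2 (fun ζ => jacXY (fun x y => p.g i x y ζ) x y) (H.inverse
          (batchMean b.1 (fun ξ => gradY (fun x y => p.f i x y ξ) x y) - gradY (p.fE i) x y))))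
        (-(batchMean b.2 (fun ζ => jacXY (fun x y => p.g i x y ζ) x y w)
          - jacXY (p.gE i) x y w))
      rw [← e, norm_neg, norm_neg] at e2
      have e3 : ‖batchMean b.2 (fun ζ => jacXY (fun x y => p.g i x y ζ) x y) (H.inverse
          (batchMean b.1 (fun ξ => gradY (fun x y => p.f i x y ξ) x y) - gradY (p.fE i) x y))‖ ^ 2
          ≤ M ^ 4 * ‖batchMean b.1 (fun ξ => gradY (fun x y => p.f i x y ξ) x y)
            - gradY (p.fE i) x y‖ ^ 2 := by
        have h3 := hp.norm_batch_jac_le hB i x y b.2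
        have h4 := hp.norm_inverse_le hH (batchMean b.1
          (fun ξ => gradY (fun x y => p.f i x y ξ) x y) - gradY (p.fE i) x y)
        calc _ ≤ (M * (M * ‖batchMean b.1 (fun ξ => gradY (fun x y => p.f i x y ξ) x y)
            - gradY (p.fE i) x y‖)) ^ 2 := by
              gcongr
              refine (ContinuousLinearMap.le_opNorm _ _).trans ?_
              gcongr
          _ = _ := by ring
      simp only [Pi.add_apply]
      linarith
  refine hle.trans ?_
  have e4 : ∀ f g h : (Fin B → Ξ) × (Fin B → Z) → ℝ, Integrable f (p.batchLaw B i) →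
      Integrable g (p.batchLaw B i) → Integrable h (p.batchLaw B i) →
      ∫ b, 3 * (f + (fun b => M ^ 4 * g b) + h) b ∂(p.batchLaw B i) =
        3 * (∫ b, f b ∂(p.batchLaw B i) + M ^ 4 * ∫ b, g b ∂(p.batchLaw B i)
          + ∫ b, h b ∂(p.batchLaw B i)) := fun f g h hf hg hh => by
    rw [integral_const_mul, integral_add' (hf.add (hg.const_mul _)) hh,
      integral_add' hf (hg.const_mul _), integral_const_mul]
  rw [e4 _ _ _ j1 j2 j3]
  have hB0 : (0 : ℝ) < B := by positivity
  have f1 : M ^ 2 / B ≤ M ^ 6 / B := by gcongr; norm_num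
  have f2 := mul_le_mul_of_nonneg_left A2 (by positivity : 0 ≤ M ^ 4)
  have f3 : M ^ 4 * (M ^ 2 / B) = M ^ 6 / B := by ring
  rw [f3] at f2
  have f4 : 9 * M ^ 6 / B = 3 * (M ^ 6 / B + M ^ 6 / B + M ^ 6 / B) := by ring
  rw [f4]
  linarith

omit hH in
lemma integral_batch_fy_sq_le (hB : 1 ≤ B) :
    ∫ b : (Fin B → Ξ) × (Fin B → Z),
      ‖batchMean b.1 (fun ξ => gradY (fun x y => p.f i x y ξ) x y)‖ ^ 2 ∂(p.batchLaw B i) ≤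
      2 * M ^ 2 := by
  have := hp.standing.isProb_P
  have := hp.standing.isProb_Q
  have h1 := hp.one_le
  have c : MemLp (fun b : Fin B → Ξ => batchMean b (fun ξ => gradY (fun x y => p.f i x y ξ) x y))
    2 (Measure.pi fun _ => p.P i) := memLp_batchMean (B := B) (hp.var_fy i x y).1
  have c2 : MemLp (fun b : Fin B → Ξ => batchMean b (fun ξ => gradY (fun x y => p.f i x y ξ) x y) -
      gradY (p.fE i) x y) 2 (Measure.pi fun _ => p.P i) := c.sub (memLp_const _)
  have hfst : MeasurePreserving (Prod.fst : (Fin B → Ξ) × (Fin B → Z) → _) (p.batchLaw B i)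
      (Measure.pi fun _ => p.P i) := measurePreserving_fst
  rw [MeasurePreserving.integral_comp_ae hfst (integrable_norm_sq c).1]
  have A2 := integral_norm_batch_sub_le hB (hp.var_fy i x y).1 (hp.var_fy i x y).2.1
    (hp.var_fy i x y).2.2
  have hz : ∫ b : Fin B → Ξ, (batchMean b (fun ξ => gradY (fun x y => p.f i x y ξ) x y) -
      gradY (p.fE i) x y) ∂(Measure.pi fun _ => p.P i) = 0 := by
    rw [integral_sub (c.integrable one_le_two) (integrable_const _),
      integral_batchMean hB ((hp.var_fy i x y).1.integrable one_le_two), (hp.var_fy i x y).2.1]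
    simp
  have A3 := integral_norm_const_add_sq (gradY (p.fE i) x y) c2 hz
  simp only [add_sub_cancel] at A3
  rw [A3]
  have hb : ‖gradY (p.fE i) x y‖ ^ 2 ≤ M ^ 2 := by
    have := hp.bdd_fy i x y
    gcongr
  have hBi : M ^ 2 / B ≤ M ^ 2 := div_le_self (by positivity) (by exact_mod_cast hB)
  linarith

variable (x' : Vec dx) (y' : Vec (dy i)) {H' : Mat (dy i) (dy i)} (hH' : H' ∈ matGe (dy i) lam)
include hH'

/-- The sampled ∇_y f is only square integrable, so the Lipschitz constant is random; it involves
the squared norm of the batch, whose mean is at most 2M². -/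
lemma norm_blockEst_sub_sq_le (hB : 1 ≤ B) (b : (Fin B → Ξ) × (Fin B → Z)) :
    ‖p.blockEst i x y H b - p.blockEst i x' y' H' b‖ ^ 2 ≤ 16 * M ^ 6 *
      (1 + ‖batchMean b.1 (fun ξ => gradY (fun x y => p.f i x y ξ) x y)‖ ^ 2) *
      (‖x - x'‖ ^ 2 + ‖y - y'‖ ^ 2 + ‖H - H'‖ ^ 2) := by
  have h0 := hp.nonneg
  have h1 := hp.one_le
  set δ := Real.sqrt (‖x - x'‖ ^ 2 + ‖y - y'‖ ^ 2) with hδ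
  have hδ2 : δ ^ 2 = ‖x - x'‖ ^ 2 + ‖y - y'‖ ^ 2 := Real.sq_sqrt (by positivity)
  have hδ0 : 0 ≤ δ := Real.sqrt_nonneg _
  set fx := batchMean b.1 (fun ξ => gradX (fun x y => p.f i x y ξ) x y) with hfx
  set fx' := batchMean b.1 (fun ξ => gradX (fun x y => p.f i x y ξ) x' y') with hfx'
  set fy := batchMean b.1 (fun ξ => gradY (fun x y => p.f i x y ξ) x y) with hfy
  set fy' := batchMean b.1 (fun ξ => gradY (fun x y => p.f i x y ξ) x' y') with hfy'
  set j := batchMean b.2 (fun ζ => jacXY (fun x y => p.g i x y ζ) x y) with hj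
  set j' := batchMean b.2 (fun ζ => jacXY (fun x y => p.g i x y ζ) x' y') with hj'
  have e : p.blockEst i x y H b - p.blockEst i x' y' H' b =
      (fx - fx') - (j - j') (H.inverse fy)
        - j' (H.inverse fy - H'.inverse fy) - j' (H'.inverse (fy - fy')) := by
    simp only [Problem.blockEst, map_sub, _root_.sub_apply, ← hfx, ← hfx', ← hfy, ← hfy', ← hj,
      ← hj']
    abel
  have hj'n : ‖j'‖ ≤ M := hp.norm_batch_jac_le hB i x' y' b.2
  have b1 : ‖fx - fx'‖ ≤ M * δ := by
    rw [hfx, hfx', ← batchMean_sub]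
    exact norm_batchMean_le hB _ fun ξ => hp.lip_fx i ξ x y x' y'
  have b1' : ‖fy - fy'‖ ≤ M * δ := by
    rw [hfy, hfy', ← batchMean_sub]
    exact norm_batchMean_le hB _ fun ξ => hp.lip_fy i ξ x y x' y'
  have b1'' : ‖j - j'‖ ≤ M * δ := by
    rw [hj, hj', ← batchMean_sub]
    exact norm_batchMean_le hB _ fun ξ => hp.lip_gxy i ξ x y x' y'
  have b2 : ‖(j - j') (H.inverse fy)‖ ≤ (M * δ) * (M * ‖fy‖) := by
    refine (ContinuousLinearMap.le_opNorm _ _).trans ?_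
    have h3 := hp.norm_inverse_le hH fy
    gcongr
  have b3 : ‖j' (H.inverse fy - H'.inverse fy)‖ ≤ M * (M ^ 2 * ‖H - H'‖ * ‖fy‖) := by
    refine (ContinuousLinearMap.le_opNorm _ _).trans ?_
    have h3 := hp.norm_inverse_sub_le hH hH' fy
    gcongr
  have b4 : ‖j' (H'.inverse (fy - fy'))‖ ≤ M * (M * (M * δ)) := by
    refine (ContinuousLinearMap.le_opNorm _ _).trans ?_
    have h3 := hp.norm_inverse_le hH' (fy - fy')
    gcongr
    exact h3.trans (by gcongr)
  set φ := ‖fy‖ with hφ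
  have hφ0 : 0 ≤ φ := norm_nonneg _
  set e' := ‖H - H'‖
  have he0 : 0 ≤ e' := norm_nonneg _
  have b5 : ‖p.blockEst i x y H b - p.blockEst i x' y' H' b‖ ≤
      2 * M ^ 3 * ((1 + φ) * (δ + e')) := by
    rw [e]
    refine (norm_sub_le _ _).trans ?_
    have := norm_sub_le ((fx - fx') - (j - j') (H.inverse fy))
      (j' (H.inverse fy - H'.inverse fy))
    have := norm_sub_le (fx - fx') ((j - j') (H.inverse fy))
    have c1 : M * δ ≤ M ^ 3 * δ := by gcongr; exact le_self_pow₀ h1 (by norm_num)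
    have c2 : M ^ 2 * (δ * φ) ≤ M ^ 3 * (δ * φ) := by gcongr; norm_num
    have c3 : 0 ≤ M ^ 3 * (δ * φ) := by positivity
    have c4 : 0 ≤ M ^ 3 * (e' * φ) := by positivity
    have c5 : 0 ≤ M ^ 3 * e' := by positivity
    nlinarith
  calc _ ≤ (2 * M ^ 3 * ((1 + φ) * (δ + e'))) ^ 2 := by gcongr
    _ = 4 * M ^ 6 * ((1 + φ) ^ 2 * (δ + e') ^ 2) := by ring
    _ ≤ 4 * M ^ 6 * ((2 * (1 ^ 2 + φ ^ 2)) * (2 * (δ ^ 2 + e' ^ 2))) := by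
        gcongr <;> exact add_sq_le
    _ = _ := by rw [hδ2]; ring

lemma integral_blockEst_diff_le (hB : 1 ≤ B) :
    ∫ b, ‖p.blockEst (B := B) i x y H b - p.blockEst i x' y' H' b‖ ^ 2 ∂(p.batchLaw B i) ≤
      48 * M ^ 8 * (‖x - x'‖ ^ 2 + ‖y - y'‖ ^ 2 + ‖H - H'‖ ^ 2) := by
  have := hp.isProbabilityMeasure_batchLaw (B := B) i
  have hd : MemLp (fun b => p.blockEst (B := B) i x y H b - p.blockEst i x' y' H' b) 2
    (p.batchLaw B i) := (hp.memLp_blockEst i x y hH hB).sub (hp.memLp_blockEst i x' y' hH' hB)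
  have h0 := hp.nonneg
  have h1 := hp.one_le
  have hfy := integrable_norm_sq (hp.memLp_batch_fy (B := B) i x y)
  refine (integral_mono (integrable_norm_sq hd)
    ((((integrable_const 1).add hfy).const_mul (16 * M ^ 6)).mul_const
      (‖x - x'‖ ^ 2 + ‖y - y'‖ ^ 2 + ‖H - H'‖ ^ 2))
    fun b => hp.norm_blockEst_sub_sq_le i x y hH x' y' hH' hB b).trans ?_
  rw [integral_mul_const, integral_const_mul, integral_add' (integrable_const 1) hfy]
  simp only [integral_const, probReal_univ, one_smul]
  have h2 := hp.integral_batch_fy_sq_le (B := B) i x y hB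
  refine mul_le_mul_of_nonneg_right ?_ (by positivity)
  have hM2 : 1 ≤ M ^ 2 := one_le_pow₀ h1
  calc 16 * M ^ 6 * (1 + _) ≤ 16 * M ^ 6 * (3 * M ^ 2) := by gcongr; linarith
    _ = _ := by ring

end block

end Problem.Bounds

end BSVRB

-- The sampled gradient estimator and the recursion for `z`

namespace BSVRB

open scoped RealInnerProductSpace

variable {m dx : ℕ} {dy : Fin m → ℕ} {Ξ : Type u} {Z : Type v}
  [MeasurableSpace Ξ] [MeasurableSpace Z]

lemma noise_nonneg (m I B : ℕ) : 0 ≤ noise m I B := by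
  unfold noise
  positivity

namespace Problem.Bounds

variable {p : Problem m dx dy Ξ Z} {lam M : ℝ} (hp : p.Bounds lam M) {I B : ℕ} (hI : I ≤ m)
include hp hI

lemma memLp_sum_blocks {W : Type*} [NormedAddCommGroup W] [NormedSpace ℝ W]
    {ψ : Fin m → (Fin B → Ξ) × (Fin B → Z) → W} (hψ : ∀ i, MemLp (ψ i) 2 (p.batchLaw B i)) :
    MemLp (fun d : Draw m B Ξ Z => (1 / (I : ℝ)) • ∑ i ∈ d.1, ψ i (d.2.1 i, d.2.2 i)) 2
      (p.drawLaw I B) := by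
  have h : MemLp (fun d : Draw m B Ξ Z => ∑ i, sel i d.1 • ψ i (d.2.1 i, d.2.2 i)) 2
    (p.drawLaw I B) := memLp_finsetSum _ fun i _ => hp.memLp_sel_smul hI (hψ i)
  have e : (fun d : Draw m B Ξ Z => ∑ i, sel i d.1 • ψ i (d.2.1 i, d.2.2 i)) =
      fun d => ∑ i ∈ d.1, ψ i (d.2.1 i, d.2.2 i) :=
    funext fun d => sum_sel_smul d.1 fun i => ψ i (d.2.1 i, d.2.2 i)
  rw [e] at h
  exact h.const_smul (1 / (I : ℝ))

lemma integral_norm_sum_blocks_sq_le {W : Type*} [NormedAddCommGroup W] [NormedSpace ℝ W]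
    (hI1 : 1 ≤ I) {ψ : Fin m → (Fin B → Ξ) × (Fin B → Z) → W}
    (hψ : ∀ i, MemLp (ψ i) 2 (p.batchLaw B i)) :
    ∫ d : Draw m B Ξ Z, ‖(1 / (I : ℝ)) • ∑ i ∈ d.1, ψ i (d.2.1 i, d.2.2 i)‖ ^ 2
      ∂(p.drawLaw I B) ≤ 1 / m * ∑ i, ∫ b, ‖ψ i b‖ ^ 2 ∂(p.batchLaw B i) := by
  have hi : ∀ i, Integrable (fun d : Draw m B Ξ Z => sel i d.1 • ‖ψ i (d.2.1 i, d.2.2 i)‖ ^ 2)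
    (p.drawLaw I B) := fun i => hp.integrable_sel_smul hI (integrable_norm_sq (hψ i))
  have h := integral_mono_ae (integrable_norm_sq (hp.memLp_sum_blocks hI hψ))
    ((integrable_finsetSum Finset.univ fun i _ => hi i).const_mul (1 / (I : ℝ)))
    (by
      filter_upwards [hp.drawLaw_ae_card hI] with d hd
      refine (norm_mean_sq_le d.1 hd _).trans_eq ?_
      rw [sum_sel_smul d.1 (fun i => ‖ψ i (d.2.1 i, d.2.2 i)‖ ^ 2)])
  refine h.trans_eq ?_
  rw [integral_const_mul, integral_finsetSum _ fun i _ => hi i]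
  have hs : ∀ i, ∫ d : Draw m B Ξ Z, sel i d.1 • ‖ψ i (d.2.1 i, d.2.2 i)‖ ^ 2 ∂(p.drawLaw I B) =
      I / m * ∫ b, ‖ψ i b‖ ^ 2 ∂(p.batchLaw B i) := fun i =>
    hp.integral_sel_smul hI (integrable_norm_sq (hψ i))
  rw [Finset.sum_congr rfl fun i _ => hs i, ← Finset.mul_sum]
  have : (0 : ℝ) < I := by exact_mod_cast hI1
  field_simp

variable {θ : State dx dy} (hθ : ∀ i, θ.H i ∈ matGe (dy i) lam) (hB : 1 ≤ B)
include hθ hB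

lemma memLp_gradEst :
    MemLp (fun d : Draw m B Ξ Z => p.gradEst I d θ) 2 (p.drawLaw I B) := by
  simp_rw [Problem.gradEst_eq]
  exact hp.memLp_sum_blocks hI (ψ := fun i => p.blockEst i θ.x (θ.y i) (θ.H i))
    fun i => hp.memLp_blockEst i θ.x (θ.y i) (hθ i) hB

variable (hI1 : 1 ≤ I)
include hI1

lemma integral_gradEst :
    ∫ d : Draw m B Ξ Z, p.gradEst I d θ ∂(p.drawLaw I B) = p.gradMean θ := by
  have hi : ∀ i, Integrable (p.blockEst (B := B) i θ.x (θ.y i) (θ.H i)) (p.batchLaw B i) := fun i =>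
    have := hp.isProbabilityMeasure_batchLaw (B := B) i
    (hp.memLp_blockEst i θ.x (θ.y i) (hθ i) hB).integrable one_le_two
  have e : (fun d : Draw m B Ξ Z => p.gradEst I d θ) = fun d => (1 / (I : ℝ)) •
      ∑ i, sel i d.1 • p.blockEst i θ.x (θ.y i) (θ.H i) (d.2.1 i, d.2.2 i) :=
    funext fun d => by
      rw [Problem.gradEst_eq, sum_sel_smul d.1 fun i =>
        p.blockEst i θ.x (θ.y i) (θ.H i) (d.2.1 i, d.2.2 i)]
  rw [e, integral_smul, integral_finsetSum _ fun i _ => hp.integrable_sel_smul hI (hi i),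
    Finset.sum_congr rfl fun i _ => hp.integral_sel_smul hI (hi i), ← Finset.smul_sum, smul_smul,
    Problem.gradMean_eq]
  have : (0 : ℝ) < I := by exact_mod_cast hI1
  congr 1
  · field_simp
  · exact Finset.sum_congr rfl fun i _ => hp.integral_blockEst i θ.x (θ.y i) (hθ i) hB

omit hB in
-- The part of the variance that comes from sampling blocks. For I < m it is the variance of
-- sampling without replacement; for I = m every block is drawn and it vanishes.
lemma integral_blockMean_sub_le :
    ∫ d : Draw m B Ξ Z, ‖(1 / (I : ℝ)) • ∑ i ∈ d.1, p.blockGrad i θ.x (θ.y i) (θ.H i)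
      - p.gradMean θ‖ ^ 2 ∂(p.drawLaw I B) ≤ 16 * M ^ 6 * ((if I < m then 1 else 0) / (I : ℝ)) := by
  have h0 := hp.nonneg
  have hI0 : (0 : ℝ) < I := by exact_mod_cast hI1
  have hm0 : (0 : ℝ) < m := by exact_mod_cast hI1.trans hI
  set a : (i : Fin m) → Vec dx := fun i => p.blockGrad i θ.x (θ.y i) (θ.H i) with ha
  have hmean : p.gradMean θ = (1 / (m : ℝ)) • ∑ i, a i := Problem.gradMean_eq _
  split_ifs with h
  · have hn : ∀ i, ‖a i‖ ≤ 2 * M ^ 3 := fun i => hp.norm_blockGrad_le i _ _ (hθ i)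
    have hg : ‖p.gradMean θ‖ ≤ 2 * M ^ 3 := by
      rw [hmean, norm_smul, Real.norm_of_nonneg (by positivity)]
      calc _ ≤ 1 / (m : ℝ) * ∑ i : Fin m, 2 * M ^ 3 := by
            gcongr
            exact (norm_sum_le _ _).trans (Finset.sum_le_sum fun i _ => hn i)
        _ = _ := by
            rw [Finset.sum_const, Finset.card_univ, Fintype.card_fin, nsmul_eq_mul]
            field_simp
    have hz : ∑ i, (a i - p.gradMean θ) = 0 := by
      rw [Finset.sum_sub_distrib, Finset.sum_const, Finset.card_univ, Fintype.card_fin, hmean,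
        ← Nat.cast_smul_eq_nsmul ℝ, smul_smul, mul_one_div_cancel hm0.ne', one_smul, sub_self]
    have hfst : MeasurePreserving (Prod.fst : Draw m B Ξ Z → _) (p.drawLaw I B)
        (blockLaw m I) := by
      have := hp.standing.isProb_P
      have := hp.standing.isProb_Q
      have := isProbabilityMeasure_blockLaw hI
      exact measurePreserving_fst
    have e : ∀ᵐ d : Draw m B Ξ Z ∂(p.drawLaw I B),
        ‖(1 / (I : ℝ)) • ∑ i ∈ d.1, a i - p.gradMean θ‖ ^ 2 =
          (1 / (I : ℝ)) ^ 2 * ‖∑ i, sel i d.1 • (a i - p.gradMean θ)‖ ^ 2 := by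
      filter_upwards [hp.drawLaw_ae_card hI] with d hd
      rw [sum_sel_smul, Finset.sum_sub_distrib, Finset.sum_const, hd,
        ← Nat.cast_smul_eq_nsmul ℝ, ← abs_of_pos (one_div_pos.2 hI0), ← Real.norm_eq_abs,
        ← mul_pow, ← norm_smul, Real.norm_of_nonneg (by positivity), smul_sub, smul_smul,
        one_div_mul_cancel hI0.ne', one_smul]
    rw [integral_congr_ae e, integral_const_mul,
      MeasurePreserving.integral_comp_ae
        (f := fun J => ‖∑ i, sel i J • (a i - p.gradMean θ)‖ ^ 2) hfst
        (measurable_of_finite _).aestronglyMeasurable]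
    have h2 := integral_norm_sum_sel_sq_le hI hI1 _ hz
    have h3 : ∑ i, ‖a i - p.gradMean θ‖ ^ 2 ≤ m * (16 * M ^ 6) := by
      calc _ ≤ ∑ i : Fin m, 16 * M ^ 6 := by
            refine Finset.sum_le_sum fun i _ => ?_
            have := norm_sub_le (a i) (p.gradMean θ)
            have := hn i
            calc _ ≤ (2 * M ^ 3 + 2 * M ^ 3) ^ 2 := by gcongr; linarith
              _ = _ := by ring
        _ = _ := by simp
    calc _ ≤ (1 / (I : ℝ)) ^ 2 * (I / m * (m * (16 * M ^ 6))) := by gcongr; exact h2.trans (by gcongr)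
      _ = _ := by field_simp
  · have hIm : I = m := le_antisymm hI (not_lt.1 h)
    have e : ∀ᵐ d : Draw m B Ξ Z ∂(p.drawLaw I B),
        ‖(1 / (I : ℝ)) • ∑ i ∈ d.1, a i - p.gradMean θ‖ ^ 2 = 0 := by
      filter_upwards [hp.drawLaw_ae_card hI] with d hd
      have : d.1 = Finset.univ := by
        rw [← Finset.card_eq_iff_eq_univ, hd, Fintype.card_fin, hIm]
      rw [this, hmean, hIm, sub_self]
      simp
    rw [integral_congr_ae e]
    simp

/-- Splits the noise into the batch noise within the sampled blocks and the noise of the choice of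
blocks; these give the two summands of `noise`. -/
lemma integral_gradEst_sub_le :
    ∫ d : Draw m B Ξ Z, ‖p.gradEst I d θ - p.gradMean θ‖ ^ 2 ∂(p.drawLaw I B) ≤
      32 * M ^ 6 * noise m I B := by
  have := hp.isProbabilityMeasure_drawLaw (B := B) hI
  have := fun i => hp.isProbabilityMeasure_batchLaw (B := B) i
  have h0 := hp.nonneg
  have hm0 : (0 : ℝ) < m := by exact_mod_cast hI1.trans hI
  set a : (i : Fin m) → Vec dx := fun i => p.blockGrad i θ.x (θ.y i) (θ.H i) with ha
  have hψ : ∀ i, MemLp (fun b => p.blockEst (B := B) i θ.x (θ.y i) (θ.H i) b - a i) 2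
    (p.batchLaw B i) := fun i =>
      (hp.memLp_blockEst i θ.x (θ.y i) (hθ i) hB).sub (memLp_const _)
  have hc : ∀ i, MemLp (fun _ : (Fin B → Ξ) × (Fin B → Z) => a i) 2 (p.batchLaw B i) :=
    fun i => memLp_const _
  have k1 := hp.memLp_sum_blocks hI hψ
  have k2 : MemLp (fun d : Draw m B Ξ Z => (1 / (I : ℝ)) • ∑ i ∈ d.1, a i - p.gradMean θ) 2
    (p.drawLaw I B) := (hp.memLp_sum_blocks hI hc).sub (memLp_const _)
  have h := integral_norm_add_sq_le k1 k2
  have e : ∀ d : Draw m B Ξ Z, (1 / (I : ℝ)) • ∑ i ∈ d.1,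
      (p.blockEst i θ.x (θ.y i) (θ.H i) (d.2.1 i, d.2.2 i) - a i) +
      ((1 / (I : ℝ)) • ∑ i ∈ d.1, a i - p.gradMean θ) = p.gradEst I d θ - p.gradMean θ := fun d => by
    rw [Problem.gradEst_eq, Finset.sum_sub_distrib, smul_sub]
    abel
  simp_rw [e] at h
  have h1 := hp.integral_norm_sum_blocks_sq_le hI hI1 hψ
  have h2 := hp.integral_blockMean_sub_le hI (B := B) hθ hI1
  have h3 : ∑ i, ∫ b, ‖p.blockEst (B := B) i θ.x (θ.y i) (θ.H i) b - a i‖ ^ 2 ∂(p.batchLaw B i) ≤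
      m * (9 * M ^ 6 / B) := by
    refine (Finset.sum_le_sum fun i _ =>
      hp.integral_blockEst_sub_le i θ.x (θ.y i) (hθ i) hB).trans_eq ?_
    simp
  have h4 : 1 / (m : ℝ) * (m * (9 * M ^ 6 / B)) = 9 * M ^ 6 * (1 / B) := by field_simp
  have h5 : 1 / (m : ℝ) * ∑ i, ∫ b, ‖p.blockEst (B := B) i θ.x (θ.y i) (θ.H i) b - a i‖ ^ 2
      ∂(p.batchLaw B i) ≤ 9 * M ^ 6 * (1 / B) := by
    rw [← h4]
    gcongr
  have h6 : 0 ≤ M ^ 6 * (1 / (B : ℝ)) := by positivity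
  have h7 : 0 ≤ M ^ 6 * ((if I < m then 1 else 0) / (I : ℝ)) := by positivity
  rw [noise, mul_add]
  linarith

variable {θ' : State dx dy} (hθ' : ∀ i, θ'.H i ∈ matGe (dy i) lam)
include hθ'

lemma integral_gradEst_diff_le :
    ∫ d : Draw m B Ξ Z, ‖p.gradEst I d θ - p.gradEst I d θ'‖ ^ 2 ∂(p.drawLaw I B) ≤
      48 * M ^ 8 / m * (incX (θ', θ) + incY (θ', θ) + incH (θ', θ)) := by
  have hψ : ∀ i, MemLp (fun b => p.blockEst (B := B) i θ.x (θ.y i) (θ.H i) b -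
    p.blockEst i θ'.x (θ'.y i) (θ'.H i) b) 2 (p.batchLaw B i) := fun i =>
      (hp.memLp_blockEst i θ.x (θ.y i) (hθ i) hB).sub
        (hp.memLp_blockEst i θ'.x (θ'.y i) (hθ' i) hB)
  have h := hp.integral_norm_sum_blocks_sq_le hI hI1 hψ
  simp_rw [Finset.sum_sub_distrib, smul_sub, ← Problem.gradEst_eq] at h
  refine h.trans ?_
  have e : 48 * M ^ 8 / m * (incX (θ', θ) + incY (θ', θ) + incH (θ', θ)) =
      1 / m * ∑ i, 48 * M ^ 8 *
        (‖θ.x - θ'.x‖ ^ 2 + ‖θ.y i - θ'.y i‖ ^ 2 + ‖θ.H i - θ'.H i‖ ^ 2) := by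
    rw [← Finset.mul_sum, incX_add_incY, incH, ← Finset.sum_add_distrib]
    ring
  rw [e]
  gcongr with i
  exact hp.integral_blockEst_diff_le i _ _ (hθ i) _ _ (hθ' i) hB

end Problem.Bounds

namespace Problem.Bounds

variable {p : Problem m dx dy Ξ Z} {lam M : ℝ} (hp : p.Bounds lam M) {I B : ℕ}
include hp

/-- The estimator `z` contracts towards the mean of the gradient estimator. -/
lemma errZ_step (hI : I ≤ m) (hI1 : 1 ≤ I) (hB : 1 ≤ B) {τ : ℝ} {a : Params} (hβ0 : 0 ≤ a.beta)
    (hβ1 : a.beta ≤ 1) {r : State dx dy × State dx dy} (hr : Admissible lam r) :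
    Integrable (fun d : Draw m B Ξ Z => p.errZ (r.2, p.step I lam τ a d r.1 r.2)) (p.drawLaw I B) ∧
    ∫ d : Draw m B Ξ Z, p.errZ (r.2, p.step I lam τ a d r.1 r.2) ∂(p.drawLaw I B) ≤
      (1 - a.beta) * p.errZ r + 96 * M ^ 8 / m * (incX r + incY r + incH r)
        + 64 * M ^ 6 * a.beta ^ 2 * noise m I B := by
  have := hp.isProbabilityMeasure_drawLaw (B := B) hI
  have h0 := hp.nonneg
  have g1 := hp.memLp_gradEst (B := B) hI (fun i => (hr i).1) hB
  have g2 := hp.memLp_gradEst (B := B) hI (fun i => (hr i).2) hB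
  have e1 := hp.integral_gradEst (B := B) hI (fun i => (hr i).1) hB hI1
  have e2 := hp.integral_gradEst (B := B) hI (fun i => (hr i).2) hB hI1
  have v2 := hp.integral_gradEst_sub_le (B := B) hI (fun i => (hr i).2) hB hI1
  have df := hp.integral_gradEst_diff_le (B := B) hI (fun i => (hr i).2) hB hI1 (fun i => (hr i).1)
  set Gc := fun d : Draw m B Ξ Z => p.gradEst I d r.2
  set Gp := fun d : Draw m B Ξ Z => p.gradEst I d r.1
  have k1 : MemLp (fun d => Gc d - Gp d) 2 (p.drawLaw I B) := g2.sub g1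
  have k2 : MemLp (fun d => Gc d - Gp d - (p.gradMean r.2 - p.gradMean r.1)) 2 (p.drawLaw I B) :=
    k1.sub (memLp_const _)
  have k3 : MemLp (fun d => Gc d - p.gradMean r.2) 2 (p.drawLaw I B) := g2.sub (memLp_const _)
  have k4 : MemLp (fun d => (1 - a.beta) • (Gc d - Gp d - (p.gradMean r.2 - p.gradMean r.1))) 2
    (p.drawLaw I B) := k2.const_smul (1 - a.beta)
  have k5 : MemLp (fun d => a.beta • (Gc d - p.gradMean r.2)) 2 (p.drawLaw I B) := k3.const_smul a.beta
  have k6 : MemLp (fun d => (1 - a.beta) • (Gc d - Gp d - (p.gradMean r.2 - p.gradMean r.1)) +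
    a.beta • (Gc d - p.gradMean r.2)) 2 (p.drawLaw I B) := k4.add k5
  have z1 : ∫ d, (Gc d - Gp d) ∂(p.drawLaw I B) = p.gradMean r.2 - p.gradMean r.1 := by
    rw [integral_sub (g2.integrable one_le_two) (g1.integrable one_le_two), e1, e2]
  have z2 : ∫ d, ((1 - a.beta) • (Gc d - Gp d - (p.gradMean r.2 - p.gradMean r.1)) +
    a.beta • (Gc d - p.gradMean r.2)) ∂(p.drawLaw I B) = 0 := by
    rw [integral_add (k4.integrable one_le_two) (k5.integrable one_le_two), integral_smul,
      integral_smul, integral_sub (k1.integrable one_le_two) (integrable_const _), z1,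
      integral_sub (g2.integrable one_le_two) (integrable_const _), e2]
    simp
  -- The contracted old error plus two centred terms: the difference of the two estimators on the
  -- same draw, which is of the size of the increments, and β times the noise of the current
  -- estimator.
  have hstep : ∀ d : Draw m B Ξ Z, p.errZ (r.2, p.step I lam τ a d r.1 r.2) =
      ‖(1 - a.beta) • (r.2.z - p.gradMean r.1) +
        ((1 - a.beta) • (Gc d - Gp d - (p.gradMean r.2 - p.gradMean r.1)) +
          a.beta • (Gc d - p.gradMean r.2))‖ ^ 2 := fun d => by
    simp only [Problem.errZ, Problem.step]
    congr 2
    simp only [Gc, Gp]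
    module
  simp_rw [hstep]
  have k7 : MemLp (fun d => (1 - a.beta) • (r.2.z - p.gradMean r.1) +
        ((1 - a.beta) • (Gc d - Gp d - (p.gradMean r.2 - p.gradMean r.1)) +
          a.beta • (Gc d - p.gradMean r.2))) 2 (p.drawLaw I B) := by
    have kc : MemLp (fun _ : Draw m B Ξ Z => (1 - a.beta) • (r.2.z - p.gradMean r.1)) 2
      (p.drawLaw I B) := memLp_const _
    exact kc.add k6
  refine ⟨integrable_norm_sq k7, ?_⟩
  rw [integral_norm_const_add_sq _ k6 z2]
  have hb : 0 ≤ 1 - a.beta := by linarith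
  have A1 : ‖(1 - a.beta) • (r.2.z - p.gradMean r.1)‖ ^ 2 ≤ (1 - a.beta) * p.errZ r := by
    rw [norm_smul, mul_pow, Real.norm_of_nonneg hb, Problem.errZ]
    gcongr
    nlinarith
  have A2 := integral_norm_add_sq_le k4 k5
  have A3 : ∫ d, ‖(1 - a.beta) • (Gc d - Gp d - (p.gradMean r.2 - p.gradMean r.1))‖ ^ 2
      ∂(p.drawLaw I B) ≤ 48 * M ^ 8 / m * (incX r + incY r + incH r) := by
    have h1 := integral_norm_sub_mean_sq_le k1 z1
    simp_rw [norm_smul, mul_pow]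
    rw [integral_const_mul, Real.norm_of_nonneg hb]
    have h2 : 0 ≤ ∫ d, ‖Gc d - Gp d - (p.gradMean r.2 - p.gradMean r.1)‖ ^ 2 ∂(p.drawLaw I B) :=
      integral_nonneg fun d => by positivity
    have h3 : (1 - a.beta) ^ 2 ≤ 1 := by nlinarith
    have h4 := mul_le_mul_of_nonneg_right h3 h2
    rw [one_mul] at h4
    exact h4.trans (h1.trans df)
  have A4 : ∫ d, ‖a.beta • (Gc d - p.gradMean r.2)‖ ^ 2 ∂(p.drawLaw I B) ≤
      a.beta ^ 2 * (32 * M ^ 6 * noise m I B) := by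
    simp_rw [norm_smul, mul_pow]
    rw [integral_const_mul, Real.norm_of_nonneg hβ0]
    gcongr
  have e : 96 * M ^ 8 / m * (incX r + incY r + incH r) =
    2 * (48 * M ^ 8 / m * (incX r + incY r + incH r)) := by ring
  rw [e]
  linarith

end Problem.Bounds

end BSVRB

namespace BSVRB

open scoped RealInnerProductSpace

/-! ### Measurability of sample derivatives -/

section

variable {S : Type*} [MeasurableSpace S] {a b : ℕ}

lemma measurable_clm {F : Type*} [NormedAddCommGroup F] [NormedSpace ℝ F] [FiniteDimensional ℝ F]
    [MeasurableSpace F] [BorelSpace F] {A : S → Vec a →L[ℝ] F}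
    (hA : ∀ v, Measurable fun s => A s v) : Measurable A := by
  have : SecondCountableTopology F := by
    have := FiniteDimensional.proper_real F
    infer_instance
  have e : A = fun s => ∑ j, (EuclideanSpace.proj j : Vec a →L[ℝ] ℝ).smulRight
      (A s (EuclideanSpace.single j 1)) := by
    ext s v
    have hv : v = ∑ j, v j • EuclideanSpace.single j (1 : ℝ) := by
      ext k
      simp [Finset.sum_apply, Pi.single_apply]
    conv_lhs => rw [hv]
    simp
  rw [e]
  refine Finset.measurable_sum _ fun j _ => ?_
  have hc : Continuous fun w : F => (EuclideanSpace.proj j : Vec a →L[ℝ] ℝ).smulRight w :=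
    (ContinuousLinearMap.smulRightL ℝ (Vec a) F (EuclideanSpace.proj j)).continuous
  exact hc.measurable.comp (hA _)

/-- The directional derivative is the limit of the measurable quotients n (h(x + v/n) - h(x)). -/
lemma measurable_fderiv_sample {F : Type*} [NormedAddCommGroup F] [NormedSpace ℝ F]
    [FiniteDimensional ℝ F] [MeasurableSpace F] [BorelSpace F] {h : Vec a → S → F}
    (hm : ∀ x, Measurable (h x)) (x : Vec a) (hd : ∀ s, DifferentiableAt ℝ (fun x => h x s) x) :
    Measurable fun s => fderiv ℝ (fun x => h x s) x := by
  have : SecondCountableTopology F := by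
    have := FiniteDimensional.proper_real F
    infer_instance
  refine measurable_clm fun v => ?_
  refine measurable_of_tendsto_metrizable
    (f := fun (n : ℕ) s => (n : ℝ) • (h (x + (n : ℝ)⁻¹ • v) s - h x s))
    (fun n => ((hm _).sub (hm _)).const_smul (n : ℝ)) ?_
  rw [tendsto_pi_nhds]
  intro s
  exact ((hd s).hasFDerivAt.lim_real v).comp tendsto_natCast_atTop_atTop

lemma measurable_gradient_sample {h : Vec a → S → ℝ} (hm : ∀ x, Measurable (h x)) (x : Vec a)
    (hd : ∀ s, DifferentiableAt ℝ (fun x => h x s) x) :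
    Measurable fun s => gradient (fun x => h x s) x :=
  (InnerProductSpace.toDual ℝ (Vec a)).symm.continuous.measurable.comp
    (measurable_fderiv_sample hm x hd)

lemma measurable_batchMean {V : Type*} [NormedAddCommGroup V] [NormedSpace ℝ V]
    [MeasurableSpace V] [BorelSpace V] [SecondCountableTopology V] {B : ℕ} {T : Type*}
    [MeasurableSpace T] {h : T → S → V} (hh : Measurable (Function.uncurry h)) {b : T → Fin B → S}
    (hb : Measurable b) : Measurable fun t => batchMean (b t) (h t) := by
  unfold batchMean
  refine Measurable.const_smul (Finset.measurable_sum _ fun j _ => ?_) (1 / (B : ℝ))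
  exact hh.comp (measurable_id.prodMk ((measurable_pi_apply j).comp hb))

/-- Continuous in (x, y) and measurable in the sample (a Carathéodory function), hence jointly
measurable. -/
lemma measurable_sample_of_jointLip {V : Type*} [NormedAddCommGroup V] [MeasurableSpace V]
    [BorelSpace V] {L : ℝ} {h : Vec a → Vec b → S → V} (hl : ∀ s, JointLip L fun x y => h x y s)
    (hm : ∀ x y, Measurable (h x y)) :
    Measurable (Function.uncurry fun (q : Vec a × Vec b) s => h q.1 q.2 s) :=
  measurable_uncurry_of_continuous_of_measurable (fun s => (hl s).continuous) fun q => hm q.1 q.2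

/-- Inversion is continuous on the open set of invertible matrices and is 0 outside it. -/
lemma measurable_inverse {d : ℕ} :
    Measurable (ContinuousLinearMap.inverse : Mat d d → Mat d d) := by
  classical
  have ho : IsOpen {A : Mat d d | A.IsInvertible} := ContinuousLinearEquiv.isOpen
  have e : (ContinuousLinearMap.inverse : Mat d d → Mat d d) =
      {A : Mat d d | A.IsInvertible}.piecewise ContinuousLinearMap.inverse 0 := by
    ext1 A
    by_cases hA : A ∈ {A : Mat d d | A.IsInvertible}
    · rw [Set.piecewise_eq_of_mem _ _ _ hA]
    · rw [Set.piecewise_eq_of_notMem _ _ _ hA, ContinuousLinearMap.inverse_of_not_isInvertible hA]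
      rfl
  rw [e]
  refine ContinuousOn.measurable_piecewise (fun A hA => ?_) continuousOn_const ho.measurableSet
  exact (ContinuousLinearMap.IsInvertible.contDiffAt_map_inverse (n := 0)
    hA).continuousAt.continuousWithinAt

lemma measurable_clm_apply {T : Type*} [MeasurableSpace T] {A : T → Mat a b} {w : T → Vec a}
    (hA : Measurable A) (hw : Measurable w) : Measurable fun t => A t (w t) :=
  (isBoundedBilinearMap_apply (𝕜 := ℝ) (E := Vec a) (F := Vec b)).continuous.measurable.comp
    (hA.prodMk hw)

end

/-! ### The measurable space of states -/

variable {m dx : ℕ} {dy : Fin m → ℕ} {Ξ : Type u} {Z : Type v}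
  [MeasurableSpace Ξ] [MeasurableSpace Z]

noncomputable instance : MeasurableSpace (State dx dy) :=
  MeasurableSpace.comap (fun θ => (θ.x, θ.y, θ.s, θ.H, θ.z)) inferInstance

section

variable {T : Type*} [MeasurableSpace T]

lemma measurable_state_mk {f : T → State dx dy} (hx : Measurable fun t => (f t).x)
    (hy : ∀ i, Measurable fun t => (f t).y i) (hs : ∀ i, Measurable fun t => (f t).s i)
    (hH : ∀ i, Measurable fun t => (f t).H i) (hz : Measurable fun t => (f t).z) :
    Measurable f := by
  rw [measurable_comap_iff]
  exact hx.prodMk ((measurable_pi_lambda _ hy).prodMk ((measurable_pi_lambda _ hs).prodMk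
    ((measurable_pi_lambda _ hH).prodMk hz)))

lemma measurable_state_prod : Measurable fun θ : State dx dy => (θ.x, θ.y, θ.s, θ.H, θ.z) :=
  comap_measurable _

@[fun_prop]
lemma measurable_state_x : Measurable fun θ : State dx dy => θ.x := measurable_state_prod.fst

@[fun_prop]
lemma measurable_state_y (i : Fin m) : Measurable fun θ : State dx dy => θ.y i :=
  (measurable_pi_apply i).comp measurable_state_prod.snd.fst

@[fun_prop]
lemma measurable_state_s (i : Fin m) : Measurable fun θ : State dx dy => θ.s i :=
  (measurable_pi_apply i).comp measurable_state_prod.snd.snd.fst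

@[fun_prop]
lemma measurable_state_H (i : Fin m) : Measurable fun θ : State dx dy => θ.H i :=
  (measurable_pi_apply i).comp measurable_state_prod.snd.snd.snd.fst

@[fun_prop]
lemma measurable_state_z : Measurable fun θ : State dx dy => θ.z :=
  measurable_state_prod.snd.snd.snd.snd

end

namespace Problem.Bounds

variable {p : Problem m dx dy Ξ Z} {lam M : ℝ} (hp : p.Bounds lam M) {I B : ℕ}
include hp

lemma measurable_sample_fx (i : Fin m) : Measurable (Function.uncurry
    fun (q : Vec dx × Vec (dy i)) ξ => gradX (fun x y => p.f i x y ξ) q.1 q.2) :=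
  measurable_sample_of_jointLip (h := fun x y ξ => gradX (fun x y => p.f i x y ξ) x y) (hp.lip_fx i)
    fun x y => measurable_gradient_sample (h := fun x ξ => p.f i x y ξ)
      (fun x => hp.standing.measurable_f i x y) x fun ξ =>
        ((hp.standing.diff_f i ξ).comp (differentiable_id.prodMk (differentiable_const y))) x

lemma measurable_sample_fy (i : Fin m) : Measurable (Function.uncurry
    fun (q : Vec dx × Vec (dy i)) ξ => gradY (fun x y => p.f i x y ξ) q.1 q.2) :=
  measurable_sample_of_jointLip (h := fun x y ξ => gradY (fun x y => p.f i x y ξ) x y) (hp.lip_fy i)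
    fun x y => measurable_gradient_sample (h := fun y ξ => p.f i x y ξ)
      (fun y => hp.standing.measurable_f i x y) y fun ξ =>
        ((hp.standing.diff_f i ξ).comp ((differentiable_const x).prodMk differentiable_id)) y

lemma measurable_gradY_sample (i : Fin m) (x : Vec dx) (y : Vec (dy i)) :
    Measurable fun ζ => gradY (fun x y => p.g i x y ζ) x y :=
  measurable_gradient_sample (h := fun y ζ => p.g i x y ζ)
    (fun y => hp.standing.measurable_g i x y) y fun ζ =>
      ((hp.standing.diff_g i ζ).comp ((differentiable_const x).prodMk differentiable_id)) y

lemma measurable_sample_gy (i : Fin m) : Measurable (Function.uncurry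
    fun (q : Vec dx × Vec (dy i)) ζ => gradY (fun x y => p.g i x y ζ) q.1 q.2) :=
  measurable_sample_of_jointLip (h := fun x y ζ => gradY (fun x y => p.g i x y ζ) x y) (hp.lip_gy i)
    (hp.measurable_gradY_sample i)

lemma measurable_sample_gxy (i : Fin m) : Measurable (Function.uncurry
    fun (q : Vec dx × Vec (dy i)) ζ => jacXY (fun x y => p.g i x y ζ) q.1 q.2) :=
  measurable_sample_of_jointLip (h := fun x y ζ => jacXY (fun x y => p.g i x y ζ) x y)
    (hp.lip_gxy i) fun x y => by
      have h := measurable_fderiv_sample (h := fun x ζ => gradY (fun x y => p.g i x y ζ) x y)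
        (fun x => hp.measurable_gradY_sample i x y) x fun ζ =>
        ((hp.standing.diff_gradY_g i ζ).comp (differentiable_id.prodMk (differentiable_const y))) x
      exact (ContinuousLinearMap.adjoint (𝕜 := ℝ)
        (E := Vec dx) (F := Vec (dy i))).continuous.measurable.comp h

lemma measurable_sample_gyy (i : Fin m) : Measurable (Function.uncurry
    fun (q : Vec dx × Vec (dy i)) ζ => hessYY (fun x y => p.g i x y ζ) q.1 q.2) :=
  measurable_sample_of_jointLip (h := fun x y ζ => hessYY (fun x y => p.g i x y ζ) x y)
    (hp.lip_gyy i) fun x y =>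
      measurable_fderiv_sample (h := fun y ζ => gradY (fun x y => p.g i x y ζ) x y)
        (fun y => hp.measurable_gradY_sample i x y) y fun ζ =>
        ((hp.standing.diff_gradY_g i ζ).comp ((differentiable_const x).prodMk differentiable_id)) y

section compose

variable {T : Type*} [MeasurableSpace T] {d : T → Draw m B Ξ Z} (hd : Measurable d)
  {θ : T → State dx dy} (hθ : Measurable θ)
include hd hθ

omit hp in
lemma measurable_batch_left {V : Type*} [NormedAddCommGroup V] [NormedSpace ℝ V]
    [MeasurableSpace V] [BorelSpace V] [SecondCountableTopology V] (i : Fin m)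
    {h : Vec dx → Vec (dy i) → Ξ → V}
    (hh : Measurable (Function.uncurry fun (q : Vec dx × Vec (dy i)) ξ => h q.1 q.2 ξ)) :
    Measurable fun t => batchMean ((d t).2.1 i) (h (θ t).x ((θ t).y i)) := by
  refine measurable_batchMean (h := fun t => h (θ t).x ((θ t).y i)) ?_
    ((measurable_pi_apply i).comp hd.snd.fst)
  exact hh.comp ((((measurable_state_x.comp hθ).prodMk
    ((measurable_state_y i).comp hθ)).comp measurable_fst).prodMk measurable_snd)

omit hp in
lemma measurable_batch_right {V : Type*} [NormedAddCommGroup V] [NormedSpace ℝ V]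
    [MeasurableSpace V] [BorelSpace V] [SecondCountableTopology V] (i : Fin m)
    {h : Vec dx → Vec (dy i) → Z → V}
    (hh : Measurable (Function.uncurry fun (q : Vec dx × Vec (dy i)) ζ => h q.1 q.2 ζ)) :
    Measurable fun t => batchMean ((d t).2.2 i) (h (θ t).x ((θ t).y i)) := by
  refine measurable_batchMean (h := fun t => h (θ t).x ((θ t).y i)) ?_
    ((measurable_pi_apply i).comp hd.snd.snd)
  exact hh.comp ((((measurable_state_x.comp hθ).prodMk
    ((measurable_state_y i).comp hθ)).comp measurable_fst).prodMk measurable_snd)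

omit hp hθ in
lemma measurableSet_mem_draw (i : Fin m) : MeasurableSet {t | i ∈ (d t).1} :=
  hd.fst (Set.toFinite {J : Finset (Fin m) | i ∈ J}).measurableSet

lemma measurable_gradEst : Measurable fun t => p.gradEst I (d t) (θ t) := by
  have e : (fun t => p.gradEst I (d t) (θ t)) = fun t => (1 / (I : ℝ)) • ∑ i, sel i (d t).1 •
      p.blockEst i (θ t).x ((θ t).y i) ((θ t).H i) ((d t).2.1 i, (d t).2.2 i) :=
    funext fun t => by
      rw [Problem.gradEst_eq, sum_sel_smul (d t).1 fun i =>
        p.blockEst i (θ t).x ((θ t).y i) ((θ t).H i) ((d t).2.1 i, (d t).2.2 i)]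
  rw [e]
  refine Measurable.const_smul (Finset.measurable_sum _ fun i _ => ?_) (1 / (I : ℝ))
  refine Measurable.smul ((measurable_of_finite (sel i)).comp hd.fst) ?_
  unfold Problem.blockEst
  exact (measurable_batch_left hd hθ i
      (h := fun x y ξ => gradX (fun x y => p.f i x y ξ) x y) (hp.measurable_sample_fx i)).sub
    (measurable_clm_apply (measurable_batch_right hd hθ i
      (h := fun x y ζ => jacXY (fun x y => p.g i x y ζ) x y) (hp.measurable_sample_gxy i))
      (measurable_clm_apply (measurable_inverse.comp ((measurable_state_H i).comp hθ))
        (measurable_batch_left hd hθ i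
      (h := fun x y ξ => gradY (fun x y => p.f i x y ξ) x y) (hp.measurable_sample_fy i))))

variable {θ' : T → State dx dy} (hθ' : Measurable θ')
include hθ'

lemma measurable_step (τ : ℝ) (a : Params) :
    Measurable fun t => p.step I lam τ a (d t) (θ' t) (θ t) := by
  have hz : Measurable fun t => (p.step I lam τ a (d t) (θ' t) (θ t)).z :=
    (((measurable_state_z.comp hθ).sub (hp.measurable_gradEst hd hθ')).const_smul
      (1 - a.beta)).add (hp.measurable_gradEst hd hθ)
  refine measurable_state_mk ?_ (fun i => ?_) (fun i => ?_) (fun i => ?_) hz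
  · exact (measurable_state_x.comp hθ).sub (hz.const_smul a.eta)
  · exact ((measurable_state_y i).comp hθ).sub
      (((measurable_state_s i).comp hθ).const_smul (τ * a.tauT))
  · have h1 := measurable_batch_right hd hθ i
      (h := fun x y ζ => gradY (fun x y => p.g i x y ζ) x y) (hp.measurable_sample_gy i)
    have h2 := measurable_batch_right hd hθ' i
      (h := fun x y ζ => gradY (fun x y => p.g i x y ζ) x y) (hp.measurable_sample_gy i)
    have h3 := (measurable_state_s i).comp hθ
    exact Measurable.ite (measurableSet_mem_draw hd i)
      (((h3.const_smul (1 - a.alpha)).add (h1.const_smul a.alpha)).add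
        ((h1.sub h2).const_smul (gammaOf m I a.alpha))) h3
  · have h1 := measurable_batch_right hd hθ i
      (h := fun x y ζ => hessYY (fun x y => p.g i x y ζ) x y) (hp.measurable_sample_gyy i)
    have h2 := measurable_batch_right hd hθ' i
      (h := fun x y ζ => hessYY (fun x y => p.g i x y ζ) x y) (hp.measurable_sample_gyy i)
    have h3 := (measurable_state_H i).comp hθ
    exact Measurable.ite (measurableSet_mem_draw hd i)
      (continuous_matProj.measurable.comp (((h3.const_smul (1 - a.alphaBar)).add
        (h1.const_smul a.alphaBar)).add ((h1.sub h2).const_smul (gammaOf m I a.alphaBar)))) h3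

end compose

/-! ### Measurability of the error functionals -/

lemma measurable_F : Measurable p.F := hp.differentiable_F.continuous.measurable

lemma measurable_gradient_F : Measurable (gradient p.F) :=
  (LipschitzWith.of_dist_le_mul (K := ⟨9 * M ^ 7, by have := hp.nonneg; positivity⟩) fun x x' => by
    rw [dist_eq_norm, dist_eq_norm]; exact hp.gradient_lip x x').continuous.measurable

omit hp in
lemma measurable_incX : Measurable (incX : State dx dy × State dx dy → ℝ) := by
  unfold incX
  fun_prop

omit hp in
lemma measurable_incY : Measurable (incY : State dx dy × State dx dy → ℝ) := by
  unfold incY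
  fun_prop

omit hp in
lemma measurable_incH : Measurable (incH : State dx dy × State dx dy → ℝ) := by
  unfold incH
  fun_prop

lemma measurable_errY : Measurable p.errY := by
  unfold Problem.errY
  refine Finset.measurable_sum _ fun i _ => ?_
  exact (((measurable_state_y i).sub
    ((hp.ySol_continuous i).measurable.comp measurable_state_x)).norm).pow_const 2

omit [MeasurableSpace Ξ] [MeasurableSpace Z] hp in
lemma measurable_jointLip_state {V : Type*} [NormedAddCommGroup V] [MeasurableSpace V]
    [BorelSpace V] (i : Fin m) {h : Vec dx → Vec (dy i) → V} (hh : JointLip M h) :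
    Measurable fun θ : State dx dy => h θ.x (θ.y i) :=
  hh.continuous.measurable.comp (measurable_state_x.prodMk (measurable_state_y i))

lemma measurable_errS : Measurable p.errS := by
  unfold Problem.errS
  refine Finset.measurable_sum _ fun i _ => ?_
  exact ((((measurable_state_s i).comp measurable_snd).sub
    ((measurable_jointLip_state i (hp.mean_lip_gy i)).comp measurable_fst)).norm).pow_const 2

lemma measurable_errH : Measurable p.errH := by
  unfold Problem.errH
  refine Finset.measurable_sum _ fun i _ => ?_
  exact continuous_frobSq.measurable.comp (((measurable_state_H i).comp measurable_snd).sub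
    ((measurable_jointLip_state i (hp.mean_lip_gyy i)).comp measurable_fst))

lemma measurable_gradMean : Measurable p.gradMean := by
  unfold Problem.gradMean
  refine Measurable.const_smul (Finset.measurable_sum _ fun i _ => ?_) (1 / (m : ℝ))
  exact (measurable_jointLip_state i (hp.mean_lip_fx i)).sub
    (measurable_clm_apply (measurable_jointLip_state i (hp.mean_lip_gxy i))
      (measurable_clm_apply (measurable_inverse.comp (measurable_state_H i))
        (measurable_jointLip_state i (hp.mean_lip_fy i))))

lemma measurable_errZ : Measurable p.errZ := by
  unfold Problem.errZ
  exact (((measurable_state_z.comp measurable_snd).sub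
    (hp.measurable_gradMean.comp measurable_fst)).norm).pow_const 2

end Problem.Bounds

end BSVRB

namespace BSVRB

open scoped RealInnerProductSpace ENNReal

variable {m dx : ℕ} {dy : Fin m → ℕ} {Ξ : Type u} {Z : Type v}
  [MeasurableSpace Ξ] [MeasurableSpace Z]

/-! ### The potential function of one stage -/

/-- The squared increments of both levels. -/
noncomputable def incXY (r : State dx dy × State dx dy) : ℝ := incX r + incY r

lemma incXY_nonneg (r : State dx dy × State dx dy) : 0 ≤ incXY r :=
  add_nonneg (incX_nonneg r) (incY_nonneg r)

/-- The potential function: the optimality gap plus weighted errors. -/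
noncomputable def Problem.potential (p : Problem m dx dy Ξ Z) (xstar : Vec dx) (K q a η α : ℝ)
    (r : State dx dy × State dx dy) : ℝ :=
  (p.F r.2.x - p.F xstar) + 2 * K * η / α * p.errZ r + 2 * K ^ 2 * (η / m) / a * p.errY r.2
    + 3 * K ^ 3 * (η / m) / (α * q) * p.errS r + 6 * K ^ 3 * (η / m) / (α * q) * p.errH r
    + 4 * K ^ 2 * (η / m) / α * incH r + 20 * K ^ 4 * (η / m) / (α * q ^ 2) * incXY r

/-- The decrease of the potential function in one iteration, per unit of the step size. -/
noncomputable def Problem.gain (p : Problem m dx dy Ξ Z) (r : State dx dy × State dx dy) : ℝ :=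
  ‖gradient p.F r.2.x‖ ^ 2 / 2 + p.errZ r
    + (p.errY r.2 + p.errS r + p.errH r + incH r + incXY r) / m

/-- The conditions on the step sizes under which the potential function decreases. -/
structure StepSizes (M K q a η α : ℝ) : Prop where
  q_pos : 0 < q
  q_le : q ≤ 1
  a_pos : 0 < a
  a_le : a ≤ 1 / K
  eta_pos : 0 < η
  eta_le : η ≤ 1 / (2 * (9 * M ^ 7))
  alpha_pos : 0 < α
  alpha_le : α ≤ 1 / 2
  lower_le : 10 * K ^ 3 * a ^ 2 ≤ α * q ^ 2
  upper_le : 16 * K ^ 3 * η ^ 2 ≤ a ^ 2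

-- Balancing the weights of the potential

section algebra

variable {M K q a η α mr : ℝ} (h : StepSizes M K q a η α) (hK : 1 ≤ K) (hm : 1 ≤ mr)
include h hK hm

/-- Pays for the new increments X and Y, which enter the potential with a large weight. By
`lower_le` this weight is at most 2Ke/a² with e = η/m, which is what the negative Y-term of the
lower level provides; by `upper_le` the negative X-term of the descent inequality covers 4K³e/a²,
the sum of this weight and of the drift of y(x). -/
lemma StepSizes.pathwise {F F' G Z' D D' S H W X Y c₁ c₂ c₃ c₄ c₅ : ℝ} (hD : 0 ≤ D) (hS : 0 ≤ S)
    (hH : 0 ≤ H) (hW : 0 ≤ W) (hX : 0 ≤ X) (hY : 0 ≤ Y)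
    (hc₁ : c₁ ≤ K) (hc₂ : 1 / K ≤ c₂) (hc₃ : c₃ ≤ K) (hc₄ : 1 / K ≤ c₄) (hc₅ : c₅ ≤ K)
    (hF : F' ≤ F - η / 2 * G - 1 / (4 * η * mr) * X + η * Z' + c₁ * η / mr * (D + H + W))
    (hD' : D' ≤ (1 - a * c₂) * D + c₃ * a * (S + W) - c₄ / a * Y + c₅ / a * X) :
    F' + 2 * K ^ 2 * (η / mr) / a * D' + 20 * K ^ 4 * (η / mr) / (α * q ^ 2) * (X + Y) ≤
      F - η / 2 * G + η * Z' + K * (η / mr) * (D + H + W) + 2 * K ^ 2 * (η / mr) / a * D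
        - 2 * K * (η / mr) * D + 2 * K ^ 3 * (η / mr) * (S + W) := by
  obtain ⟨hq, hq1, ha, ha1, hη, hη1, hα, hα1, hlow, hup⟩ := h
  have hK0 : 0 < K := by linarith
  have hm0 : 0 < mr := by linarith
  set e := η / mr with he
  have he0 : 0 < e := by positivity
  have hA : 0 < 2 * K ^ 2 * e / a := by positivity
  have t1 : c₁ * η / mr * (D + H + W) ≤ K * e * (D + H + W) := by
    rw [mul_div_assoc]
    gcongr
  have t2 := mul_le_mul_of_nonneg_left hD' hA.le
  have t3 : 2 * K ^ 2 * e / a * ((1 - a * c₂) * D) ≤ 2 * K ^ 2 * e / a * D - 2 * K * e * D := by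
    have : 2 * K * e * D ≤ 2 * K ^ 2 * e * c₂ * D := by
      have h1 : 2 * K ^ 2 * e * (1 / K) * D ≤ 2 * K ^ 2 * e * c₂ * D := by gcongr
      calc _ = 2 * K ^ 2 * e * (1 / K) * D := by field_simp
        _ ≤ _ := h1
    have e1 : 2 * K ^ 2 * e / a * ((1 - a * c₂) * D) =
      2 * K ^ 2 * e / a * D - 2 * K ^ 2 * e * c₂ * D := by field_simp
    linarith
  have t4 : 2 * K ^ 2 * e / a * (c₃ * a * (S + W)) ≤ 2 * K ^ 3 * e * (S + W) := by
    calc _ = 2 * K ^ 2 * e * (c₃ * (S + W)) := by field_simp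
      _ ≤ 2 * K ^ 2 * e * (K * (S + W)) := by gcongr
      _ = _ := by ring
  have t5 : 20 * K ^ 4 * e / (α * q ^ 2) ≤ 2 * K * e / a ^ 2 := by
    rw [div_le_div_iff₀ (by positivity) (by positivity)]
    calc _ = 2 * K * e * (10 * K ^ 3 * a ^ 2) := by ring
      _ ≤ _ := by gcongr
  have t6 : 20 * K ^ 4 * e / (α * q ^ 2) * Y ≤ 2 * K ^ 2 * e / a * (c₄ / a * Y) := by
    calc _ ≤ 2 * K * e / a ^ 2 * Y := by gcongr
      _ = 2 * K ^ 2 * e / a * (1 / K / a * Y) := by field_simp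
      _ ≤ _ := by gcongr
  have t7 : 2 * K ^ 2 * e / a * (c₅ / a * X) + 20 * K ^ 4 * e / (α * q ^ 2) * X ≤
      1 / (4 * η * mr) * X := by
    calc _ ≤ 2 * K ^ 2 * e / a * (K / a * X) + 2 * K * e / a ^ 2 * X := by gcongr
      _ = (2 * K ^ 3 + 2 * K) * e / a ^ 2 * X := by field_simp
      _ ≤ 4 * K ^ 3 * e / a ^ 2 * X := by
          have : K ≤ K ^ 3 := le_self_pow₀ hK (by norm_num)
          gcongr
          linarith
      _ ≤ _ := by
          refine mul_le_mul_of_nonneg_right ?_ hX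
          rw [div_le_div_iff₀ (by positivity) (by positivity)]
          calc _ = 16 * K ^ 3 * η ^ 2 * (mr / mr) := by rw [he]; ring
            _ ≤ _ := by rw [div_self hm0.ne']; linarith
  linarith

set_option maxHeartbeats 1000000 in
-- The weights are chosen so that each contraction pays for what the next error costs. The loss
-- -2KeD pays for D in the descent inequality; -3K³eS and -6K³eH pay for the uses of S and H in the
-- objective, the lower level and Δ'; the weight of Δ pays for its use in Z'. Everything in W is
-- collected in 20K⁴ω, the largest weight, and the noise adds up to 16K⁴ηαρ.
lemma StepSizes.expected {F G Z' Zr D S S' H H' Δ Δ' W ρ b : ℝ} (hZ : 0 ≤ Zr)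
    (hD : 0 ≤ D) (hS : 0 ≤ S) (hH : 0 ≤ H) (hΔ : 0 ≤ Δ) (hW : 0 ≤ W) (hb : 0 ≤ b) (hbρ : b ≤ ρ)
    (hZ' : Z' ≤ (1 - α) * Zr + K / mr * (W + Δ) + K * α ^ 2 * ρ)
    (hS' : S' ≤ (1 - α * q) * S + K * q⁻¹ * W + K * q * mr * α ^ 2 * b)
    (hH' : H' ≤ (1 - α * q) * H + K * q⁻¹ * W + K * q * mr * α ^ 2 * b)
    (hΔ' : Δ' ≤ K * q * α ^ 2 * H + K * q⁻¹ * W + K * q * mr * α ^ 2 * b) :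
    F - η / 2 * G + η * Z' + K * (η / mr) * (D + H + W) + 2 * K ^ 2 * (η / mr) / a * D
        - 2 * K * (η / mr) * D + 2 * K ^ 3 * (η / mr) * (S + W)
        + 2 * K * η / α * Z' + 3 * K ^ 3 * (η / mr) / (α * q) * S'
        + 6 * K ^ 3 * (η / mr) / (α * q) * H' + 4 * K ^ 2 * (η / mr) / α * Δ'
        + η * (G / 2 + Zr + (D + S + H + Δ + W) / mr) ≤
      F + 2 * K * η / α * Zr + 2 * K ^ 2 * (η / mr) / a * D + 3 * K ^ 3 * (η / mr) / (α * q) * S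
        + 6 * K ^ 3 * (η / mr) / (α * q) * H + 4 * K ^ 2 * (η / mr) / α * Δ
        + 20 * K ^ 4 * (η / mr) / (α * q ^ 2) * W + 16 * K ^ 4 * η * α * ρ := by
  obtain ⟨hq, hq1, ha, ha1, hη, hη1, hα, hα1, hlow, hup⟩ := h
  have hK0 : 0 < K := by linarith
  have hm0 : 0 < mr := by linarith
  have hρ : 0 ≤ ρ := hb.trans hbρ
  have hηe : η = η / mr * mr := by field_simp
  set e := η / mr with he
  have he0 : 0 < e := by positivity
  have k12 : K ≤ K ^ 2 := le_self_pow₀ hK (by norm_num)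
  have k23 : K ^ 2 ≤ K ^ 3 := pow_le_pow_right₀ hK (by norm_num)
  have k34 : K ^ 3 ≤ K ^ 4 := pow_le_pow_right₀ hK (by norm_num)
  -- The largest scale: e ≤ e/α ≤ e/(αq) ≤ ω, so every W-term can be compared with ωW.
  set ω := e / (α * q ^ 2) with hω
  have hω0 : 0 < ω := by positivity
  have w3 : e / (α * q) ≤ ω := by
    rw [hω]
    gcongr
    exact pow_le_of_le_one hq.le hq1 two_ne_zero
  have w2 : e / α ≤ e / (α * q) := by
    gcongr
    exact mul_le_of_le_one_right hα.le hq1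
  have hα2 : α ≤ 1 := by linarith
  have w1 : e ≤ e / α := by
    rw [le_div_iff₀ hα]
    exact mul_le_of_le_one_right he0.le hα2
  have f1 : 0 ≤ η + 2 * K * η / α := by positivity
  have hηK : η ≤ K * η := le_mul_of_one_le_left hη.le hK
  have ηle : η ≤ K * η / α := by
    rw [le_div_iff₀ hα]
    exact (mul_le_of_le_one_right hη.le hα2).trans hηK
  have s1 : (η + 2 * K * η / α) * Z' ≤ 2 * K * η / α * Zr - η * Zr
      + 3 * K ^ 2 * (e / α) * (W + Δ) + 3 * K ^ 2 * η * α * ρ := by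
    have g1 := mul_le_mul_of_nonneg_left hZ' f1
    have g2 : (η + 2 * K * η / α) * ((1 - α) * Zr) ≤ 2 * K * η / α * Zr - η * Zr := by
      have e1 : (η + 2 * K * η / α) * ((1 - α) * Zr) =
        2 * K * η / α * Zr + (η - η * α - 2 * K * η) * Zr := by field_simp; ring
      have e2 : (η - η * α - 2 * K * η) * Zr ≤ (-η) * Zr := by
        refine mul_le_mul_of_nonneg_right ?_ hZ
        have := mul_pos hη hα
        linarith
      linarith
    have f2 : η + 2 * K * η / α ≤ 3 * K * η / α := by
      have : 3 * K * η / α = K * η / α + 2 * K * η / α := by ring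
      linarith
    have g3 : (η + 2 * K * η / α) * (K / mr * (W + Δ)) ≤ 3 * K ^ 2 * (e / α) * (W + Δ) := by
      calc _ ≤ 3 * K * η / α * (K / mr * (W + Δ)) := by gcongr
        _ = _ := by rw [he]; ring
    have g4 : (η + 2 * K * η / α) * (K * α ^ 2 * ρ) ≤ 3 * K ^ 2 * η * α * ρ := by
      calc _ ≤ 3 * K * η / α * (K * α ^ 2 * ρ) := by gcongr
        _ = _ := by field_simp
    linarith
  have s2 : 3 * K ^ 3 * e / (α * q) * S' ≤ 3 * K ^ 3 * e / (α * q) * S - 3 * K ^ 3 * e * S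
      + 3 * K ^ 4 * ω * W + 3 * K ^ 4 * η * α * ρ := by
    have g1 := mul_le_mul_of_nonneg_left hS' (by positivity : 0 ≤ 3 * K ^ 3 * e / (α * q))
    have e1 : 3 * K ^ 3 * e / (α * q) *
      ((1 - α * q) * S + K * q⁻¹ * W + K * q * mr * α ^ 2 * b) =
      3 * K ^ 3 * e / (α * q) * S - 3 * K ^ 3 * e * S + 3 * K ^ 4 * ω * W
        + 3 * K ^ 4 * (e * mr) * α * b := by rw [hω]; field_simp
    rw [e1, ← hηe] at g1
    have : 3 * K ^ 4 * η * α * b ≤ 3 * K ^ 4 * η * α * ρ := by gcongr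
    linarith
  have s3 : 6 * K ^ 3 * e / (α * q) * H' ≤ 6 * K ^ 3 * e / (α * q) * H - 6 * K ^ 3 * e * H
      + 6 * K ^ 4 * ω * W + 6 * K ^ 4 * η * α * ρ := by
    have g1 := mul_le_mul_of_nonneg_left hH' (by positivity : 0 ≤ 6 * K ^ 3 * e / (α * q))
    have e1 : 6 * K ^ 3 * e / (α * q) *
      ((1 - α * q) * H + K * q⁻¹ * W + K * q * mr * α ^ 2 * b) =
      6 * K ^ 3 * e / (α * q) * H - 6 * K ^ 3 * e * H + 6 * K ^ 4 * ω * W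
        + 6 * K ^ 4 * (e * mr) * α * b := by rw [hω]; field_simp
    rw [e1, ← hηe] at g1
    have : 6 * K ^ 4 * η * α * b ≤ 6 * K ^ 4 * η * α * ρ := by gcongr
    linarith
  have s4 : 4 * K ^ 2 * e / α * Δ' ≤ 2 * K ^ 3 * e * H + 4 * K ^ 3 * ω * W
      + 4 * K ^ 3 * η * α * ρ := by
    have g1 := mul_le_mul_of_nonneg_left hΔ' (by positivity : 0 ≤ 4 * K ^ 2 * e / α)
    have e1 : 4 * K ^ 2 * e / α * (K * q * α ^ 2 * H + K * q⁻¹ * W + K * q * mr * α ^ 2 * b) =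
      4 * K ^ 3 * e * (q * α) * H + 4 * K ^ 3 * (e / (α * q)) * W
        + 4 * K ^ 3 * (e * mr) * α * (q * b) := by field_simp
    rw [e1, ← hηe] at g1
    have hqb : q * b ≤ 1 * ρ := by gcongr
    have hqα : q * α ≤ 1 * (1 / 2) := by gcongr
    have c1 : 4 * K ^ 3 * η * α * (q * b) ≤ 4 * K ^ 3 * η * α * (1 * ρ) := by gcongr
    have c2 : 4 * K ^ 3 * e * (q * α) * H ≤ 4 * K ^ 3 * e * (1 * (1 / 2)) * H := by gcongr
    have c3 : 4 * K ^ 3 * (e / (α * q)) * W ≤ 4 * K ^ 3 * ω * W := by gcongr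
    linarith
  have eV : η * (G / 2 + Zr + (D + S + H + Δ + W) / mr) =
    η / 2 * G + η * Zr + e * (D + S + H + Δ + W) := by rw [he]; ring
  have eω : 20 * K ^ 4 * e / (α * q ^ 2) * W = 20 * K ^ 4 * ω * W := by rw [hω]; ring
  have eΔ : 4 * K ^ 2 * e / α * Δ = 4 * K ^ 2 * (e / α) * Δ := by ring
  have d1 : e * D ≤ K * (e * D) := le_mul_of_one_le_left (by positivity) hK
  have d2 : e * S ≤ K ^ 3 * (e * S) := le_mul_of_one_le_left (by positivity) (one_le_pow₀ hK)
  have d3 : e * H ≤ K ^ 3 * (e * H) := le_mul_of_one_le_left (by positivity) (one_le_pow₀ hK)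
  have d3' : K * (e * H) ≤ K ^ 3 * (e * H) := by gcongr; linarith
  have d4 : e * Δ ≤ K ^ 2 * ((e / α) * Δ) :=
    (mul_le_mul_of_nonneg_right w1 hΔ).trans
      (le_mul_of_one_le_left (by positivity) (one_le_pow₀ hK))
  have ew : e * W ≤ ω * W := by gcongr; linarith
  have ew2 : e / α * W ≤ ω * W := by gcongr; linarith
  have hωW : 0 ≤ ω * W := by positivity
  have d5 : e * W ≤ K ^ 4 * (ω * W) := ew.trans (le_mul_of_one_le_left hωW (one_le_pow₀ hK))
  have d6 : K * (e * W) ≤ K ^ 4 * (ω * W) := by gcongr; linarith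
  have d7 : K ^ 3 * (e * W) ≤ K ^ 4 * (ω * W) := by gcongr
  have d8 : K ^ 2 * (e / α * W) ≤ K ^ 4 * (ω * W) := by gcongr ?_ * ?_; linarith
  have d9 : K ^ 3 * (ω * W) ≤ K ^ 4 * (ω * W) := by gcongr
  have n0 : 0 ≤ η * α * ρ := by positivity
  have n1 : K ^ 2 * (η * α * ρ) ≤ K ^ 4 * (η * α * ρ) := by gcongr; linarith
  have n2 : K ^ 3 * (η * α * ρ) ≤ K ^ 4 * (η * α * ρ) := by gcongr
  have hH3 : 0 ≤ K ^ 3 * (e * H) := by positivity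
  rw [eV, eω, eΔ]
  linarith

end algebra

end BSVRB

-- The potential during an iteration, at a restart and at the start

namespace BSVRB

open scoped RealInnerProductSpace ENNReal

variable {m dx : ℕ} {dy : Fin m → ℕ} {Ξ : Type u} {Z : Type v}
  [MeasurableSpace Ξ] [MeasurableSpace Z]

lemma admissible_step (p : Problem m dx dy Ξ Z) {I B : ℕ} {lam τ : ℝ} {a : Params}
    {d : Draw m B Ξ Z} {r : State dx dy × State dx dy} (hr : Admissible lam r) :
    Admissible lam (r.2, p.step I lam τ a d r.1 r.2) := fun i => by
  refine ⟨(hr i).2, ?_⟩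
  simp only [Problem.step]
  split_ifs
  · exact matProj_mem _
  · exact (hr i).2

lemma Problem.gain_nonneg (p : Problem m dx dy Ξ Z) (r : State dx dy × State dx dy) :
    0 ≤ p.gain r := by
  have h1 := p.errZ_nonneg r
  have h2 := p.errY_nonneg r.2
  have h3 := p.errS_nonneg r
  have h4 := p.errH_nonneg r
  have h5 := incH_nonneg r
  have h6 := incXY_nonneg r
  unfold Problem.gain
  positivity

lemma Problem.potential_nonneg (p : Problem m dx dy Ξ Z) {xstar : Vec dx}
    (hx : ∀ x, p.F xstar ≤ p.F x) {M K q a η α : ℝ} (h : StepSizes M K q a η α) (hK : 1 ≤ K)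
    (r : State dx dy × State dx dy) : 0 ≤ p.potential xstar K q a η α r := by
  have h0 := sub_nonneg.2 (hx r.2.x)
  have h1 := p.errZ_nonneg r
  have h2 := p.errY_nonneg r.2
  have h3 := p.errS_nonneg r
  have h4 := p.errH_nonneg r
  have h5 := incH_nonneg r
  have h6 := incXY_nonneg r
  obtain ⟨hq, hq1, ha, ha1, hη, hη1, hα, hα1, hlow, hup⟩ := h
  unfold Problem.potential
  positivity

namespace Problem.Bounds

variable {p : Problem m dx dy Ξ Z} {lam M : ℝ} (hp : p.Bounds lam M) {I B : ℕ}
include hp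

lemma measurable_gain : Measurable p.gain := by
  have h1 := hp.measurable_gradient_F.comp (measurable_state_x.comp
    (measurable_snd : Measurable (Prod.snd : State dx dy × State dx dy → _)))
  have h2 := hp.measurable_errZ
  have h3 := hp.measurable_errY.comp
    (measurable_snd : Measurable (Prod.snd : State dx dy × State dx dy → _))
  have h4 := hp.measurable_errS
  have h5 := hp.measurable_errH
  have h6 := measurable_incH (dx := dx) (dy := dy)
  have h7 := (measurable_incX (dx := dx) (dy := dy)).add measurable_incY
  exact (((h1.norm.pow_const 2).div_const 2).add h2).add
    ((((((h3.add h4).add h5).add h6).add h7)).div_const _)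

lemma measurable_potential (xstar : Vec dx) (K q a η α : ℝ) :
    Measurable (p.potential xstar K q a η α) := by
  have h1 := hp.measurable_F.comp (measurable_state_x.comp
    (measurable_snd : Measurable (Prod.snd : State dx dy × State dx dy → _)))
  have h2 := hp.measurable_errZ
  have h3 := hp.measurable_errY.comp
    (measurable_snd : Measurable (Prod.snd : State dx dy × State dx dy → _))
  have h4 := hp.measurable_errS
  have h5 := hp.measurable_errH
  have h6 := measurable_incH (dx := dx) (dy := dy)
  have h7 := (measurable_incX (dx := dx) (dy := dy)).add measurable_incY
  exact ((((((h1.sub_const _).add (h2.const_mul _)).add (h3.const_mul _)).add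
    (h4.const_mul _)).add (h5.const_mul _)).add (h6.const_mul _)).add (h7.const_mul _)

variable {xstar : Vec dx} (hx : ∀ x, p.F xstar ≤ p.F x) {K : ℝ} (hK : 96 * M ^ 10 ≤ K)
include hK

omit hK in
lemma const_mul_pow_le {c : ℝ} {n : ℕ} (hc : c ≤ 96) (hn : n ≤ 10) :
    c * M ^ n ≤ 96 * M ^ 10 := by
  have := hp.one_le
  gcongr

lemma one_le_const : 1 ≤ K := by
  have := hp.const_mul_pow_le (c := 1) (n := 0) (by norm_num) (by norm_num)
  simp only [pow_zero] at this
  linarith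

include hx

/-- One iteration decreases the expected potential. -/
lemma potential_step (hI : I ≤ m) (hI1 : 1 ≤ I) (hB : 1 ≤ B) {τ : ℝ} {a : Params}
    (h : StepSizes M K (I / m) (τ * a.tauT) a.eta a.alpha) (hbar : a.alphaBar = a.alpha)
    (hβ : a.beta = a.alpha) {r : State dx dy × State dx dy} (hr : Admissible lam r) :
    ∫⁻ d : Draw m B Ξ Z, ENNReal.ofReal (p.potential xstar K (I / m) (τ * a.tauT) a.eta a.alpha
        (r.2, p.step I lam τ a d r.1 r.2)) ∂(p.drawLaw I B)
      + ENNReal.ofReal (a.eta * p.gain r) ≤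
    ENNReal.ofReal (p.potential xstar K (I / m) (τ * a.tauT) a.eta a.alpha r)
      + ENNReal.ofReal (16 * K ^ 4 * a.eta * a.alpha * noise m I B) := by
  have := hp.isProbabilityMeasure_drawLaw (B := B) hI
  have hM := hp.one_le
  have hM0 := hp.nonneg
  have hK1 := hp.one_le_const hK
  have hm : 0 < m := hI1.trans hI
  have hm1 : (1 : ℝ) ≤ m := by exact_mod_cast hm
  have hm0 : (0 : ℝ) < m := by linarith
  have hI0 : (0 : ℝ) < I := by exact_mod_cast hI1
  have hB0 : (0 : ℝ) < B := by exact_mod_cast hB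
  have h1 := p.errZ_nonneg r
  have h2 := p.errY_nonneg r.2
  have h3 := p.errS_nonneg r
  have h4 := p.errH_nonneg r
  have h5 := incH_nonneg r
  have h6 := incXY_nonneg r
  have hnn := p.potential_nonneg hx h hK1
  have hα := h.alpha_pos
  have hη := h.eta_pos
  have hq := h.q_pos
  have ha := h.a_pos
  have k8 := (hp.const_mul_pow_le (c := 8) (n := 3) (by norm_num) (by norm_num)).trans hK
  obtain ⟨iZ, eZ⟩ := hp.errZ_step (τ := τ) (a := a) hI hI1 hB (by rw [hβ]; exact hα.le)
    (by rw [hβ]; linarith [h.alpha_le]) hr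
  obtain ⟨iS, eS⟩ := hp.errS_step (τ := τ) (r := r) hI hI1 hB hα h.alpha_le
  obtain ⟨⟨iH, eH⟩, ⟨iD, eD⟩⟩ := hp.errH_step (τ := τ) (a := a) hI hI1 hB
    (by rw [hbar]; exact hα) (by rw [hbar]; exact h.alpha_le) hr
  rw [hβ] at eZ
  rw [hbar] at eH eD
  have hpath : ∀ d : Draw m B Ξ Z, _ := fun d =>
    h.pathwise hK1 hm1 h2 h3 h4 h6 (incX_nonneg (r.2, p.step I lam τ a d r.1 r.2))
      (incY_nonneg (r.2, p.step I lam τ a d r.1 r.2))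
      (F' := p.F (p.step I lam τ a d r.1 r.2).x - p.F xstar) (F := p.F r.2.x - p.F xstar)
      (G := ‖gradient p.F r.2.x‖ ^ 2) (Z' := p.errZ (r.2, p.step I lam τ a d r.1 r.2))
      (D' := p.errY (p.step I lam τ a d r.1 r.2))
      (c₁ := 72 * M ^ 10) (c₂ := 1 / (2 * M)) (c₃ := 12 * M ^ 3) (c₄ := 1 / (8 * M ^ 3))
      (c₅ := 3 * M ^ 5)
      ((hp.const_mul_pow_le (by norm_num) (by norm_num)).trans hK)
      (by
        have := (hp.const_mul_pow_le (c := 2) (n := 1) (by norm_num) (by norm_num)).trans hK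
        rw [pow_one] at this
        gcongr)
      ((hp.const_mul_pow_le (by norm_num) (by norm_num)).trans hK)
      (by gcongr)
      ((hp.const_mul_pow_le (by norm_num) (by norm_num)).trans hK)
      (by
        have := hp.objective_step (θ := p.step I lam τ a d r.1 r.2) hm hr hη h.eta_le rfl
        rw [incXY]
        linarith)
      (by
        refine (hp.lower_step (θ := p.step I lam τ a d r.1 r.2) ha
          (h.a_le.trans (by gcongr)) fun i => rfl).trans_eq ?_
        rw [incXY]
        ring)
  set base : ℝ := (p.F r.2.x - p.F xstar) - a.eta / 2 * ‖gradient p.F r.2.x‖ ^ 2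
    + K * (a.eta / m) * (p.errY r.2 + p.errH r + incXY r)
    + 2 * K ^ 2 * (a.eta / m) / (τ * a.tauT) * p.errY r.2 - 2 * K * (a.eta / m) * p.errY r.2
    + 2 * K ^ 3 * (a.eta / m) * (p.errS r + incXY r) with hbase
  set AZ := 2 * K * a.eta / a.alpha with hAZ
  set AS := 3 * K ^ 3 * (a.eta / m) / (a.alpha * (I / m)) with hAS
  set AH := 6 * K ^ 3 * (a.eta / m) / (a.alpha * (I / m)) with hAH
  set AD := 4 * K ^ 2 * (a.eta / m) / a.alpha with hAD
  -- An upper bound of the new potential that involves the draw only through the four estimator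
  -- errors and increments. Its integrability is known, so that of F at the next iterate is not
  -- needed.
  set U : Draw m B Ξ Z → ℝ := fun d => base
    + ((a.eta + AZ) * p.errZ (r.2, p.step I lam τ a d r.1 r.2)
    + AS * p.errS (r.2, p.step I lam τ a d r.1 r.2)
    + AH * p.errH (r.2, p.step I lam τ a d r.1 r.2)
    + AD * incH (r.2, p.step I lam τ a d r.1 r.2)) with hU
  have i3 := (iZ.const_mul (a.eta + AZ)).add (iS.const_mul AS)
  have i4 := i3.add (iH.const_mul AH)
  have i5 := i4.add (iD.const_mul AD)
  have iU : Integrable U (p.drawLaw I B) := (integrable_const base).add i5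
  have eU : ∫ d, U d ∂(p.drawLaw I B) = base
    + ((a.eta + AZ) * ∫ d, p.errZ (r.2, p.step I lam τ a d r.1 r.2) ∂(p.drawLaw I B)
    + AS * ∫ d, p.errS (r.2, p.step I lam τ a d r.1 r.2) ∂(p.drawLaw I B)
    + AH * ∫ d, p.errH (r.2, p.step I lam τ a d r.1 r.2) ∂(p.drawLaw I B)
    + AD * ∫ d, incH (r.2, p.step I lam τ a d r.1 r.2) ∂(p.drawLaw I B)) := by
    rw [hU]
    erw [integral_add (integrable_const base) i5, integral_add i4 (iD.const_mul AD),
      integral_add i3 (iH.const_mul AH), integral_add (iZ.const_mul _) (iS.const_mul AS)]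
    simp only [integral_const_mul, integral_const, probReal_univ, one_smul]
  have hle : ∀ d, p.potential xstar K (I / m) (τ * a.tauT) a.eta a.alpha
      (r.2, p.step I lam τ a d r.1 r.2) ≤ U d := fun d => by
    have := hpath d
    simp only [hU, hbase, Problem.potential]
    have e : incXY (r.2, p.step I lam τ a d r.1 r.2) = incX (r.2, p.step I lam τ a d r.1 r.2)
      + incY (r.2, p.step I lam τ a d r.1 r.2) := rfl
    rw [e]
    linarith
  have hbn : 1 / (B : ℝ) ≤ noise m I B := by
    unfold noise
    have : (0 : ℝ) ≤ (if I < m then 1 else 0) / (I : ℝ) := by positivity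
    linarith
  have hexp := h.expected hK1 hm1 (F := p.F r.2.x - p.F xstar) (G := ‖gradient p.F r.2.x‖ ^ 2)
    (b := 1 / (B : ℝ)) (ρ := noise m I B) h1 h2 h3 h4 h5 h6 (by positivity) hbn
    (Z' := ∫ d : Draw m B Ξ Z, p.errZ (r.2, p.step I lam τ a d r.1 r.2) ∂(p.drawLaw I B))
    (S' := ∫ d : Draw m B Ξ Z, p.errS (r.2, p.step I lam τ a d r.1 r.2) ∂(p.drawLaw I B))
    (H' := ∫ d : Draw m B Ξ Z, p.errH (r.2, p.step I lam τ a d r.1 r.2) ∂(p.drawLaw I B))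
    (Δ' := ∫ d : Draw m B Ξ Z, incH (r.2, p.step I lam τ a d r.1 r.2) ∂(p.drawLaw I B))
    (by
      refine eZ.trans ?_
      have c1 := (hp.const_mul_pow_le (c := 96) (n := 8) le_rfl (by norm_num)).trans hK
      have c2 := (hp.const_mul_pow_le (c := 64) (n := 6) (by norm_num) (by norm_num)).trans hK
      have := noise_nonneg m I B
      have e : incX r + incY r = incXY r := rfl
      rw [e]
      gcongr)
    (by
      refine eS.trans ?_
      have c1 := (hp.const_mul_pow_le (c := 13) (n := 3) (by norm_num) (by norm_num)).trans hK
      have c2 := (hp.const_mul_pow_le (c := 2) (n := 3) (by norm_num) (by norm_num)).trans hK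
      have e : incX r + incY r = incXY r := rfl
      rw [e, mul_one_div]
      gcongr)
    (by
      refine eH.trans ?_
      have c1 := (hp.const_mul_pow_le (c := 13) (n := 3) (by norm_num) (by norm_num)).trans hK
      have c2 := (hp.const_mul_pow_le (c := 2) (n := 3) (by norm_num) (by norm_num)).trans hK
      have e : incX r + incY r = incXY r := rfl
      rw [e, mul_one_div]
      gcongr)
    (by
      refine eD.trans ?_
      have c0 := (hp.const_mul_pow_le (c := 4) (n := 0) (by norm_num) (by norm_num)).trans hK
      have c1 := (hp.const_mul_pow_le (c := 9) (n := 3) (by norm_num) (by norm_num)).trans hK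
      have c2 := (hp.const_mul_pow_le (c := 2) (n := 3) (by norm_num) (by norm_num)).trans hK
      rw [pow_zero, mul_one] at c0
      have e : incX r + incY r = incXY r := rfl
      rw [e, mul_one_div]
      gcongr)
  have hfin : ∫ d, U d ∂(p.drawLaw I B) + a.eta * p.gain r ≤
      p.potential xstar K (I / m) (τ * a.tauT) a.eta a.alpha r
        + 16 * K ^ 4 * a.eta * a.alpha * noise m I B := by
    rw [eU, Problem.gain, Problem.potential]
    linarith
  have hU0 : 0 ≤ ∫ d, U d ∂(p.drawLaw I B) := integral_nonneg fun d => (hnn _).trans (hle d)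
  have hg := mul_nonneg hη.le (p.gain_nonneg r)
  have hn : 0 ≤ 16 * K ^ 4 * a.eta * a.alpha * noise m I B := by
    have := noise_nonneg m I B
    positivity
  calc _ ≤ ∫⁻ d, ENNReal.ofReal (U d) ∂(p.drawLaw I B) + ENNReal.ofReal (a.eta * p.gain r) := by
        gcongr with d
        exact hle d
    _ = ENNReal.ofReal (∫ d, U d ∂(p.drawLaw I B) + a.eta * p.gain r) := by
        rw [← ofReal_integral_eq_lintegral_ofReal iU
          (Filter.Eventually.of_forall fun d => (hnn _).trans (hle d)), ENNReal.ofReal_add hU0 hg]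
    _ ≤ _ := by
        rw [← ENNReal.ofReal_add (hnn r) hn]
        exact ENNReal.ofReal_le_ofReal hfin

omit hx in
/-- The potential at a restart is controlled by the gain at the end of the previous stage. -/
lemma potential_restart_le {q a η α μ : ℝ} (h : StepSizes M K q a η α) (hm : 1 ≤ m) (hμ : 0 < μ)
    {r : State dx dy × State dx dy} (hr : Admissible lam r)
    (hPL : μ * (p.F r.2.x - p.F xstar) ≤ ‖gradient p.F r.2.x‖ ^ 2) :
    p.potential xstar K q a η α (r.2, r.2) ≤
      η * (22 * K ^ 4 * (1 / (μ * η) + 1 / a + 1 / (α * q)) * p.gain r) := by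
  have hM := hp.one_le
  have hM0 := hp.nonneg
  have hK1 := hp.one_le_const hK
  have hK0 : 0 < K := by linarith
  have hm0 : (0 : ℝ) < m := by exact_mod_cast hm
  have h1 := p.errZ_nonneg r
  have h2 := p.errY_nonneg r.2
  have h3 := p.errS_nonneg r
  have h4 := p.errH_nonneg r
  have h5 := incH_nonneg r
  have h6 := incXY_nonneg r
  obtain ⟨hq, hq1, ha, ha1, hη, hη1, hα, hα1, hlow, hup⟩ := h
  have c18 := (hp.const_mul_pow_le (c := 18) (n := 8) (by norm_num) (by norm_num)).trans hK
  have c2 := (hp.const_mul_pow_le (c := 1) (n := 2) (by norm_num) (by norm_num)).trans hK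
  have c3 := (hp.const_mul_pow_le (c := 1) (n := 3) (by norm_num) (by norm_num)).trans hK
  rw [one_mul] at c2 c3
  -- A restart replaces the previous state by the current one, so the errors of `z`, `s`, `H` are
  -- measured at a new reference point. The change is bounded by the last increments, which are part
  -- of the gain.
  have bZ : p.errZ (r.2, r.2) ≤ 2 * p.errZ r + 2 * (K / m * (incXY r + incH r)) := by
    have e1 := hp.gradMean_sub_le hr
    rw [norm_sub_rev] at e1
    have e2 : 18 * M ^ 8 / m * (incX r + incY r + incH r) ≤ K / m * (incXY r + incH r) := by
      rw [incXY] at h6 ⊢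
      gcongr
    have e3 : ‖r.2.z - p.gradMean r.2‖ ^ 2 ≤
        2 * (‖r.2.z - p.gradMean r.1‖ ^ 2 + ‖p.gradMean r.1 - p.gradMean r.2‖ ^ 2) := by
      rw [← sub_add_sub_cancel r.2.z (p.gradMean r.1) (p.gradMean r.2)]
      refine le_trans ?_ add_sq_le
      gcongr
      exact norm_add_le _ _
    simp only [Problem.errZ]
    linarith
  have sumle : ∀ f : Fin m → ℝ, (∀ i, f i ≤ M ^ 2 * (‖r.2.x - r.1.x‖ ^ 2 + ‖r.2.y i - r.1.y i‖ ^ 2))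
      → ∑ i, f i ≤ M ^ 2 * incXY r := fun f hf => by
    rw [incXY, incX_add_incY, Finset.mul_sum]
    exact Finset.sum_le_sum fun i _ => hf i
  have bS : p.errS (r.2, r.2) ≤ 2 * p.errS r + 2 * (K * incXY r) := by
    have e1 := sumle (fun i => ‖gradY (p.gE i) r.2.x (r.2.y i) - gradY (p.gE i) r.1.x (r.1.y i)‖ ^ 2)
      fun i => (hp.mean_lip_gy i).sq_le _ _ _ _
    have e2 : M ^ 2 * incXY r ≤ K * incXY r := by gcongr
    have e3 : p.errS (r.2, r.2) ≤ 2 * p.errS r + 2 *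
        ∑ i, ‖gradY (p.gE i) r.2.x (r.2.y i) - gradY (p.gE i) r.1.x (r.1.y i)‖ ^ 2 := by
      simp only [Problem.errS]
      rw [← mul_add, ← Finset.sum_add_distrib, Finset.mul_sum]
      refine Finset.sum_le_sum fun i _ => ?_
      rw [← sub_add_sub_cancel (r.2.s i) (gradY (p.gE i) r.1.x (r.1.y i))
        (gradY (p.gE i) r.2.x (r.2.y i)), norm_sub_rev (gradY (p.gE i) r.2.x (r.2.y i))]
      refine le_trans ?_ add_sq_le
      gcongr
      exact norm_add_le _ _
    linarith
  have bH : p.errH (r.2, r.2) ≤ 2 * p.errH r + 2 * (K * incXY r) := by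
    have e1 := sumle (fun i => ‖hessYY (p.gE i) r.2.x (r.2.y i) - hessYY (p.gE i) r.1.x (r.1.y i)‖ ^ 2)
      fun i => hp.hess_track_le i r
    have e2 : M ^ 3 * incXY r ≤ K * incXY r := by gcongr
    have e3 : p.errH (r.2, r.2) ≤ 2 * p.errH r + 2 * (M *
        ∑ i, ‖hessYY (p.gE i) r.2.x (r.2.y i) - hessYY (p.gE i) r.1.x (r.1.y i)‖ ^ 2) := by
      simp only [Problem.errH]
      rw [← mul_add, Finset.mul_sum Finset.univ _ M, ← Finset.sum_add_distrib, Finset.mul_sum]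
      refine Finset.sum_le_sum fun i _ => ?_
      have e4 : frobSq (r.2.H i - hessYY (p.gE i) r.2.x (r.2.y i)) ≤
          2 * (frobSq (r.2.H i - hessYY (p.gE i) r.1.x (r.1.y i)) +
          frobSq (hessYY (p.gE i) r.1.x (r.1.y i) - hessYY (p.gE i) r.2.x (r.2.y i))) := by
        rw [← sub_add_sub_cancel (r.2.H i) (hessYY (p.gE i) r.1.x (r.1.y i))
          (hessYY (p.gE i) r.2.x (r.2.y i)), ← norm_cols_sq, ← norm_cols_sq, ← norm_cols_sq, map_add]
        refine le_trans ?_ add_sq_le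
        gcongr
        exact norm_add_le _ _
      have e5 := (frobSq_le (hessYY (p.gE i) r.1.x (r.1.y i) - hessYY (p.gE i) r.2.x (r.2.y i))).trans
        (mul_le_mul_of_nonneg_right (hp.dim_le i) (by positivity))
      rw [norm_sub_rev] at e5
      linarith
    have e6 := mul_le_mul_of_nonneg_left e1 hM0
    have e7 : M * (M ^ 2 * incXY r) = M ^ 3 * incXY r := by ring
    linarith
  -- A stage starts with two equal states, so all increments vanish.
  have bX : incXY (r.2, r.2) = 0 := by simp [incXY, incX, incY]
  have bD : incH (r.2, r.2) = 0 := by simp [incH]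
  set V := p.gain r with hV
  have hVe : V = ‖gradient p.F r.2.x‖ ^ 2 / 2 + p.errZ r
    + (p.errY r.2 + p.errS r + p.errH r + incH r + incXY r) / m := rfl
  have d0 : 0 ≤ (p.errY r.2 + p.errS r + p.errH r + incH r + incXY r) / m := by positivity
  have g0 : (0 : ℝ) ≤ ‖gradient p.F r.2.x‖ ^ 2 := by positivity
  have hV0 : 0 ≤ V := p.gain_nonneg r
  have v1 : p.F r.2.x - p.F xstar ≤ 2 / μ * V := by
    rw [div_mul_eq_mul_div, le_div_iff₀ hμ]
    linarith
  have hle : ∀ t : ℝ, t ≤ p.errY r.2 + p.errS r + p.errH r + incH r + incXY r → t / m ≤ V :=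
    fun t ht => by
      have : t / m ≤ (p.errY r.2 + p.errS r + p.errH r + incH r + incXY r) / m := by gcongr
      linarith
  have v2 : p.errZ (r.2, r.2) ≤ 2 * K * V := by
    have e1 : K / m * (incXY r + incH r) = K * ((incXY r + incH r) / m) := by ring
    have e2 : p.errZ r + (incXY r + incH r) / m ≤ V := by
      have : (incXY r + incH r) / m ≤
        (p.errY r.2 + p.errS r + p.errH r + incH r + incXY r) / m :=
          div_le_div_of_nonneg_right (by linarith) hm0.le
      linarith
    have e3 := mul_le_mul_of_nonneg_left e2 hK0.le
    have e4 : p.errZ r ≤ K * p.errZ r := le_mul_of_one_le_left h1 hK1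
    linarith
  have v3 : p.errY r.2 ≤ m * V := by
    have := hle (p.errY r.2) (by linarith)
    rw [div_le_iff₀ hm0] at this
    linarith
  have vSH : ∀ t : ℝ, 0 ≤ t → t + incXY r ≤ p.errY r.2 + p.errS r + p.errH r + incH r + incXY r →
      2 * t + 2 * (K * incXY r) ≤ 2 * K * (m * V) := fun t ht htle => by
    have := hle _ htle
    rw [div_le_iff₀ hm0] at this
    have e3 := mul_le_mul_of_nonneg_left this hK0.le
    have e4 : t ≤ K * t := le_mul_of_one_le_left ht hK1
    linarith
  have v4 : p.errS (r.2, r.2) ≤ 2 * K * (m * V) := bS.trans (vSH _ h3 (by linarith))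
  have v5 : p.errH (r.2, r.2) ≤ 2 * K * (m * V) := bH.trans (vSH _ h4 (by linarith))
  rw [Problem.potential, bX, bD]
  simp only [mul_zero, add_zero]
  have k24 : K ^ 2 ≤ K ^ 4 := pow_le_pow_right₀ hK1 (by norm_num)
  have k4 : 1 ≤ K ^ 4 := one_le_pow₀ hK1
  have w1 : 1 / α ≤ 1 / (α * q) := by
    gcongr
    exact mul_le_of_le_one_right hα.le hq1
  calc _ ≤ 2 / μ * V + 2 * K * η / α * (2 * K * V) + 2 * K ^ 2 * (η / m) / a * (m * V)
        + 3 * K ^ 3 * (η / m) / (α * q) * (2 * K * (m * V))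
        + 6 * K ^ 3 * (η / m) / (α * q) * (2 * K * (m * V)) := by gcongr
    _ = η * V * (2 * (1 / (μ * η)) + 4 * K ^ 2 * (1 / α) + 2 * K ^ 2 * (1 / a)
        + 18 * K ^ 4 * (1 / (α * q))) := by field_simp; ring
    _ ≤ η * V * (22 * K ^ 4 * (1 / (μ * η)) + 4 * K ^ 4 * (1 / (α * q)) + 22 * K ^ 4 * (1 / a)
        + 18 * K ^ 4 * (1 / (α * q))) := by
          gcongr <;> linarith
    _ = _ := by ring

omit hx in
/-- The potential at the start of the first stage. -/
lemma potential_init_le {q a η α D0 : ℝ} (h : StepSizes M K q a η α)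
    {θ : State dx dy} (hθ : p.InitBound lam xstar θ D0) :
    p.potential xstar K q a η α (θ, θ) ≤
      D0 * (1 + 2 * K * η / α + 2 * K ^ 2 * (η / m) / a + 3 * K ^ 3 * (η / m) / (α * q)
        + 6 * K ^ 3 * (η / m) / (α * q) * K) := by
  have hM0 := hp.nonneg
  have hK1 := hp.one_le_const hK
  obtain ⟨hq, hq1, ha, ha1, hη, hη1, hα, hα1, hlow, hup⟩ := h
  have bX : incXY (θ, θ) = 0 := by simp [incXY, incX, incY]
  have bD : incH (θ, θ) = 0 := by simp [incH]
  have bH : p.errH (θ, θ) ≤ K * D0 := by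
    have c1 := (hp.const_mul_pow_le (c := 1) (n := 1) (by norm_num) (by norm_num)).trans hK
    rw [one_mul, pow_one] at c1
    calc _ ≤ ∑ i, M * ‖θ.H i - hessYY (p.gE i) θ.x (θ.y i)‖ ^ 2 :=
          Finset.sum_le_sum fun i _ => (frobSq_le _).trans
            (mul_le_mul_of_nonneg_right (hp.dim_le i) (by positivity))
      _ ≤ _ := by
          rw [← Finset.mul_sum]
          have := hθ.err_H
          gcongr
  rw [Problem.potential, bX, bD]
  have h1 : p.errZ (θ, θ) ≤ D0 := hθ.err_z
  have h2 : p.errY θ ≤ D0 := hθ.err_y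
  have h3 : p.errS (θ, θ) ≤ D0 := hθ.err_s
  simp only [mul_zero, add_zero]
  calc _ ≤ D0 + 2 * K * η / α * D0 + 2 * K ^ 2 * (η / m) / a * D0
        + 3 * K ^ 3 * (η / m) / (α * q) * D0 + 6 * K ^ 3 * (η / m) / (α * q) * (K * D0) := by
          have := hθ.gap
          gcongr
    _ = _ := by ring

end Problem.Bounds

end BSVRB

namespace BSVRB

open scoped RealInnerProductSpace ENNReal

/-! ### Independence -/

section

variable {Ω : Type w} {A₁ A₂ A₃ : Type*} {mΩ : MeasurableSpace Ω} [MeasurableSpace A₁]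
  [MeasurableSpace A₂] [MeasurableSpace A₃] {Pr : Measure Ω} [IsProbabilityMeasure Pr]

/-- The joint law of ((X, Y), W) is a triple product, and reassociating it separates X from (Y, W).
-/
lemma indepFun_prodMk_of_indepFun {X : Ω → A₁} {Y : Ω → A₂} {W : Ω → A₃} (hX : Measurable X)
    (hY : Measurable Y) (hW : Measurable W) (h1 : IndepFun X Y Pr)
    (h2 : IndepFun (fun ω => (X ω, Y ω)) W Pr) : IndepFun X (fun ω => (Y ω, W ω)) Pr := by
  have := Measure.isProbabilityMeasure_map (μ := Pr) hX.aemeasurable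
  have := Measure.isProbabilityMeasure_map (μ := Pr) hY.aemeasurable
  have := Measure.isProbabilityMeasure_map (μ := Pr) hW.aemeasurable
  have h3 : IndepFun Y W Pr := h2.comp measurable_snd measurable_id
  rw [indepFun_iff_map_prod_eq_prod_map_map hX.aemeasurable hY.aemeasurable] at h1
  rw [indepFun_iff_map_prod_eq_prod_map_map (hX.prodMk hY).aemeasurable hW.aemeasurable] at h2
  rw [indepFun_iff_map_prod_eq_prod_map_map hY.aemeasurable hW.aemeasurable] at h3
  rw [indepFun_iff_map_prod_eq_prod_map_map hX.aemeasurable (hY.prodMk hW).aemeasurable, h3]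
  have e : Pr.map (fun ω => (X ω, (Y ω, W ω))) =
      (Pr.map fun ω => ((X ω, Y ω), W ω)).map MeasurableEquiv.prodAssoc := by
    rw [Measure.map_map MeasurableEquiv.prodAssoc.measurable ((hX.prodMk hY).prodMk hW)]
    rfl
  rw [e, h2, h1]
  exact (measurePreserving_prodAssoc _ _ _).map_eq

/-- Conditioning in the form of Tonelli's theorem: Y is frozen while X is integrated over its law.
With values in [0, ∞] no integrability is required. -/
lemma lintegral_of_indepFun {X : Ω → A₁} {Y : Ω → A₂} (hX : Measurable X) (hY : Measurable Y)
    (h : IndepFun X Y Pr) {g : A₁ → A₂ → ℝ≥0∞} (hg : Measurable (Function.uncurry g)) :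
    ∫⁻ ω, g (X ω) (Y ω) ∂Pr = ∫⁻ ω, ∫⁻ x, g x (Y ω) ∂(Pr.map X) ∂Pr := by
  have := Measure.isProbabilityMeasure_map (μ := Pr) hX.aemeasurable
  have := Measure.isProbabilityMeasure_map (μ := Pr) hY.aemeasurable
  rw [indepFun_iff_map_prod_eq_prod_map_map hX.aemeasurable hY.aemeasurable] at h
  have e1 : ∫⁻ ω, g (X ω) (Y ω) ∂Pr =
      ∫⁻ z, Function.uncurry g z ∂(Pr.map fun ω => (X ω, Y ω)) := by
    rw [lintegral_map hg (hX.prodMk hY)]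
    rfl
  rw [e1, h, lintegral_prod_symm _ hg.aemeasurable, lintegral_map _ hY]
  · rfl
  · exact hg.lintegral_prod_left'

lemma lintegral_uniformOn_Icc {n : ℕ} (hn : 1 ≤ n) (f : ℕ → ℝ≥0∞) :
    n * ∫⁻ t, f t ∂(uniformOn (Set.Icc 1 n)) = ∑ t ∈ Finset.range n, f (t + 1) := by
  have h1 : ∑ t ∈ Finset.range n, f (t + 1) = ∑ t ∈ Finset.Icc 1 n, f t := by
    rw [Finset.range_eq_Ico, Finset.sum_Ico_add' f 0 n 1]
    congr 1
  rw [h1, uniformOn, ProbabilityTheory.cond, lintegral_smul_measure, ← Finset.coe_Icc,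
    lintegral_finset, Measure.count_apply_finset]
  simp only [Nat.card_Icc, add_tsub_cancel_right, Measure.count_singleton, mul_one, smul_eq_mul]
  rw [← mul_assoc, ENNReal.mul_inv_cancel (by simp; omega) (by simp), one_mul]

end

variable {m dx : ℕ} {dy : Fin m → ℕ} {Ξ : Type u} {Z : Type v}
  [MeasurableSpace Ξ] [MeasurableSpace Z]

/-! ### Measurability of the iterates -/

namespace Problem.Bounds

variable {p : Problem m dx dy Ξ Z} {lam M : ℝ} (hp : p.Bounds lam M) {I B : ℕ}
  {S : Type*} {mS : MeasurableSpace S}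
include hp

/-- The σ-algebra of the domain is arbitrary, and only the draws up to `n` must be measurable; later
this is applied to the σ-algebra generated by the past. -/
lemma measurable_iter (τ : ℝ) (a : Params) {d : ℕ → S → Draw m B Ξ Z} {θ : S → State dx dy}
    (hθ : Measurable θ) (n : ℕ) (hd : ∀ t ≤ n, Measurable (d t)) :
    Measurable fun s => p.iter I lam τ a (fun t => d t s) (θ s) n := by
  induction n with
  | zero => exact hθ.prodMk hθ
  | succ n ih =>
    have h := ih fun t ht => hd t (by omega)
    exact h.snd.prodMk (hp.measurable_step (hd (n + 1) le_rfl) h.snd h.fst τ a)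

lemma measurable_restarted (τ : ℝ) (a : ℕ → Params) {d : ℕ → ℕ → S → Draw m B Ξ Z}
    {tt : ℕ → S → ℕ} (htt : ∀ j, Measurable (tt j)) (θ : State dx dy) (k : ℕ)
    (hd : ∀ j ≤ k, ∀ t, Measurable (d j t)) :
    Measurable fun s => p.restarted I lam τ a (fun j t => d j t s) (fun j => tt j s) θ k := by
  induction k with
  | zero => exact measurable_const
  | succ k ih =>
    have h := ih fun j hj => hd j (by omega)
    have h2 : Measurable fun q : ℕ × S => (p.iter I lam τ (a (k + 1)) (fun t => d (k + 1) t q.2)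
        (p.restarted I lam τ a (fun j t => d j t q.2) (fun j => tt j q.2) θ k) (q.1 - 1)).2 :=
      measurable_from_prod_countable_right fun n =>
        (hp.measurable_iter τ (a (k + 1)) h (n - 1) fun t _ => hd (k + 1) le_rfl t).snd
    exact h2.comp ((htt (k + 1)).prodMk measurable_id)

omit hp in
-- Only the indices of the stages up to k matter; the later ones may be replaced by 0 without
-- changing the state.
lemma measurable_restarted_index (hp : p.Bounds lam M) (τ : ℝ) (a : ℕ → Params)
    {d : ℕ → ℕ → S → Draw m B Ξ Z} (hd : ∀ j t, Measurable (d j t)) {tt : ℕ → S → ℕ}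
    (θ : State dx dy) (k : ℕ) (htt : ∀ j ≤ k, Measurable (tt j)) :
    Measurable fun s => p.restarted I lam τ a (fun j t => d j t s) (fun j => tt j s) θ k := by
  have e : ∀ k' ≤ k, ∀ s,
      p.restarted I lam τ a (fun j t => d j t s) (fun j => tt j s) θ k' =
      p.restarted I lam τ a (fun j t => d j t s) (fun j => if j ≤ k then tt j s else 0) θ k' := by
    intro k' hk' s
    induction k' with
    | zero => rfl
    | succ k' ih => simp only [Problem.restarted, ih (by omega), hk', if_true]
  rw [funext (e k le_rfl)]
  refine hp.measurable_restarted τ a (tt := fun j s => if j ≤ k then tt j s else 0) (fun j => ?_)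
    θ k fun j _ t => hd j t
  by_cases hj : j ≤ k
  · simpa only [hj, if_true] using htt j hj
  · simp only [hj, if_false]
    exact measurable_const

end Problem.Bounds

/-! ### The trajectory of one stage -/

/-- The iterates of stage `k + 1`. -/
noncomputable def Problem.traj (p : Problem m dx dy Ξ Z) (I : ℕ) {B : ℕ} (lam τ : ℝ)
    (a : ℕ → Params) {Ω : Type w} (d : ℕ → ℕ → Ω → Draw m B Ξ Z) (tt : ℕ → Ω → ℕ)
    (θ : State dx dy) (k n : ℕ) (ω : Ω) : State dx dy × State dx dy :=
  p.iter I lam τ (a (k + 1)) (fun t => d (k + 1) t ω)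
    (p.restarted I lam τ a (fun k t => d k t ω) (fun k => tt k ω) θ k) n

namespace Problem.IsSampling

variable {p : Problem m dx dy Ξ Z} {I B : ℕ} {T : ℕ → ℕ} {Ω : Type w} [MeasurableSpace Ω]
  {Pr : Measure Ω} [IsProbabilityMeasure Pr] {d : ℕ → ℕ → Ω → Draw m B Ξ Z} {tt : ℕ → Ω → ℕ}
  (hs : p.IsSampling I B T Pr d tt)
include hs

lemma indepFun_draw {q : ℕ × ℕ} {A : Set (ℕ × ℕ)} (hq : q ∉ A) :
    IndepFun (d q.1 q.2) (fun ω => ((fun s : A => d s.1.1 s.1.2 ω), fun k => tt k ω)) Pr := by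
  have hm : Measurable fun ω (s : A) => d s.1.1 s.1.2 ω :=
    measurable_pi_lambda _ fun s => hs.measurable_draw _ _
  have ht : Measurable fun ω k => tt k ω := measurable_pi_lambda _ hs.measurable_index
  refine indepFun_prodMk_of_indepFun (hs.measurable_draw _ _) hm ht ?_ ?_
  · have h := indep_iSup_of_disjoint (fun q => (hs.measurable_draw q.1 q.2).comap_le)
      ((iIndepFun_iff_iIndep _ _ _).1 hs.indep_draw) (Set.disjoint_singleton_left.2 hq)
    rw [IndepFun_iff_Indep]
    refine indep_of_indep_of_le h ?_ ?_
    · exact le_iSup₂_of_le q (Set.mem_singleton q) le_rfl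
    · set 𝓕 : MeasurableSpace Ω := ⨆ i ∈ A, MeasurableSpace.comap (d i.1 i.2) inferInstance
      have hF : Measurable[𝓕] fun ω (s : A) => d s.1.1 s.1.2 ω := measurable_pi_lambda _ fun s =>
        (comap_measurable (d s.1.1 s.1.2)).mono
          (le_iSup₂_of_le (f := fun (i : ℕ × ℕ) (_ : i ∈ A) =>
            MeasurableSpace.comap (d i.1 i.2) inferInstance) s.1 s.2 le_rfl) le_rfl
      exact hF.comap_le
  · exact hs.indep_draw_index.comp (φ := fun D : ℕ × ℕ → Draw m B Ξ Z => (D q, fun s : A => D s.1))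
      (by fun_prop) measurable_id

lemma indepFun_index (k : ℕ) :
    IndepFun (tt k) (fun ω => ((fun s : {j | j ≠ k} => tt s.1 ω),
      fun q : ℕ × ℕ => d q.1 q.2 ω)) Pr := by
  have hm : Measurable fun ω (s : {j | j ≠ k}) => tt s.1 ω :=
    measurable_pi_lambda _ fun s => hs.measurable_index _
  have ht : Measurable fun ω (q : ℕ × ℕ) => d q.1 q.2 ω :=
    measurable_pi_lambda _ fun q => hs.measurable_draw _ _
  refine indepFun_prodMk_of_indepFun (hs.measurable_index _) hm ht ?_ ?_
  · have h := indep_iSup_of_disjoint (fun k => (hs.measurable_index k).comap_le)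
      ((iIndepFun_iff_iIndep _ _ _).1 hs.indep_index)
      (Set.disjoint_singleton_left.2 (show k ∉ {j | j ≠ k} by simp))
    rw [IndepFun_iff_Indep]
    refine indep_of_indep_of_le h ?_ ?_
    · exact le_iSup₂_of_le k (Set.mem_singleton k) le_rfl
    · set 𝓕 : MeasurableSpace Ω := ⨆ i ∈ {j | j ≠ k}, MeasurableSpace.comap (tt i) inferInstance
      have hF : Measurable[𝓕] fun ω (s : {j | j ≠ k}) => tt s.1 ω := measurable_pi_lambda _ fun s =>
        (comap_measurable (tt s.1)).mono
          (le_iSup₂_of_le (f := fun (i : ℕ) (_ : i ∈ {j | j ≠ k}) =>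
            MeasurableSpace.comap (tt i) inferInstance) s.1 s.2 le_rfl) le_rfl
      exact hF.comap_le
  · exact hs.indep_draw_index.symm.comp
      (φ := fun D : ℕ → ℕ => (D k, fun s : {j | j ≠ k} => D s.1)) (by fun_prop) measurable_id

variable {lam M : ℝ} (hp : p.Bounds lam M) (τ : ℝ) (a : ℕ → Params) (θ : State dx dy)
include hp

omit [IsProbabilityMeasure Pr] in
lemma measurable_traj (k n : ℕ) : Measurable (p.traj I lam τ a d tt θ k n) :=
  hp.measurable_iter τ (a (k + 1))
    (hp.measurable_restarted τ a hs.measurable_index θ k fun j _ t => hs.measurable_draw j t) n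
    fun t _ => hs.measurable_draw _ t

lemma indepFun_draw_traj (k n : ℕ) :
    IndepFun (d (k + 1) (n + 1)) (p.traj I lam τ a d tt θ k n) Pr := by
  -- Contains all draws of the earlier stages and the first n of the present one, which together
  -- with the output indices determine the trajectory, but not the next draw (k + 1, n + 1).
  set A : Set (ℕ × ℕ) := {q | q.1 ≤ k ∨ q.2 ≤ n} with hA
  have h := hs.indepFun_draw (q := (k + 1, n + 1)) (A := A) (by simp [hA])
  rw [IndepFun_iff_Indep] at h ⊢
  refine indep_of_indep_of_le_right h ?_
  set 𝓕 : MeasurableSpace Ω :=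
    MeasurableSpace.comap (fun ω => ((fun s : A => d s.1.1 s.1.2 ω), fun k => tt k ω)) inferInstance
  have h0 : Measurable[𝓕] fun ω => ((fun s : A => d s.1.1 s.1.2 ω), fun k => tt k ω) :=
    comap_measurable _
  have hd : ∀ j t, (j ≤ k ∨ t ≤ n) → Measurable[𝓕] (d j t) := fun j t hjt =>
    (measurable_pi_apply (⟨(j, t), hjt⟩ : A)).comp (measurable_fst.comp h0)
  have ht : ∀ j, Measurable[𝓕] (tt j) := fun j =>
    (measurable_pi_apply j).comp (measurable_snd.comp h0)
  have hm : Measurable[𝓕] (p.traj I lam τ a d tt θ k n) :=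
    hp.measurable_iter τ (a (k + 1)) (hp.measurable_restarted τ a ht θ k fun j hj t =>
      hd j t (Or.inl hj)) n fun t ht => hd _ t (Or.inr ht)
  exact hm.comap_le

/-- The whole trajectory of stage k + 1 is a function of the draws and of the earlier output
indices, all of which are independent of the output index of this stage. -/
lemma indepFun_index_traj (k : ℕ) :
    IndepFun (tt (k + 1)) (fun ω n => p.traj I lam τ a d tt θ k n ω) Pr := by
  have h := hs.indepFun_index (k + 1)
  rw [IndepFun_iff_Indep] at h ⊢
  refine indep_of_indep_of_le_right h ?_
  set 𝓕 : MeasurableSpace Ω := MeasurableSpace.comap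
    (fun ω => ((fun s : {j | j ≠ k + 1} => tt s.1 ω), fun q : ℕ × ℕ => d q.1 q.2 ω)) inferInstance
  have h0 : Measurable[𝓕] fun ω =>
    ((fun s : {j | j ≠ k + 1} => tt s.1 ω), fun q : ℕ × ℕ => d q.1 q.2 ω) := comap_measurable _
  have hd : ∀ j t, Measurable[𝓕] (d j t) := fun j t =>
    (measurable_pi_apply (j, t)).comp (measurable_snd.comp h0)
  have ht : ∀ j ≤ k, Measurable[𝓕] (tt j) := fun j hj =>
    (measurable_pi_apply (⟨j, by simp; omega⟩ : {j | j ≠ k + 1})).comp (measurable_fst.comp h0)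
  have hm : Measurable[𝓕] (fun ω n => p.traj I lam τ a d tt θ k n ω) :=
    measurable_pi_lambda _ fun n => hp.measurable_iter τ (a (k + 1))
      (hp.measurable_restarted_index τ a hd θ k ht) n fun t _ => hd _ t
  exact hm.comap_le

/-- The output index averages over the iterates of the stage. -/
lemma lintegral_output {k : ℕ} (hT : 1 ≤ T (k + 1)) {g : State dx dy × State dx dy → ℝ≥0∞}
    (hg : Measurable g) :
    T (k + 1) * ∫⁻ ω, g (p.traj I lam τ a d tt θ k (tt (k + 1) ω - 1) ω) ∂Pr =
      ∑ n ∈ Finset.range (T (k + 1)), ∫⁻ ω, g (p.traj I lam τ a d tt θ k n ω) ∂Pr := by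
  have hR := fun n => hs.measurable_traj hp τ a θ k n
  have h1 := lintegral_of_indepFun (hs.measurable_index (k + 1))
    (measurable_pi_lambda (fun ω n => p.traj I lam τ a d tt θ k n ω) hR)
    (hs.indepFun_index_traj hp τ a θ k)
    (g := fun t (r : ℕ → State dx dy × State dx dy) => g (r (t - 1)))
    (measurable_from_prod_countable_right fun t => hg.comp (measurable_pi_apply (t - 1)))
  simp only at h1
  have h2 := lintegral_finsetSum (μ := Pr) (Finset.range (T (k + 1)))
    (f := fun n ω => g (p.traj I lam τ a d tt θ k n ω)) fun n _ => hg.comp (hR n)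
  rw [h1, hs.law_index (k + 1) (by omega), ← h2, ← lintegral_const_mul']
  · simp_rw [lintegral_uniformOn_Icc hT, Nat.add_sub_cancel]
  · simp

/-- The expectation over the next draw, given the past. -/
lemma lintegral_next (k n : ℕ) {g : State dx dy × State dx dy → ℝ≥0∞} (hg : Measurable g) :
    ∫⁻ ω, g (p.traj I lam τ a d tt θ k (n + 1) ω) ∂Pr =
      ∫⁻ ω, ∫⁻ D : Draw m B Ξ Z, g ((p.traj I lam τ a d tt θ k n ω).2,
        p.step I lam τ (a (k + 1)) D (p.traj I lam τ a d tt θ k n ω).1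
          (p.traj I lam τ a d tt θ k n ω).2) ∂(p.drawLaw I B) ∂Pr := by
  have h1 := lintegral_of_indepFun (hs.measurable_draw (k + 1) (n + 1))
    (hs.measurable_traj hp τ a θ k n) (hs.indepFun_draw_traj hp τ a θ k n)
    (g := fun D r => g (r.2, p.step I lam τ (a (k + 1)) D r.1 r.2))
    (hg.comp (measurable_snd.snd.prodMk
      (hp.measurable_step measurable_fst measurable_snd.snd measurable_snd.fst τ (a (k + 1)))))
  rw [hs.law_draw] at h1
  exact h1

end Problem.IsSampling

end BSVRB

namespace BSVRB

open scoped RealInnerProductSpace ENNReal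

variable {m dx : ℕ} {dy : Fin m → ℕ} {Ξ : Type u} {Z : Type v}
  [MeasurableSpace Ξ] [MeasurableSpace Z]

lemma noise_pos {m I B : ℕ} (hB : 1 ≤ B) : 0 < noise m I B := by
  unfold noise
  positivity

/-! ### Step sizes -/

lemma tauStage_pos {m I : ℕ} (hI1 : 1 ≤ I) (hI : I ≤ m) {C8 α : ℝ} (hC8 : 0 < C8) (hα : 0 < α) :
    0 < tauStage m I C8 α := by
  have hI0 : (0 : ℝ) < I := by exact_mod_cast hI1
  have hm0 : (0 : ℝ) < m := by exact_mod_cast hI1.trans hI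
  unfold tauStage
  positivity

lemma etaStage_pos {m I : ℕ} (hI1 : 1 ≤ I) (hI : I ≤ m) {LF C8 C9 α : ℝ} (hLF : 0 < LF)
    (hC8 : 0 < C8) (hC9 : 0 < C9) (hα : 0 < α) (k : ℕ) : 0 < etaStage m I LF C8 C9 α k := by
  have hI0 : (0 : ℝ) < I := by exact_mod_cast hI1
  have hm0 : (0 : ℝ) < m := by exact_mod_cast hI1.trans hI
  have ht := tauStage_pos hI1 hI hC8 hα
  unfold etaStage
  split_ifs
  · exact lt_min (by positivity) (by positivity)
  · exact mul_pos (by positivity) (Real.sqrt_pos.2 (lt_min (by positivity) (by positivity)))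

lemma etaStage_sq_le {m I : ℕ} {LF C8 C9 α : ℝ} (hLF : 0 < LF) (hC9 : 0 < C9) (hα : 0 < α)
    (k : ℕ) : etaStage m I LF C8 C9 α k ^ 2 ≤ C9 * (α * ((I : ℝ) / m) ^ 2) := by
  unfold etaStage
  split_ifs
  · calc _ ≤ Real.sqrt (C9 * (I : ℝ) ^ 2 * α / (m : ℝ) ^ 2) ^ 2 := by
          have : 0 ≤ min (1 / (2 * LF)) (Real.sqrt (C9 * (I : ℝ) ^ 2 * α / (m : ℝ) ^ 2)) :=
            le_min (by positivity) (Real.sqrt_nonneg _)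
          gcongr
          exact min_le_right _ _
      _ = _ := by rw [Real.sq_sqrt (by positivity)]; ring
  · rw [mul_pow, Real.sq_sqrt hC9.le, Real.sq_sqrt (le_min (by positivity) (by positivity))]
    gcongr
    exact (min_le_right _ _).trans_eq (by ring)

/-- The constant C₈ makes `lower_le` an equality, a² = αq²/(10K³), and cancels τ. Then C₉ =
1/(160K⁶) turns η² ≤ C₉αq² into `upper_le`. For every stage only the bound of η by the term in αq²
is used. -/
lemma stepSizes_stage {m I : ℕ} (hI1 : 1 ≤ I) (hI : I ≤ m) {M K τ α : ℝ} (hM : 1 ≤ M)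
    (hK : 9 * M ^ 7 ≤ K) (hK1 : 1 ≤ K) (hτ : 0 < τ) (hα : 0 < α) (hα' : α ≤ 1 / 2) (k : ℕ) :
    StepSizes M K (I / m) (τ * tauStage m I (1 / (10 * K ^ 3 * τ ^ 2)) α)
      (etaStage m I (9 * M ^ 7) (1 / (10 * K ^ 3 * τ ^ 2)) (1 / (160 * K ^ 6)) α k) α := by
  have hI0 : (0 : ℝ) < I := by exact_mod_cast hI1
  have hm0 : (0 : ℝ) < m := by exact_mod_cast hI1.trans hI
  have hK0 : 0 < K := by linarith
  have hM0 : 0 < M := by linarith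
  have hIm : (I : ℝ) / m ≤ 1 := by
    rw [div_le_one hm0]
    exact_mod_cast hI
  have hLF : 0 < 9 * M ^ 7 := by positivity
  have hC8 : 0 < 1 / (10 * K ^ 3 * τ ^ 2) := by positivity
  have hC9 : 0 < 1 / (160 * K ^ 6) := by positivity
  have ha := mul_pos hτ (tauStage_pos hI1 hI hC8 hα)
  have hη := etaStage_pos (LF := 9 * M ^ 7) hI1 hI hLF hC8 hC9 hα k
  have hη2 := etaStage_sq_le (m := m) (I := I) (C8 := 1 / (10 * K ^ 3 * τ ^ 2)) hLF hC9 hα k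
  set η := etaStage m I (9 * M ^ 7) (1 / (10 * K ^ 3 * τ ^ 2)) (1 / (160 * K ^ 6)) α k with hηd
  have ha2 : (τ * tauStage m I (1 / (10 * K ^ 3 * τ ^ 2)) α) ^ 2 =
      α * ((I : ℝ) / m) ^ 2 / (10 * K ^ 3) := by
    rw [tauStage, mul_pow, div_pow, mul_pow, Real.sq_sqrt (by positivity)]
    field_simp
  set a := τ * tauStage m I (1 / (10 * K ^ 3 * τ ^ 2)) α with had
  have hαq : α * ((I : ℝ) / m) ^ 2 ≤ 1 / 2 := by
    calc _ ≤ 1 / 2 * (1 : ℝ) ^ 2 := by gcongr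
      _ = _ := by norm_num
  have hαq0 : 0 ≤ α * ((I : ℝ) / m) ^ 2 := by positivity
  refine ⟨by positivity, hIm, ha, ?_, hη, ?_, hα, hα', ?_, ?_⟩
  · refine (abs_le_of_sq_le_sq' ?_ (by positivity)).2
    rw [ha2, div_pow 1 K, one_pow, div_le_div_iff₀ (by positivity) (by positivity)]
    have : K ^ 2 ≤ K ^ 3 := pow_le_pow_right₀ hK1 (by norm_num)
    calc _ ≤ 1 / 2 * K ^ 2 := by gcongr
      _ ≤ _ := by linarith [pow_pos hK0 2]
  · refine (abs_le_of_sq_le_sq' (hη2.trans ?_) (by positivity)).2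
    have h2 : (1 / (2 * K)) ^ 2 ≤ (1 / (2 * (9 * M ^ 7))) ^ 2 := by gcongr
    refine le_trans ?_ h2
    have : K ^ 2 ≤ K ^ 6 := pow_le_pow_right₀ hK1 (by norm_num)
    calc _ ≤ 1 / (160 * K ^ 6) * (1 / 2) := by gcongr
      _ = 1 / (320 * K ^ 6) := by field_simp; norm_num
      _ ≤ 1 / (4 * K ^ 2) := by gcongr; norm_num
      _ = _ := by field_simp; norm_num
  · rw [ha2]
    field_simp
    exact le_rfl
  · rw [ha2]
    calc _ ≤ 16 * K ^ 3 * (1 / (160 * K ^ 6) * (α * ((I : ℝ) / m) ^ 2)) := by gcongr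
      _ = _ := by field_simp; norm_num

/-! ### One stage -/

lemma admissible_iter (p : Problem m dx dy Ξ Z) {I B : ℕ} {lam τ : ℝ} {a : Params}
    {d : ℕ → Draw m B Ξ Z} {θ : State dx dy} (hθ : ∀ i, θ.H i ∈ matGe (dy i) lam) (n : ℕ) :
    Admissible lam (p.iter I lam τ a d θ n) := by
  induction n with
  | zero => exact fun i => ⟨hθ i, hθ i⟩
  | succ n ih => exact admissible_step p ih

lemma restarted_hess_mem (p : Problem m dx dy Ξ Z) {I B : ℕ} {lam τ : ℝ} {a : ℕ → Params}
    {d : ℕ → ℕ → Draw m B Ξ Z} {tt : ℕ → ℕ} {θ : State dx dy}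
    (hθ : ∀ i, θ.H i ∈ matGe (dy i) lam) (k : ℕ) :
    ∀ i, (p.restarted I lam τ a d tt θ k).H i ∈ matGe (dy i) lam := by
  induction k with
  | zero => exact hθ
  | succ k ih => exact fun i => (admissible_iter p ih _ i).2

namespace Problem.IsSampling

variable {p : Problem m dx dy Ξ Z} {I B : ℕ} {T : ℕ → ℕ} {Ω : Type w} [MeasurableSpace Ω]
  {Pr : Measure Ω} [IsProbabilityMeasure Pr] {d : ℕ → ℕ → Ω → Draw m B Ξ Z} {tt : ℕ → Ω → ℕ}
  (hs : p.IsSampling I B T Pr d tt) {lam M : ℝ} (hp : p.Bounds lam M) {τ : ℝ} {a : ℕ → Params}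
  {θ : State dx dy} {xstar : Vec dx} (hx : ∀ x, p.F xstar ≤ p.F x) {K : ℝ}
  (hK : 96 * M ^ 10 ≤ K) (hI : I ≤ m) (hI1 : 1 ≤ I) (hB : 1 ≤ B)
  (hθ : ∀ i, θ.H i ∈ matGe (dy i) lam)
include hs hp hx hK hI hI1 hB hθ

/-- The expected gain at the output of a stage. -/
lemma lintegral_gain_le {k : ℕ} (hT : 1 ≤ T (k + 1))
    (h : StepSizes M K (I / m) (τ * (a (k + 1)).tauT) (a (k + 1)).eta (a (k + 1)).alpha)
    (hbar : (a (k + 1)).alphaBar = (a (k + 1)).alpha) (hβ : (a (k + 1)).beta = (a (k + 1)).alpha)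
    {P : ℝ} (hP : 0 ≤ P)
    (hP' : ∫⁻ ω, ENNReal.ofReal (p.potential xstar K (I / m) (τ * (a (k + 1)).tauT) (a (k + 1)).eta
      (a (k + 1)).alpha (p.traj I lam τ a d tt θ k 0 ω)) ∂Pr ≤
        ENNReal.ofReal ((a (k + 1)).eta * P)) :
    ∫⁻ ω, ENNReal.ofReal (p.gain (p.traj I lam τ a d tt θ k (tt (k + 1) ω - 1) ω)) ∂Pr ≤
      ENNReal.ofReal (P / T (k + 1) + 16 * K ^ 4 * (a (k + 1)).alpha * noise m I B) := by
  have hρ := noise_nonneg m I B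
  have hK1 := hp.one_le_const hK
  have hK0 : 0 < K := by linarith
  have hη := h.eta_pos
  have hα := h.alpha_pos
  have hR := fun n => hs.measurable_traj hp τ a θ k n
  set pot := p.potential xstar K (I / m) (τ * (a (k + 1)).tauT) (a (k + 1)).eta (a (k + 1)).alpha
  set R := p.traj I lam τ a d tt θ k
  set η := (a (k + 1)).eta
  set c := 16 * K ^ 4 * η * (a (k + 1)).alpha * noise m I B with hc
  have hc0 : 0 ≤ c := by positivity
  have mpot : Measurable fun r => ENNReal.ofReal (pot r) :=
    (hp.measurable_potential _ _ _ _ _ _).ennreal_ofReal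
  have mgain : Measurable fun r => ENNReal.ofReal (η * p.gain r) :=
    (hp.measurable_gain.const_mul η).ennreal_ofReal
  have mR : ∀ n, Measurable fun ω => ENNReal.ofReal (η * p.gain (R n ω)) := fun n =>
    mgain.comp (hR n)
  have hstep : ∀ n, ∫⁻ ω, ENNReal.ofReal (pot (R (n + 1) ω)) ∂Pr
      + ∫⁻ ω, ENNReal.ofReal (η * p.gain (R n ω)) ∂Pr ≤
      ∫⁻ ω, ENNReal.ofReal (pot (R n ω)) ∂Pr + ENNReal.ofReal c := fun n => by
    rw [hs.lintegral_next hp τ a θ k n mpot, ← lintegral_add_right _ (mR n)]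
    calc _ ≤ ∫⁻ ω, (ENNReal.ofReal (pot (R n ω)) + ENNReal.ofReal c) ∂Pr :=
          lintegral_mono fun ω => hp.potential_step hx hK hI hI1 hB h hbar hβ
            (admissible_iter p (restarted_hess_mem p hθ k) n)
      _ = _ := by
          rw [lintegral_add_right _ measurable_const]
          simp
  -- Telescoping is kept in additive form, because [0, ∞] has no genuine subtraction.
  have hsum : ∀ N : ℕ, ∫⁻ ω, ENNReal.ofReal (pot (R N ω)) ∂Pr
      + ∑ n ∈ Finset.range N, ∫⁻ ω, ENNReal.ofReal (η * p.gain (R n ω)) ∂Pr ≤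
      ∫⁻ ω, ENNReal.ofReal (pot (R 0 ω)) ∂Pr + N * ENNReal.ofReal c := fun N => by
    induction N with
    | zero => simp
    | succ N ih =>
      rw [Finset.sum_range_succ]
      calc _ = (∫⁻ ω, ENNReal.ofReal (pot (R (N + 1) ω)) ∂Pr
            + ∫⁻ ω, ENNReal.ofReal (η * p.gain (R N ω)) ∂Pr)
            + ∑ n ∈ Finset.range N, ∫⁻ ω, ENNReal.ofReal (η * p.gain (R n ω)) ∂Pr := by ring
        _ ≤ (∫⁻ ω, ENNReal.ofReal (pot (R N ω)) ∂Pr + ENNReal.ofReal c)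
            + ∑ n ∈ Finset.range N, ∫⁻ ω, ENNReal.ofReal (η * p.gain (R n ω)) ∂Pr :=
              add_le_add (hstep N) le_rfl
        _ = (∫⁻ ω, ENNReal.ofReal (pot (R N ω)) ∂Pr
            + ∑ n ∈ Finset.range N, ∫⁻ ω, ENNReal.ofReal (η * p.gain (R n ω)) ∂Pr)
            + ENNReal.ofReal c := by ring
        _ ≤ (∫⁻ ω, ENNReal.ofReal (pot (R 0 ω)) ∂Pr + N * ENNReal.ofReal c)
            + ENNReal.ofReal c := by gcongr
        _ = _ := by push_cast; ring
  have hT0 : (0 : ℝ) < T (k + 1) := by exact_mod_cast hT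
  -- The pair with number n has the state of index n + 1 as its second component, so the output
  -- index t selects the pair t - 1.
  have hout : T (k + 1) * ∫⁻ ω, ENNReal.ofReal (η * p.gain (R (tt (k + 1) ω - 1) ω)) ∂Pr =
      ∑ n ∈ Finset.range (T (k + 1)), ∫⁻ ω, ENNReal.ofReal (η * p.gain (R n ω)) ∂Pr :=
    hs.lintegral_output hp τ a θ hT mgain
  have h1 : ENNReal.ofReal (T (k + 1) * η) *
      ∫⁻ ω, ENNReal.ofReal (p.gain (R (tt (k + 1) ω - 1) ω)) ∂Pr ≤
      ENNReal.ofReal (η * P + T (k + 1) * c) := by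
    have e1 : ∀ ω, ENNReal.ofReal (η * p.gain (R (tt (k + 1) ω - 1) ω)) =
        ENNReal.ofReal η * ENNReal.ofReal (p.gain (R (tt (k + 1) ω - 1) ω)) := fun ω =>
      ENNReal.ofReal_mul hη.le
    simp_rw [e1] at hout
    rw [lintegral_const_mul' _ _ ENNReal.ofReal_ne_top, ← mul_assoc] at hout
    rw [ENNReal.ofReal_mul hT0.le, ENNReal.ofReal_natCast, hout,
      ENNReal.ofReal_add (by positivity) (by positivity), ENNReal.ofReal_mul hT0.le,
      ENNReal.ofReal_natCast]
    refine (le_add_left le_rfl).trans ((hsum _).trans ?_)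
    gcongr
  have h2 : ENNReal.ofReal (T (k + 1) * η) ≠ 0 := by
    rw [Ne, ENNReal.ofReal_eq_zero, not_le]
    positivity
  rw [mul_comm, ← ENNReal.le_div_iff_mul_le (Or.inl h2) (Or.inl ENNReal.ofReal_ne_top),
    ← ENNReal.ofReal_div_of_pos (by positivity)] at h1
  refine h1.trans_eq (congrArg _ ?_)
  rw [hc]
  field_simp

/-- The expected gain at the output of a restarted stage. -/
lemma lintegral_gain_restart_le {k : ℕ} (hT : 1 ≤ T (k + 2))
    (h : StepSizes M K (I / m) (τ * (a (k + 2)).tauT) (a (k + 2)).eta (a (k + 2)).alpha)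
    (hbar : (a (k + 2)).alphaBar = (a (k + 2)).alpha) (hβ : (a (k + 2)).beta = (a (k + 2)).alpha)
    {μ : ℝ} (hμ : 0 < μ) {X : Set (Vec dx)} (hPL : p.PLOn μ xstar X)
    (hX : ∀ᵐ ω ∂Pr, (p.restarted I lam τ a (fun k t => d k t ω) (fun k => tt k ω) θ (k + 1)).x ∈ X)
    {W : ℝ} (hW : 0 ≤ W)
    (hW' : ∫⁻ ω, ENNReal.ofReal (p.gain (p.traj I lam τ a d tt θ k (tt (k + 1) ω - 1) ω)) ∂Pr ≤
      ENNReal.ofReal W) :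
    ∫⁻ ω, ENNReal.ofReal (p.gain (p.traj I lam τ a d tt θ (k + 1) (tt (k + 2) ω - 1) ω)) ∂Pr ≤
      ENNReal.ofReal (22 * K ^ 4 * (1 / (μ * (a (k + 2)).eta) + 1 / (τ * (a (k + 2)).tauT)
        + 1 / ((a (k + 2)).alpha * (I / m))) * W / T (k + 2)
        + 16 * K ^ 4 * (a (k + 2)).alpha * noise m I B) := by
  have hK1 := hp.one_le_const hK
  have hK0 : 0 < K := by linarith
  have hη := h.eta_pos
  have hα := h.alpha_pos
  have hq := h.q_pos
  have ha := h.a_pos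
  set C := 22 * K ^ 4 * (1 / (μ * (a (k + 2)).eta) + 1 / (τ * (a (k + 2)).tauT)
        + 1 / ((a (k + 2)).alpha * (I / m))) with hC
  have hC0 : 0 ≤ C := by positivity
  refine hs.lintegral_gain_le hp hx hK hI hI1 hB hθ (k := k + 1) hT h hbar hβ
    (mul_nonneg hC0 hW) ?_
  calc _ ≤ ∫⁻ ω, ENNReal.ofReal ((a (k + 2)).eta * C) *
        ENNReal.ofReal (p.gain (p.traj I lam τ a d tt θ k (tt (k + 1) ω - 1) ω)) ∂Pr := by
        refine lintegral_mono_ae ?_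
        filter_upwards [hX] with ω hω
        rw [← ENNReal.ofReal_mul (by positivity), mul_assoc]
        exact ENNReal.ofReal_le_ofReal (hp.potential_restart_le hK h (hI1.trans hI) hμ
          (admissible_iter p (restarted_hess_mem p hθ k) _) (hPL _ hω))
    _ ≤ _ := by
        have e : ENNReal.ofReal ((a (k + 2)).eta * (C * W)) =
            ENNReal.ofReal ((a (k + 2)).eta * C) * ENNReal.ofReal W := by
          rw [← mul_assoc, ENNReal.ofReal_mul (by positivity)]
        rw [lintegral_const_mul' _ _ ENNReal.ofReal_ne_top]
        exact (mul_le_mul_right hW' _).trans_eq e.symm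

omit [IsProbabilityMeasure Pr] hK hI hI1 hB hθ in
/-- The optimality gap at the output of a stage is at most `2 / μ` times the gain. -/
lemma gap_le {k : ℕ} {μ : ℝ} (hμ : 0 < μ) {X : Set (Vec dx)} (hPL : p.PLOn μ xstar X)
    (hX : ∀ᵐ ω ∂Pr, (p.restarted I lam τ a (fun k t => d k t ω) (fun k => tt k ω) θ (k + 1)).x ∈ X)
    {W : ℝ} (hW : 0 ≤ W)
    (hW' : ∫⁻ ω, ENNReal.ofReal (p.gain (p.traj I lam τ a d tt θ k (tt (k + 1) ω - 1) ω)) ∂Pr ≤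
      ENNReal.ofReal W) :
    Integrable (fun ω => p.F (p.restarted I lam τ a (fun k t => d k t ω) (fun k => tt k ω) θ
      (k + 1)).x - p.F xstar) Pr ∧
    ∫ ω, (p.F (p.restarted I lam τ a (fun k t => d k t ω) (fun k => tt k ω) θ (k + 1)).x
      - p.F xstar) ∂Pr ≤ 2 / μ * W := by
  have hm : Measurable fun ω => p.F (p.restarted I lam τ a (fun k t => d k t ω) (fun k => tt k ω) θ
      (k + 1)).x - p.F xstar :=
    (hp.measurable_F.comp (measurable_state_x.comp (hp.measurable_restarted τ a
      hs.measurable_index θ (k + 1) fun j _ t => hs.measurable_draw j t))).sub_const _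
  have h0 : ∀ ω, 0 ≤ p.F (p.restarted I lam τ a (fun k t => d k t ω) (fun k => tt k ω) θ
      (k + 1)).x - p.F xstar := fun ω => sub_nonneg.2 (hx _)
  have hle : ∫⁻ ω, ENNReal.ofReal (p.F (p.restarted I lam τ a (fun k t => d k t ω)
      (fun k => tt k ω) θ (k + 1)).x - p.F xstar) ∂Pr ≤ ENNReal.ofReal (2 / μ * W) := by
    calc _ ≤ ∫⁻ ω, ENNReal.ofReal (2 / μ) *
          ENNReal.ofReal (p.gain (p.traj I lam τ a d tt θ k (tt (k + 1) ω - 1) ω)) ∂Pr := by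
          refine lintegral_mono_ae ?_
          filter_upwards [hX] with ω hω
          rw [← ENNReal.ofReal_mul (by positivity)]
          refine ENNReal.ofReal_le_ofReal ?_
          have h1 := hPL _ hω
          set r := p.traj I lam τ a d tt θ k (tt (k + 1) ω - 1) ω with hr
          have h2 : ‖gradient p.F r.2.x‖ ^ 2 / 2 ≤ p.gain r := by
            have g1 := p.errZ_nonneg r
            have g2 := p.errY_nonneg r.2
            have g3 := p.errS_nonneg r
            have g4 := p.errH_nonneg r
            have g5 := incH_nonneg r
            have g6 := incXY_nonneg r
            have : 0 ≤ (p.errY r.2 + p.errS r + p.errH r + incH r + incXY r) / m := by positivity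
            unfold Problem.gain
            linarith
          have h3 : μ * (p.F r.2.x - p.F xstar) ≤ ‖gradient p.F r.2.x‖ ^ 2 := h1
          change p.F r.2.x - p.F xstar ≤ _
          rw [div_mul_eq_mul_div, le_div_iff₀ hμ]
          linarith
      _ ≤ _ := by
          rw [lintegral_const_mul' _ _ ENNReal.ofReal_ne_top, ENNReal.ofReal_mul (by positivity)]
          gcongr
  refine ⟨⟨hm.aestronglyMeasurable, ?_⟩, ?_⟩
  · rw [hasFiniteIntegral_iff_ofReal (Filter.Eventually.of_forall h0)]
    exact hle.trans_lt ENNReal.ofReal_lt_top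
  · rw [integral_eq_lintegral_of_nonneg_ae (Filter.Eventually.of_forall h0)
      hm.aestronglyMeasurable]
    exact ENNReal.toReal_le_of_le_ofReal (by positivity) hle

end Problem.IsSampling

end BSVRB

-- Assembling the stages

namespace BSVRB

open scoped RealInnerProductSpace ENNReal

lemma Consts.one_le_bound (c : Consts) (dmax : ℕ) : 1 ≤ c.bound dmax := by
  have e2 := inv_pos.2 c.lam_pos
  have e3 := c.Lfx_nonneg
  have e4 := c.Lfy_nonneg
  have e5 := c.Lgy_nonneg
  have e6 := c.Lgxy_nonneg
  have e7 := c.Lgyy_nonneg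
  have e8 := c.Cfx_nonneg
  have e9 := c.Cfy_nonneg
  have e10 := c.sigma_nonneg
  have e11 : (0 : ℝ) ≤ dmax := Nat.cast_nonneg _
  unfold Consts.bound
  linarith

lemma mul_epsStage {m I B : ℕ} {C μ α : ℝ} (hμ : 0 < μ) (k : ℕ) :
    μ * epsStage m I B C μ α (k + 1) = 21 * C * α * noise m I B / 2 ^ k := by
  unfold epsStage
  rw [Nat.add_sub_cancel]
  field_simp
  ring

/-- The length of a stage dominates each of the three terms of the restart bound; 176 = 22 · 8,
where 8 is the desired reduction. The factor m/I accounts for 1/q, and 2 + 1/τ for the two τ-free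
terms and the one with τ. -/
lemma restart_factor_le {K τ μ η t α q r L W : ℝ} (hK : 0 < K) (hτ : 0 < τ) (hμ : 0 < μ)
    (hη : 0 < η) (ht : 0 < t) (hr : 1 ≤ r) (hqr : 1 / q = r) (hW : 0 ≤ W)
    (hL : 176 * K ^ 4 * (2 + 1 / τ) * r * max (max (1 / (μ * η)) (1 / α)) (1 / t) ≤ L) :
    22 * K ^ 4 * (1 / (μ * η) + 1 / (τ * t) + 1 / (α * q)) * W / L ≤ W / 8 := by
  set X := max (max (1 / (μ * η)) (1 / α)) (1 / t) with hX
  have x1 : 1 / (μ * η) ≤ X := (le_max_left _ _).trans (le_max_left _ _)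
  have x2 : 1 / α ≤ X := (le_max_right _ _).trans (le_max_left _ _)
  have x3 : 1 / t ≤ X := le_max_right _ _
  have hX0 : 0 < X := lt_of_lt_of_le (by positivity) x3
  have hr0 : 0 < r := by linarith
  have hL0 : 0 < L := lt_of_lt_of_le (by positivity) hL
  have y1 : 1 / (μ * η) ≤ r * X := x1.trans (le_mul_of_one_le_left hX0.le hr)
  have y2 : 1 / (τ * t) ≤ 1 / τ * (r * X) := by
    calc _ = 1 / τ * (1 / t) := by field_simp
      _ ≤ _ := by
        gcongr
        exact x3.trans (le_mul_of_one_le_left hX0.le hr)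
  have y3 : 1 / (α * q) ≤ r * X := by
    calc _ = 1 / q * (1 / α) := by rw [one_div_mul_one_div_rev]
      _ ≤ _ := by rw [hqr]; gcongr
  rw [div_le_div_iff₀ hL0 (by norm_num)]
  calc _ ≤ 22 * K ^ 4 * (r * X + 1 / τ * (r * X) + r * X) * W * 8 := by gcongr
    _ = W * (176 * K ^ 4 * (2 + 1 / τ) * r * X) := by ring
    _ ≤ W * L := by gcongr

variable {m dx : ℕ} {dy : Fin m → ℕ} {Ξ : Type u} {Z : Type v}
  [MeasurableSpace Ξ] [MeasurableSpace Z]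

namespace Problem.Bounds

variable {p : Problem m dx dy Ξ Z} {lam M : ℝ} (hp : p.Bounds lam M)
include hp

/-- PL and smoothness bound the squared gradient from below and above by multiples of the gap; for μ
> 2L_F they are compatible only if the gap is zero. -/
lemma eq_min_of_lt {μ : ℝ} (hμ : 18 * M ^ 7 < μ) {xstar x : Vec dx} {X : Set (Vec dx)}
    (hx : ∀ x, p.F xstar ≤ p.F x) (hPL : p.PLOn μ xstar X) (hxX : x ∈ X) :
    p.F x - p.F xstar = 0 := by
  have h1 := (hPL x hxX).trans (hp.norm_gradient_sq_le hx x)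
  have h2 := sub_nonneg.2 (hx x)
  have h3 : (μ - 18 * M ^ 7) * (p.F x - p.F xstar) ≤ 0 := by linarith
  exact le_antisymm (nonpos_of_mul_nonpos_right h3 (by linarith)) h2

end Problem.Bounds

end BSVRB

/-- For `X = Set.univ`, `PLOn` is the PL condition on the whole space; any set that contains the outputs
of all stages is enough.
`C10 * (m / I)` and `CT * (m / I)` are the constant `C₁₀` and the constant hidden in the bound
`T_k = O(max {1/(μ η_k), 1/β_k, 1/τ_k})`, with their dependence on `m / I` written out; `CT1` is the
constant hidden in the bound for `T_1`. The conclusion holds for all stage lengths above these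
thresholds, in particular for the least ones. -/
theorem mainTheorem3 (c : BSVRB.Consts) (dmax : ℕ) (τ : ℝ) (hτ : 0 < τ)
    (hτg : τ ≤ 2 / (3 * c.Lg)) :
    ∃ LF C8 C9 C10 CT : ℝ, 0 < LF ∧ 0 < C8 ∧ 0 < C9 ∧ 0 < C10 ∧ 0 < CT ∧
    ∀ m I B : ℕ, 1 ≤ I → I ≤ m → 1 ≤ B →
    ∀ D0 α1 : ℝ, 0 < α1 → α1 ≤ 1 / 2 →
    ∃ CT1 : ℝ, 0 < CT1 ∧
    ∀ (dx : ℕ) (dy : Fin m → ℕ), (∀ i, dy i ≤ dmax) →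
    ∀ (Ξ : Type u) (Z : Type v) [MeasurableSpace Ξ] [MeasurableSpace Z]
      (p : BSVRB.Problem m dx dy Ξ Z),
      p.Standing → p.Assumption1 c → p.Assumption2 c →
      (Differentiable ℝ p.F ∧
        ∀ x x', ‖gradient p.F x - gradient p.F x'‖ ≤ LF * ‖x - x'‖) ∧
      ∀ (μ : ℝ) (xstar : BSVRB.Vec dx) (X : Set (BSVRB.Vec dx)),
        0 < μ → (∀ x, p.F xstar ≤ p.F x) → p.PLOn μ xstar X →
      ∀ θ : BSVRB.State dx dy, p.InitBound c.lam xstar θ D0 →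
      ∀ α : ℕ → ℝ, α 1 = α1 →
        (∀ k, 2 ≤ k → 0 < α k ∧
          α k ≤ μ * BSVRB.epsStage m I B (C10 * (m / I)) μ α1 k / (21 * (C10 * (m / I)))
            * (BSVRB.noise m I B)⁻¹) →
      ∀ T : ℕ → ℕ,
        CT1 * max (max (m / (μ * BSVRB.etaStage m I LF C8 C9 α1 1))
            (m / (μ * α1) * (BSVRB.noise m I B)⁻¹))
            (m / (μ * BSVRB.tauStage m I C8 α1) * (BSVRB.noise m I B)⁻¹) ≤ T 1 →
        (∀ k, 2 ≤ k →
          CT * (m / I) * max (max (1 / (μ * BSVRB.etaStage m I LF C8 C9 (α k) k)) (1 / α k))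
            (1 / BSVRB.tauStage m I C8 (α k)) ≤ T k) →
      ∀ (Ω : Type w) [MeasurableSpace Ω] (Pr : MeasureTheory.Measure Ω)
        [MeasureTheory.IsProbabilityMeasure Pr]
        (d : ℕ → ℕ → Ω → BSVRB.Draw m B Ξ Z) (tt : ℕ → Ω → ℕ),
        p.IsSampling I B T Pr d tt →
      ∀ (ε : ℝ) (K : ℕ), 0 < ε → 1 ≤ K →
        1 + Real.logb 2 (BSVRB.epsStage m I B (C10 * (m / I)) μ α1 1 / ε) ≤ K →
        let xOut : ℕ → Ω → BSVRB.Vec dx := fun k ω =>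
          (p.restarted I c.lam τ (BSVRB.stageParams m I LF C8 C9 α)
            (fun k t => d k t ω) (fun k => tt k ω) θ k).x
        (∀ k, 1 ≤ k → k ≤ K → ∀ᵐ ω ∂Pr, xOut k ω ∈ X) →
        MeasureTheory.Integrable (fun ω => p.F (xOut K ω) - p.F xstar) Pr ∧
          ∫ ω, (p.F (xOut K ω) - p.F xstar) ∂Pr ≤ ε := by
  set M := c.bound dmax with hMdef
  have hM : 1 ≤ M := c.one_le_bound dmax
  have hM0 : 0 < M := by linarith
  set K := 96 * M ^ 10 with hKdef
  have hK9 : 9 * M ^ 7 ≤ K := by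
    rw [hKdef]
    gcongr <;> norm_num [hM]
  have hK1 : 1 ≤ K := by
    have := one_le_pow₀ hM (n := 7)
    linarith
  have hK0 : 0 < K := by linarith
  set C8 := 1 / (10 * K ^ 3 * τ ^ 2) with hC8
  set C9 := 1 / (160 * K ^ 6) with hC9
  have hC80 : 0 < C8 := by positivity
  have hC90 : 0 < C9 := by positivity
  have hLF0 : 0 < 9 * M ^ 7 := by positivity
  refine ⟨9 * M ^ 7, C8, C9, 16 * K ^ 4, 176 * K ^ 4 * (2 + 1 / τ), hLF0, hC80, hC90, by positivity,
    by positivity, ?_⟩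
  intro m I B hI1 hI hB D0 α1 hα1 hα1'
  have hI0 : (0 : ℝ) < I := by exact_mod_cast hI1
  have hm0 : (0 : ℝ) < m := by exact_mod_cast hI1.trans hI
  have hr1 : (1 : ℝ) ≤ m / I := by
    rw [le_div_iff₀ hI0, one_mul]
    exact_mod_cast hI
  have hρ : 0 < BSVRB.noise m I B := BSVRB.noise_pos hB
  have hS1 := BSVRB.stepSizes_stage hI1 hI hM hK9 hK1 hτ hα1 hα1' 1
  rw [← hC8, ← hC9] at hS1
  set ρ := BSVRB.noise m I B with hρd
  set η1 := BSVRB.etaStage m I (9 * M ^ 7) C8 C9 α1 1 with hη1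
  have hη10 : 0 < η1 := hS1.eta_pos
  have hq0 : (0 : ℝ) < I / m := hS1.q_pos
  have ha10 := hS1.a_pos
  set a1 := τ * BSVRB.tauStage m I C8 α1 with ha1
  -- This is μ ε₁; the factor μ cancels, so the target for the gain does not depend on μ.
  set E := 21 * (16 * K ^ 4 * (m / I)) * α1 * ρ with hE
  have hE0 : 0 < E := by positivity
  -- The bound of the initial potential divided by η₁. The maximum with 0 covers a negative `D0`.
  set P := max D0 0 * (1 + 2 * K * η1 / α1 + 2 * K ^ 2 * (η1 / m) / a1
    + 3 * K ^ 3 * (η1 / m) / (α1 * (I / m)) + 6 * K ^ 3 * (η1 / m) / (α1 * (I / m)) * K) / η1 with hP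
  have hP0 : 0 ≤ P := by
    have : 0 ≤ max D0 0 := le_max_right _ _
    positivity
  -- Multiplied by m/(μη₁), the first summand is (18M⁷/μ)(4P/E), which is at least 4P/E when μ ≤
  -- 18M⁷. The summand 1 keeps the constant positive when P = 0.
  refine ⟨18 * M ^ 7 * η1 / m * (4 * P / E) + 1, by positivity, ?_⟩
  intro dx dy hdy Ξ Z _ _ p hst h1 h2
  have hp : p.Bounds c.lam M := BSVRB.Problem.bounds_of_assumptions hdy hst h1 h2
  refine ⟨⟨hp.differentiable_F, hp.gradient_lip⟩, ?_⟩
  intro μ xstar X hμ hx hPL θ hθ α hαe hαk T hT1 hTk Ω _ Pr _ d tt hs ε N hε hN hNε xOut hX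
  obtain ⟨n, rfl⟩ : ∃ n, N = n + 1 := ⟨N - 1, by omega⟩
  rcases lt_or_ge (18 * M ^ 7) μ with hμM | hμM
  · have h0 : (fun ω => p.F (xOut (n + 1) ω) - p.F xstar) =ᵐ[Pr] fun _ => (0 : ℝ) := by
      filter_upwards [hX (n + 1) hN le_rfl] with ω hω
      exact hp.eq_min_of_lt hμM hx hPL hω
    exact ⟨(integrable_const (0 : ℝ)).congr h0.symm, by
      rw [integral_congr_ae h0, integral_zero]; exact hε.le⟩
  -- In the prescribed bound on the step sizes μ, C₁₀ and the noise cancel, leaving α_{k+1} ≤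
  -- α₁/2^k. Therefore the noise of stage k + 1 is at most 1/21 of E/2^k.
  have hα : ∀ k, 0 < α (k + 1) ∧ 16 * K ^ 4 * α (k + 1) * ρ ≤ E / 2 ^ k / 21 ∧
      α (k + 1) ≤ 1 / 2 := fun k => by
    have hα1k : ∀ x : ℝ, x ≤ α1 / 2 ^ k → 16 * K ^ 4 * x * ρ ≤ E / 2 ^ k / 21 ∧ x ≤ 1 / 2 :=
      fun x hxk => by
        constructor
        · calc _ ≤ 16 * K ^ 4 * 1 * (α1 / 2 ^ k) * ρ := by rw [mul_one]; gcongr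
            _ ≤ 16 * K ^ 4 * (m / I) * (α1 / 2 ^ k) * ρ := by gcongr
            _ = _ := by rw [hE]; ring
        · refine hxk.trans ((div_le_self hα1.le (one_le_pow₀ one_le_two)).trans hα1')
    rcases Nat.eq_zero_or_pos k with rfl | hk
    · rw [zero_add, hαe]
      exact ⟨hα1, hα1k α1 (by simp)⟩
    · obtain ⟨g1, g2⟩ := hαk (k + 1) (by omega)
      refine ⟨g1, hα1k _ (g2.trans_eq ?_)⟩
      rw [BSVRB.mul_epsStage hμ, ← hρd]
      field_simp
  have hT11 : 1 ≤ T 1 := by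
    have hpos : 0 < max (max (m / (μ * η1)) (m / (μ * α1) * ρ⁻¹))
        (m / (μ * BSVRB.tauStage m I C8 α1) * ρ⁻¹) :=
      lt_max_of_lt_left (lt_max_of_lt_left (by positivity))
    have : (0 : ℝ) < T 1 := lt_of_lt_of_le (by positivity) hT1
    exact_mod_cast this
  -- The expected gain at the output of stage j + 1 is at most half of μ ε_{j+1}. In the first stage
  -- the two parts are 1/4 and 1/21 of E; later they are 1/8 and 1/21 of the previous bound, with
  -- sum below 1/2.
  have key : ∀ j, j ≤ n → ∫⁻ ω, ENNReal.ofReal (p.gain (p.traj I c.lam τ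
      (BSVRB.stageParams m I (9 * M ^ 7) C8 C9 α) d tt θ j (tt (j + 1) ω - 1) ω)) ∂Pr ≤
      ENNReal.ofReal (E / 2 ^ j / 2) := by
    intro j
    induction j with
    | zero =>
      intro _
      have hinit := hp.potential_init_le (K := K) le_rfl hS1 (D0 := max D0 0) (xstar := xstar) (θ := θ)
        ⟨hθ.hess_mem, hθ.gap.trans (le_max_left _ _), hθ.err_z.trans (le_max_left _ _),
          hθ.err_y.trans (le_max_left _ _), hθ.err_s.trans (le_max_left _ _),
          hθ.err_H.trans (le_max_left _ _)⟩
      have hS : BSVRB.StepSizes M K (I / m)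
          (τ * (BSVRB.stageParams m I (9 * M ^ 7) C8 C9 α (0 + 1)).tauT)
          (BSVRB.stageParams m I (9 * M ^ 7) C8 C9 α (0 + 1)).eta
          (BSVRB.stageParams m I (9 * M ^ 7) C8 C9 α (0 + 1)).alpha := by
        simp only [zero_add, BSVRB.stageParams, hαe]
        exact hS1
      refine (hs.lintegral_gain_le hp hx le_rfl hI hI1 hB hθ.hess_mem hT11 hS rfl rfl hP0 ?_).trans
        (ENNReal.ofReal_le_ofReal ?_)
      · have hc : ∀ ω, p.traj I c.lam τ (BSVRB.stageParams m I (9 * M ^ 7) C8 C9 α) d tt θ 0 0 ω =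
          (θ, θ) := fun ω => rfl
        simp only [hc, lintegral_const, measure_univ, mul_one]
        refine ENNReal.ofReal_le_ofReal ?_
        simp only [zero_add, BSVRB.stageParams, hαe]
        refine hinit.trans_eq ?_
        rw [hP, ← hη1]
        field_simp
      · obtain ⟨_, g2, _⟩ := hα 0
        have hTle : 4 * P / E ≤ T 1 := by
          have hx1 : m / (μ * η1) ≤ max (max (m / (μ * η1)) (m / (μ * α1) * ρ⁻¹))
            (m / (μ * BSVRB.tauStage m I C8 α1) * ρ⁻¹) := (le_max_left _ _).trans (le_max_left _ _)
          refine le_trans ?_ hT1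
          calc 4 * P / E = 1 * (4 * P / E) := (one_mul _).symm
            _ ≤ 18 * M ^ 7 / μ * (4 * P / E) := by
                gcongr
                rwa [le_div_iff₀ hμ, one_mul]
            _ = 18 * M ^ 7 * η1 / m * (4 * P / E) * (m / (μ * η1)) := by field_simp
            _ ≤ (18 * M ^ 7 * η1 / m * (4 * P / E) + 1) * (m / (μ * η1)) := by
                gcongr
                linarith
            _ ≤ _ := by gcongr
        have hT0 : (0 : ℝ) < T 1 := by exact_mod_cast hT11
        have hPT : P / T 1 ≤ E / 4 := by
          rw [div_le_iff₀ hE0] at hTle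
          rw [div_le_iff₀ hT0]
          linarith
        change P / T 1 + 16 * K ^ 4 * α (0 + 1) * ρ ≤ _
        rw [pow_zero, div_one] at g2 ⊢
        linarith
    | succ j ih =>
      intro hj
      obtain ⟨g1, g2, g3⟩ := hα (j + 1)
      have hS := BSVRB.stepSizes_stage hI1 hI hM hK9 hK1 hτ g1 g3 (j + 2)
      rw [← hC8, ← hC9] at hS
      have htau := BSVRB.tauStage_pos hI1 hI hC80 g1
      have hTj := hTk (j + 2) (by omega)
      have hTj1 : 1 ≤ T (j + 2) := by
        have hpos : 0 < max (max (1 / (μ * BSVRB.etaStage m I (9 * M ^ 7) C8 C9 (α (j + 2)) (j + 2)))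
            (1 / α (j + 2))) (1 / BSVRB.tauStage m I C8 (α (j + 2))) :=
          lt_max_of_lt_right (by positivity)
        have : (0 : ℝ) < T (j + 2) := lt_of_lt_of_le (by positivity) hTj
        exact_mod_cast this
      refine (hs.lintegral_gain_restart_le hp hx le_rfl hI hI1 hB hθ.hess_mem (k := j) hTj1 hS rfl rfl
        hμ hPL (hX (j + 1) (by omega) (by omega)) (by positivity) (ih (by omega))).trans
        (ENNReal.ofReal_le_ofReal ?_)
      have hf := BSVRB.restart_factor_le (W := E / 2 ^ j / 2) (q := I / m) hK0 hτ hμ hS.eta_pos htau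
        hr1 (by rw [one_div_div]) (by positivity) hTj
      have e1 : E / 2 ^ (j + 1) = E / 2 ^ j / 2 := by rw [pow_succ]; field_simp
      rw [e1] at g2 ⊢
      have : 0 < E / 2 ^ j / 2 := by positivity
      refine (add_le_add hf g2).trans ?_
      linarith
  obtain ⟨r1, r2⟩ := hs.gap_le hp hx (a := BSVRB.stageParams m I (9 * M ^ 7) C8 C9 α) (k := n) hμ hPL
    (hX (n + 1) hN le_rfl) (by positivity) (key n le_rfl)
  refine ⟨r1, r2.trans ?_⟩
  have e1 : μ * BSVRB.epsStage m I B (16 * K ^ 4 * (m / I)) μ α1 1 = E := by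
    have := BSVRB.mul_epsStage (m := m) (I := I) (B := B) (C := 16 * K ^ 4 * (m / I)) (α := α1) hμ 0
    rw [zero_add] at this
    rw [this, pow_zero, div_one]
  have e2 : BSVRB.epsStage m I B (16 * K ^ 4 * (m / I)) μ α1 1 = E / μ := by
    rw [← e1]
    field_simp
  rw [e2] at hNε
  push_cast at hNε
  -- Since K = n + 1, the assumption on K says E/μ ≤ 2ⁿ ε; the factor 2/μ of the gap bound cancels
  -- the last half in the bound of the gain.
  have h3 : Real.logb 2 (E / μ / ε) ≤ n := by linarith
  rw [Real.logb_le_iff_le_rpow one_lt_two (by positivity), Real.rpow_natCast,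
    div_le_iff₀ hε] at h3
  calc 2 / μ * (E / 2 ^ n / 2) = E / μ / 2 ^ n := by field_simp
    _ ≤ ε := by
      rw [div_le_iff₀ (by positivity)]
      linarith
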